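/- \textbf{Definitions.} A strict preference system $(G,\prec)$ is a finite simple graph $G=(V,E)$ together with, for each vertex $v$, a strict linear order $\prec_v$ on the set $N_G(v)$ of its neighbours; $v$ prefers $b$ to $a$ if $a\prec_v b$. A matching is a set $M\subseteq E$ of edges no two of which share an endpoint, and $M(v)$ denotes the partner of a matched vertex $v$. An edge $(a,b)\in E$ blocks $M$ if $a$ is unmatched or prefers $b$ to $M(a)$, and $b$ is unmatched or prefers $a$ to $M(b)$; $\mathrm{bp}_G(M)$ is the set of blocking edges, and $M$ is stable if $\mathrm{bp}_G(M)=\emptyset$. A vertex $v$ prefers a matching $M$ to a matching $M'$ if $v$ is matched in $M$ and is either unmatched in $M'$ or satisfies $M'(v)\prec_v M(v)$. A matching $M$ is popular if there is no matching $M'$ such that more vertices prefer $M'$ to $M$ than prefer $M$ to $M'$. For $S\subseteq E$, $G-S$ is $G$ with the edges of $S$ deleted and the preferences restricted accordingly. If $G=(A,B;E)$ is bipartite, a master list over $A$ is a strict linear order on $A$ whose restriction to $N_G(b)$ is $\prec_b$ for every $b\in B$; a master list over $B$ is defined symmetrically. The system $(G,\prec)$ admits a master list on one side if there is a master list over $A$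 or over $B$. In the problem \textsc{Popularity with Fixed Instability}, the input is a strict preference system $(G,\prec)$ and a set $S\subseteq E$, and the task is to find a solution, i.e. a popular matching $M$ in $G$ with $\mathrm{bp}_G(M)=S$, or to report that there is none. \textbf{Theorem.} Consider the instances $(G,\prec,S)$ of \textsc{Popularity with Fixed Instability} in which $G=(A,B;E)$ is bipartite and $(G,\prec)$ admits a master list on one side. (1) These instances can be solved in $O(|E|)$ time: there are a program for a unit-cost random access machine (with constants, copying, addition, truncated subtraction, indirect memory access and comparison) and a constant $C$ such that, for every such instance, given by the preference lists of the vertices of $A$ and of $B$ with the edges of $S$ marked (isolated vertices take no space in the input), the program halts after at most $C(|E|+1)$ steps, computes no number exceeding $C(|V|+|E|+1)$, and outputs a solution if one exists and ``no'' otherwise. The master list is not part of the input. (2) For every such instance, $G-S$ has exactly one stable matching, and every solution is equal to it. -/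

import Mathlib

/-- A strict preference system on the vertex set `V`: a simple graph together with, for each
vertex `v`, a strict linear order on the set of neighbours of `v`.  `lt v a b` is `a ≺_v b`,
that is, `v` prefers `b` to `a`; it relates neighbours of `v` only. -/
structure PrefSystem (V : Type*) where
  graph : SimpleGraph V
  lt : V → V → V → Prop
  dom : ∀ v a b, lt v a b → graph.Adj v a ∧ graph.Adj v b
  irrefl : ∀ v a, ¬ lt v a a
  trans : ∀ v a b c, lt v a b → lt v b c → lt v a c
  total : ∀ v a b, graph.Adj v a → graph.Adj v b → a ≠ b → lt v a b ∨ lt v b a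

namespace PrefSystem

variable {V : Type*}

/-- The set of edges of the graph. -/
def edges (P : PrefSystem V) : Set (Sym2 V) := P.graph.edgeSet

/-- Deletion of a set `S` of edges: the preferences are restricted to the remaining
neighbours. -/
def deleteEdges (P : PrefSystem V) (S : Set (Sym2 V)) : PrefSystem V where
  graph := P.graph.deleteEdges S
  lt v a b := P.lt v a b ∧ (P.graph.deleteEdges S).Adj v a ∧ (P.graph.deleteEdges S).Adj v b
  dom _ _ _ h := h.2
  irrefl v a h := P.irrefl v a h.1
  trans v a b c h₁ h₂ := ⟨P.trans v a b c h₁.1 h₂.1, h₁.2.1, h₂.2.2⟩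
  total v a b ha hb hne := by
    rcases P.total v a b (SimpleGraph.deleteEdges_le S ha) (SimpleGraph.deleteEdges_le S hb) hne
      with h | h
    · exact Or.inl ⟨h, ha, hb⟩
    · exact Or.inr ⟨h, hb, ha⟩

/-- A matching is a set of edges no two of which share an endpoint. -/
def IsMatching (P : PrefSystem V) (M : Set (Sym2 V)) : Prop :=
  M ⊆ P.edges ∧ ∀ e ∈ M, ∀ f ∈ M, ∀ v, v ∈ e → v ∈ f → e = f

/-- `v` is unmatched in `M`, or `v` prefers `u` to its partner in `M`. -/
def Wants (P : PrefSystem V) (M : Set (Sym2 V)) (v u : V) : Prop :=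
  ∀ w, s(v, w) ∈ M → P.lt v w u

/-- The set of blocking edges of `M`. -/
def bp (P : PrefSystem V) (M : Set (Sym2 V)) : Set (Sym2 V) :=
  {e | ∃ a b, e = s(a, b) ∧ P.graph.Adj a b ∧ P.Wants M a b ∧ P.Wants M b a}

/-- Stable matchings. -/
def IsStable (P : PrefSystem V) (M : Set (Sym2 V)) : Prop :=
  P.IsMatching M ∧ P.bp M = ∅

/-- `v` prefers the matching `M` to the matching `M'`: it is matched in `M`, and in `M'` it is
unmatched or matched to a vertex that it likes less. -/
def VertexPrefers (P : PrefSystem V) (M M' : Set (Sym2 V)) (v : V) : Prop :=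
  ∃ u, s(v, u) ∈ M ∧ ∀ w, s(v, w) ∈ M' → P.lt v w u

/-- More vertices prefer `M` to `M'` than vice versa (`V` is finite in all uses). -/
def MorePopular (P : PrefSystem V) (M M' : Set (Sym2 V)) : Prop :=
  {v | P.VertexPrefers M' M v}.ncard < {v | P.VertexPrefers M M' v}.ncard

/-- Popular matchings. -/
def IsPopular (P : PrefSystem V) (M : Set (Sym2 V)) : Prop :=
  P.IsMatching M ∧ ∀ M', P.IsMatching M' → ¬ P.MorePopular M' M

/-- `M` is a solution of the instance `(P, S)` of Popularity with Fixed Instability. -/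
def IsSolution (P : PrefSystem V) (S M : Set (Sym2 V)) : Prop :=
  P.IsPopular M ∧ P.bp M = S

/-- There is a master list over `A`: a linear ordering of all vertices of `A` whose restriction to
the neighbourhood of each `b ∈ B` is the preference order of `b`. -/
def HasMasterList (P : PrefSystem V) (A B : Set V) : Prop :=
  ∃ r : A → A → Prop, IsStrictTotalOrder A r ∧
    ∀ b ∈ B, ∀ a a' : A, P.graph.Adj b a → P.graph.Adj b a' → (P.lt b a a' ↔ r a a')

/-- `(P, S)` is an instance of Popularity with Fixed Instability, `P` is bipartite with sides `A`
and `B`, and `P` admits a master list on one side. -/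
structure IsMasterListInstance (P : PrefSystem V) (A B : Set V) (S : Set (Sym2 V)) : Prop where
  subset : S ⊆ P.edges
  bipartite : P.graph.IsBipartiteWith A B
  cover : A ∪ B = Set.univ
  master : P.HasMasterList A B ∨ P.HasMasterList B A

/-- `l` is the preference list of `v`: all its neighbours, in decreasing order of preference. -/
def IsPrefList (P : PrefSystem V) (v : V) (l : List V) : Prop :=
  (∀ u, u ∈ l ↔ P.graph.Adj v u) ∧ l.Pairwise (fun a b => P.lt v b a)

end PrefSystem

/-! ### Random access machine

Programs act on registers and on a memory, both indexed by `ℕ` and holding natural numbers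
(each program mentions finitely many registers).  Control flow is structured.  Each
elementary instruction and each evaluation of a test costs one step. -/

/-- Programs of the random access machine. -/
inductive RamProg where
  | skip
  | const (r c : ℕ)
  | copy (r i : ℕ)
  | add (r i j : ℕ)
  | sub (r i j : ℕ)
  | load (r i : ℕ)
  | store (i j : ℕ)
  | seq (p q : RamProg)
  | ifLt (i j : ℕ) (p q : RamProg)
  | whileLt (i j : ℕ) (p : RamProg)

/-- Contents of the registers and of the memory. -/
structure RamState where
  reg : ℕ → ℕ
  mem : ℕ → ℕ

/-- Write `x` into register `r`. -/
def RamState.setReg (s : RamState) (r x : ℕ) : RamState := ⟨Function.update s.reg r x, s.mem⟩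

/-- Write `x` into the memory cell with address `a`. -/
def RamState.setMem (s : RamState) (a x : ℕ) : RamState := ⟨s.reg, Function.update s.mem a x⟩

/-- `RamExec W p s t s'`: started in `s`, the program `p` halts after exactly `t` steps in `s'`, and
no number greater than `W` is ever computed (a computation that overflows the word bound `W` has no
result). The semantics is deterministic. -/
inductive RamExec (W : ℕ) : RamProg → RamState → ℕ → RamState → Prop where
  | skip (s) : RamExec W .skip s 1 s
  | const (s r c) (h : c ≤ W) : RamExec W (.const r c) s 1 (s.setReg r c)
  | copy (s r i) : RamExec W (.copy r i) s 1 (s.setReg r (s.reg i))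
  | add (s r i j) (h : s.reg i + s.reg j ≤ W) :
      RamExec W (.add r i j) s 1 (s.setReg r (s.reg i + s.reg j))
  | sub (s r i j) : RamExec W (.sub r i j) s 1 (s.setReg r (s.reg i - s.reg j))
  | load (s r i) : RamExec W (.load r i) s 1 (s.setReg r (s.mem (s.reg i)))
  | store (s i j) : RamExec W (.store i j) s 1 (s.setMem (s.reg i) (s.reg j))
  | seq (p q s₁ t₁ s₂ t₂ s₃) (hp : RamExec W p s₁ t₁ s₂) (hq : RamExec W q s₂ t₂ s₃) :
      RamExec W (.seq p q) s₁ (t₁ + t₂) s₃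
  | ifTrue (i j p q s t s') (h : s.reg i < s.reg j) (hp : RamExec W p s t s') :
      RamExec W (.ifLt i j p q) s (1 + t) s'
  | ifFalse (i j p q s t s') (h : ¬ s.reg i < s.reg j) (hq : RamExec W q s t s') :
      RamExec W (.ifLt i j p q) s (1 + t) s'
  | whileDone (i j p s) (h : ¬ s.reg i < s.reg j) : RamExec W (.whileLt i j p) s 1 s
  | whileStep (i j p s₁ t₁ s₂ t₂ s₃) (h : s₁.reg i < s₁.reg j) (hp : RamExec W p s₁ t₁ s₂)
      (hw : RamExec W (.whileLt i j p) s₂ t₂ s₃) :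
      RamExec W (.whileLt i j p) s₁ (1 + t₁ + t₂) s₃

/-- Initial state: the input occupies the memory cells `0, 1, …`; all else is `0`. -/
def RamState.init (input : List ℕ) : RamState := ⟨fun _ => 0, fun a => input.getD a 0⟩

/-! ### Input and output -/

open Classical in
/-- The block describing the vertex `v` with preference list `l`: the vertex, its degree, and, for
each neighbour in decreasing order of preference, the neighbour and a bit telling whether the edge
lies in `S`. -/
noncomputable def vertexBlock {n : ℕ} (S : Set (Sym2 (Fin n))) (v : Fin n) (l : List (Fin n)) :
    List ℕ :=
  (v : ℕ) :: l.length :: l.flatMap (fun u : Fin n => [(u : ℕ), if s(v, u) ∈ S then 1 else 0])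

/-- `w` encodes the bipartite instance `(P, S)` with sides `A` and `B`: the numbers of vertices
with non-empty preference lists in `A` and in `B`, followed by the blocks of those of `A` and then
by the blocks of those of `B`, the vertices of each side being in arbitrary order. Isolated vertices
take no space, so that the input consists of `Θ(|E| + 1)` words. -/
def IsEncoding {n : ℕ} (P : PrefSystem (Fin n)) (A B : Set (Fin n)) (S : Set (Sym2 (Fin n)))
    (w : List ℕ) : Prop :=
  ∃ (pl : Fin n → List (Fin n)) (as bs : List (Fin n)),
    (∀ v, P.IsPrefList v (pl v)) ∧
    as.Nodup ∧ (∀ v, v ∈ as ↔ v ∈ A ∧ pl v ≠ []) ∧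
    bs.Nodup ∧ (∀ v, v ∈ bs ↔ v ∈ B ∧ pl v ≠ []) ∧
    w = as.length :: bs.length :: (as ++ bs).flatMap (fun v => vertexBlock S v (pl v))

/-- The state `s` presents the edge set `M`: register `1` holds an address from which on the
memory lists the edges of `M` without repetition, each as a pair of vertices, and register `2`
holds their number. -/
def RamState.Presents {n : ℕ} (s : RamState) (M : Set (Sym2 (Fin n))) : Prop :=
  ∃ L : List (Fin n × Fin n), (L.map (fun q => s(q.1, q.2))).Nodup ∧
    (∀ e, e ∈ M ↔ e ∈ L.map (fun q => s(q.1, q.2))) ∧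
    s.reg 2 = L.length ∧
    ∀ (i : ℕ) (h : i < L.length),
      s.mem (s.reg 1 + 2 * i) = (L[i].1 : ℕ) ∧ s.mem (s.reg 1 + 2 * i + 1) = (L[i].2 : ℕ)

/-- The final state `s` is a correct answer for the instance `(P, S)`: if there is a solution, then
register `0` holds `1` and `s` presents a solution; otherwise register `0` holds `0`. -/
def IsCorrectAnswer {n : ℕ} (P : PrefSystem (Fin n)) (S : Set (Sym2 (Fin n))) (s : RamState) :
    Prop :=
  ((∃ M, P.IsSolution S M) → s.reg 0 = 1 ∧ ∃ M, P.IsSolution S M ∧ s.Presents M) ∧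
  ((¬ ∃ M, P.IsSolution S M) → s.reg 0 = 0)

/-- The program `p` solves, in `O(|E|)` steps and with words of size logarithmic in `|V| + |E|`, all
bipartite instances of Popularity with Fixed Instability with a master list on one side.  (The
summand `+ 1` is there for edgeless graphs.) -/
def SolvesInLinearTime (p : RamProg) : Prop :=
  ∃ C : ℕ, ∀ (n : ℕ) (P : PrefSystem (Fin n)) (A B : Set (Fin n)) (S : Set (Sym2 (Fin n))),
    P.IsMasterListInstance A B S → ∀ w : List ℕ, IsEncoding P A B S w →
      ∃ (t : ℕ) (s : RamState),
        RamExec (C * (n + P.edges.ncard + 1)) p (RamState.init w) t s ∧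
        t ≤ C * (P.edges.ncard + 1) ∧ IsCorrectAnswer P S s

/-!
# Popularity with Fixed Instability under a one-sided master list

A solution `M` of `(P, S)` contains no edge of `S`, and every edge outside `S` fails to block it, so
`M` is a stable matching of `P` without the edges of `S` (`IsSolution.isStable_deleteEdges`).  A
master list survives the deletion of edges, and under a master list on one side there is exactly one
stable matching: at the best vertex of the master list where two stable matchings differ, the better
of its two situations would block the other matching (`HasMasterList.isStable_unique`).  Hence there
is only one candidate for a solution, and it remains to find it and to test whether `S` is its set
of blocking edges and whether it is popular.

Popularity is tested with the dual of the linear program for popular matchings.  Call a vertex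
*forced* if it is an endpoint of a blocking edge, or if the partner `m` of a forced vertex has an
edge to it that `m` or the vertex itself prefers to `M`.  A matching `M` of a bipartite graph is
popular if and only if every forced vertex is matched to a vertex that is not forced
(`IsMatching.isPopular_iff`).  If this is so, then the labels `1` on forced vertices, `-1` on their
partners and `0` elsewhere bound the votes on every edge and add up to `0`, so that no matching
beats `M`.  Conversely, following the derivation of a forced vertex back to a blocking edge gives a
perturbation of `M` that gains a vote at the expense of matching this vertex once too often
(`Forced.exists_isExchange`).  If a forced vertex has no partner or a forced one, then these
perturbations combine to one that respects the degrees; by Birkhoff's theorem and bipartiteness, an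
integral matching then beats `M` (`IsExchange.not_isPopular`).

For the running time, programs are written for a machine with registers, sixteen arrays and a
read-only input, whose programs are sequences of phases.  A phase repeats a loop-free command
`4 * L` times, where `L` is the length of the input; so time and word size are linear by
construction
(`Mach.exists_program`), and each phase only has to be shown to finish its work within this number
of steps, by means of an invariant with a potential (`Mach.Phase.eval_inv`).  The phases read the
input (`Layout.read_readPhase`), link the two occurrences of each edge (`Layout.linked_linkPhase`),
run deferred acceptance on the edges outside `S` (`Layout.holds_proposePhase`), check that the
edges of `S` block the result (`Layout.Ready.scan_seedCmd`), find the forced vertices by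
breadth-first search (`Layout.Ready.forcePhase`), test the criterion
(`Layout.Ready.scan_checkCmd`), and write the matching to the output
(`Layout.Ready.scan_outputCmd`).  Deferred acceptance does not need to know the master list, nor
the side that it is on.
-/

/-! ### Stable matchings under a master list -/

namespace PrefSystem

variable {V : Type*} {P : PrefSystem V} {A B : Set V} {M : Set (Sym2 V)}

theorem IsMatching.adj (h : P.IsMatching M) {a b : V} (hab : s(a, b) ∈ M) : P.graph.Adj a b :=
  h.1 hab

theorem IsMatching.partner_unique (h : P.IsMatching M) {v a b : V} (ha : s(v, a) ∈ M)
    (hb : s(v, b) ∈ M) : a = b := by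
  have := h.2 _ ha _ hb v (Sym2.mem_mk_left _ _) (Sym2.mem_mk_left _ _)
  exact Sym2.congr_right.mp this

theorem mk_mem_bp {a b : V} :
    s(a, b) ∈ P.bp M ↔ P.graph.Adj a b ∧ P.Wants M a b ∧ P.Wants M b a := by
  constructor
  · rintro ⟨x, y, hxy, h, h₁, h₂⟩
    rcases Sym2.eq_iff.mp hxy with ⟨rfl, rfl⟩ | ⟨rfl, rfl⟩
    · exact ⟨h, h₁, h₂⟩
    · exact ⟨h.symm, h₂, h₁⟩
  · rintro ⟨h, h₁, h₂⟩
    exact ⟨a, b, rfl, h, h₁, h₂⟩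

theorem isMatching_of_partner_unique (hsub : ∀ a b, s(a, b) ∈ M → P.graph.Adj a b)
    (huniq : ∀ v a b, s(v, a) ∈ M → s(v, b) ∈ M → a = b) : P.IsMatching M := by
  refine ⟨?_, ?_⟩
  · intro e he
    induction e using Sym2.ind with
    | _ a b => exact hsub a b he
  · intro e he f hf v hve hvf
    obtain ⟨a, rfl⟩ := hve
    obtain ⟨b, rfl⟩ := hvf
    rw [huniq v a b he hf]

theorem bp_eq_empty_iff :
    P.bp M = ∅ ↔ ∀ a b, P.graph.Adj a b → P.Wants M a b → ¬ P.Wants M b a := by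
  constructor
  · intro h a b hab h₁ h₂
    have : s(a, b) ∈ P.bp M := mk_mem_bp.mpr ⟨hab, h₁, h₂⟩
    rw [h] at this
    exact this
  · intro h
    rw [Set.eq_empty_iff_forall_notMem]
    rintro e ⟨a, b, -, hab, h₁, h₂⟩
    exact h a b hab h₁ h₂

theorem asymm {v a b : V} (h : P.lt v a b) : ¬ P.lt v b a :=
  fun h' => P.irrefl v a (P.trans v a b a h h')

/-- A master list over `A`, as a relation on all of `V`. -/
theorem HasMasterList.exists_rel (hbip : P.graph.IsBipartiteWith A B) (h : P.HasMasterList A B) :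
    ∃ R : V → V → Prop, (∀ a, ¬ R a a) ∧ (∀ a b c, R a b → R b c → R a c) ∧
      (∀ a ∈ A, ∀ a' ∈ A, a ≠ a' → R a a' ∨ R a' a) ∧
      ∀ b ∈ B, ∀ a a', P.graph.Adj b a → P.graph.Adj b a' → (P.lt b a a' ↔ R a a') := by
  obtain ⟨r, hr, hb⟩ := h
  refine ⟨fun a a' => ∃ (ha : a ∈ A) (ha' : a' ∈ A), r ⟨a, ha⟩ ⟨a', ha'⟩, ?_, ?_, ?_, ?_⟩
  · rintro a ⟨ha, _, h⟩
    exact hr.irrefl _ h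
  · rintro a b c ⟨ha, hb, h⟩ ⟨hb', hc, h'⟩
    exact ⟨ha, hc, hr.trans _ _ _ h h'⟩
  · intro a ha a' ha' hne
    by_contra hcon
    push Not at hcon
    have := hr.trichotomous ⟨a, ha⟩ ⟨a', ha'⟩ (hcon.1 ha ha') (hcon.2 ha' ha)
    exact hne (congrArg Subtype.val this)
  · intro b hbB a a' ha ha'
    have h₁ : a ∈ A := hbip.symm.mem_of_mem_adj hbB ha
    have h₂ : a' ∈ A := hbip.symm.mem_of_mem_adj hbB ha'
    rw [hb b hbB ⟨a, h₁⟩ ⟨a', h₂⟩ ha ha']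
    exact ⟨fun h => ⟨h₁, h₂, h⟩, fun ⟨_, _, h⟩ => h⟩

/-- Among the neighbours of `v` with a given property there is a best one. -/
theorem exists_best [Finite V] (P : PrefSystem V) (v : V) (p : V → Prop)
    (h : ∃ u, P.graph.Adj v u ∧ p u) :
    ∃ u, P.graph.Adj v u ∧ p u ∧ ∀ w, P.graph.Adj v w → p w → w ≠ u → P.lt v w u := by
  have hwf : WellFounded (fun a b => P.lt v b a) := by
    have : IsTrans V (fun a b => P.lt v b a) := ⟨fun a b c h h' => P.trans v c b a h' h⟩
    have : Std.Irrefl (fun a b => P.lt v b a) := ⟨fun a => P.irrefl v a⟩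
    exact Finite.wellFounded_of_trans_of_irrefl _
  obtain ⟨u, ⟨hu, hpu⟩, hmin⟩ := hwf.has_min {u | P.graph.Adj v u ∧ p u} h
  refine ⟨u, hu, hpu, fun w hw hpw hne => ?_⟩
  exact (P.total v w u hw hu hne).resolve_right (hmin w ⟨hw, hpw⟩)

/-- With a master list over `A`, letting the vertices of `A` choose one after another, the best one
first, produces a stable matching.  The proof extends a stable matching of a maximal initial part
`T` of the master list. -/
theorem HasMasterList.exists_isStable [Finite V] (hbip : P.graph.IsBipartiteWith A B)
    (h : P.HasMasterList A B) : ∃ M, P.IsStable M := by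
  classical
  obtain ⟨R, hirr, htr, htot, hR⟩ := h.exists_rel hbip
  let good : Set V → Set (Sym2 V) → Prop := fun T M =>
    T ⊆ A ∧ (∀ a ∈ T, ∀ a' ∈ A, R a a' → a' ∈ T) ∧ P.IsMatching M ∧
      (∀ a ∈ A, ∀ b, s(a, b) ∈ M → a ∈ T) ∧
      ∀ a ∈ T, ∀ b, P.graph.Adj a b → P.Wants M a b → ¬ P.Wants M b a
  have hfin : {T : Set V | ∃ M, good T M}.Finite := Set.toFinite _
  have hne : {T : Set V | ∃ M, good T M}.Nonempty := by
    refine ⟨∅, ∅, Set.empty_subset _, by simp, ⟨Set.empty_subset _, by simp⟩, by simp, by simp⟩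
  obtain ⟨T, ⟨M, hTA, hup, hM, hMT, hst⟩, hmax⟩ := hfin.exists_maximal hne
  have hT : T = A := by
    by_contra hTne
    have hex : (A \ T).Nonempty := by
      rw [Set.nonempty_iff_ne_empty]
      intro h0
      exact hTne (Set.Subset.antisymm hTA (Set.sdiff_eq_empty.mp h0))
    have hwf : WellFounded (fun a b => R b a) := by
      have : IsTrans V (fun a b => R b a) := ⟨fun a b c h h' => htr c b a h' h⟩
      have : Std.Irrefl (fun a b => R b a) := ⟨fun a => hirr a⟩
      exact Finite.wellFounded_of_trans_of_irrefl _
    obtain ⟨a, ⟨haA, haT⟩, hamin⟩ := hwf.has_min _ hex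
    have haup : ∀ a' ∈ A, R a a' → a' ∈ T := by
      intro a' ha' hr
      by_contra hc
      exact hamin a' ⟨ha', hc⟩ hr
    have hTa : ∀ x ∈ T, R a x := by
      intro x hx
      have hxa : x ≠ a := by rintro rfl; exact haT hx
      rcases htot x (hTA hx) a haA hxa with h | h
      · exact absurd (hup x hx a haA h) haT
      · exact h
    have hamem : ∀ b, s(a, b) ∉ M := fun b hb => haT (hMT a haA b hb)
    suffices hsuff : ∃ M', good (insert a T) M' by
      exact haT (hmax hsuff (Set.subset_insert a T) (Set.mem_insert a T))
    have hsub : insert a T ⊆ A := Set.insert_subset haA hTA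
    have hup' : ∀ x ∈ insert a T, ∀ a' ∈ A, R x a' → a' ∈ insert a T := by
      rintro x (rfl | hx) a' ha' hr
      · exact Or.inr (haup a' ha' hr)
      · exact Or.inr (hup x hx a' ha' hr)
    by_cases hfree : ∃ b, P.graph.Adj a b ∧ ∀ w, s(b, w) ∉ M
    · obtain ⟨b, hab, hbfree, hbest⟩ := P.exists_best a (fun b => ∀ w, s(b, w) ∉ M) hfree
      have hbB : b ∈ B := hbip.mem_of_mem_adj haA hab
      have hmem : ∀ x y, s(x, y) ∈ insert s(a, b) M ↔
          (x = a ∧ y = b) ∨ (x = b ∧ y = a) ∨ s(x, y) ∈ M := by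
        intro x y
        rw [Set.mem_insert_iff, Sym2.eq_iff, or_assoc]
      have hAB : ∀ x ∈ A, x ≠ b := fun x hx hxb =>
        Set.disjoint_left.mp hbip.disjoint hx (hxb ▸ hbB)
      refine ⟨insert s(a, b) M, hsub, hup', ?_, ?_, ?_⟩
      · refine isMatching_of_partner_unique ?_ ?_
        · intro x y hxy
          rcases (hmem x y).mp hxy with ⟨rfl, rfl⟩ | ⟨rfl, rfl⟩ | h
          · exact hab
          · exact hab.symm
          · exact hM.adj h
        · intro v x y hx hy
          rcases (hmem v x).mp hx with ⟨rfl, rfl⟩ | ⟨rfl, rfl⟩ | h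
          · rcases (hmem _ y).mp hy with ⟨_, rfl⟩ | ⟨h1, _⟩ | h'
            · rfl
            · exact absurd h1 hab.ne
            · exact absurd h' (hamem y)
          · rcases (hmem _ y).mp hy with ⟨h1, _⟩ | ⟨_, rfl⟩ | h'
            · exact absurd h1.symm hab.ne
            · rfl
            · exact absurd h' (hbfree y)
          · rcases (hmem _ y).mp hy with ⟨rfl, _⟩ | ⟨rfl, _⟩ | h'
            · exact absurd h (hamem x)
            · exact absurd h (hbfree x)
            · exact hM.partner_unique h h'
      · intro x hx y hxy
        rcases (hmem x y).mp hxy with ⟨rfl, _⟩ | ⟨rfl, _⟩ | h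
        · exact Or.inl rfl
        · exact absurd rfl (hAB x hx)
        · exact Or.inr (hMT x hx y h)
      · rintro x (rfl | hx) y hxy hw hw'
        · -- the new vertex takes the best free neighbour; the taken ones prefer their partner
          have hyB : y ∈ B := hbip.mem_of_mem_adj haA hxy
          have hlt : P.lt x b y := hw b ((hmem _ _).mpr (Or.inl ⟨rfl, rfl⟩))
          by_cases hyf : ∀ w, s(y, w) ∉ M
          · have hyb : y ≠ b := by rintro rfl; exact P.irrefl _ _ hlt
            exact asymm hlt (hbest y hxy hyf hyb)
          · push Not at hyf
            obtain ⟨w, hyw⟩ := hyf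
            have hwA : w ∈ A := hbip.symm.mem_of_mem_adj hyB (hM.adj hyw)
            have hwT : w ∈ T := hMT w hwA y (by rwa [Sym2.eq_swap])
            have h1 : P.lt y w x := hw' w ((hmem _ _).mpr (Or.inr (Or.inr hyw)))
            rw [hR y hyB w x (hM.adj hyw) hxy.symm] at h1
            exact hirr _ (htr _ _ _ h1 (hTa w hwT))
        · refine hst x hx y hxy (fun w hw1 => hw w ?_) (fun w hw1 => hw' w ?_)
          · exact (hmem _ _).mpr (Or.inr (Or.inr hw1))
          · exact (hmem _ _).mpr (Or.inr (Or.inr hw1))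
    · push Not at hfree
      refine ⟨M, hsub, hup', hM, fun x hx y hxy => Or.inr (hMT x hx y hxy), ?_⟩
      rintro x (rfl | hx) y hxy hw hw'
      · have hyB : y ∈ B := hbip.mem_of_mem_adj haA hxy
        obtain ⟨w, hyw⟩ := hfree y hxy
        have hwA : w ∈ A := hbip.symm.mem_of_mem_adj hyB (hM.adj hyw)
        have hwT : w ∈ T := hMT w hwA y (by rwa [Sym2.eq_swap])
        have h1 : P.lt y w x := hw' w hyw
        rw [hR y hyB w x (hM.adj hyw) hxy.symm] at h1
        exact hirr _ (htr _ _ _ h1 (hTa w hwT))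
      · exact hst x hx y hxy hw hw'
  refine ⟨M, hM, bp_eq_empty_iff.mpr fun a b hab hw hw' => ?_⟩
  rcases hbip.mem_of_adj hab with ⟨ha, -⟩ | ⟨-, hb⟩
  · exact hst a (hT ▸ ha) b hab hw hw'
  · exact hst b (hT ▸ hb) a hab.symm hw' hw

/-- If `a` is matched in `M` to `b`, prefers `b` to its situation in the stable matching `M'`, and
all vertices of `A` above `a` on the master list have the same partners in `M` and in `M'`, then
`a` is matched to `b` in `M'` as well: the vertex `b` can only refuse `a` for a better vertex,
which is then the partner of `b` in `M`, too. -/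
theorem IsStable.mem_of_agree_above {M M' : Set (Sym2 V)} (hbip : P.graph.IsBipartiteWith A B)
    {R : V → V → Prop}
    (hR : ∀ b ∈ B, ∀ a a', P.graph.Adj b a → P.graph.Adj b a' → (P.lt b a a' ↔ R a a'))
    (hM : P.IsStable M) (hM' : P.IsStable M') {a b : V} (ha : a ∈ A) (hab : s(a, b) ∈ M)
    (hagree : ∀ x ∈ A, R a x → ∀ y, s(x, y) ∈ M ↔ s(x, y) ∈ M')
    (hw : ∀ w, s(a, w) ∈ M' → w ≠ b → P.lt a w b) : s(a, b) ∈ M' := by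
  by_contra hc
  have hadj := hM.1.adj hab
  have hbB : b ∈ B := hbip.mem_of_mem_adj ha hadj
  have h1 : P.Wants M' a b := fun w hw' => hw w hw' (by rintro rfl; exact hc hw')
  have h2 := bp_eq_empty_iff.mp hM'.2 a b hadj h1
  unfold Wants at h2
  push Not at h2
  obtain ⟨x, hbx, hlt⟩ := h2
  have hxb : P.graph.Adj b x := hM'.1.adj hbx
  have hxA : x ∈ A := hbip.symm.mem_of_mem_adj hbB hxb
  have hxa : x ≠ a := by rintro rfl; exact hc (by rwa [Sym2.eq_swap])
  have h3 : P.lt b a x := (P.total b x a hxb hadj.symm hxa).resolve_left hlt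
  have h4 : R a x := (hR b hbB a x hadj.symm hxb).mp h3
  have h5 : s(x, b) ∈ M := (hagree x hxA h4 b).mpr (by rwa [Sym2.eq_swap])
  exact hxa (hM.1.partner_unique (v := b) (by rwa [Sym2.eq_swap]) (by rwa [Sym2.eq_swap]))

/-- Under a master list two stable matchings agree: the best vertex of the master list at which
they differ would violate `IsStable.mem_of_agree_above`. -/
theorem HasMasterList.isStable_unique [Finite V] (hbip : P.graph.IsBipartiteWith A B)
    (h : P.HasMasterList A B) {M M' : Set (Sym2 V)} (hM : P.IsStable M) (hM' : P.IsStable M') :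
    M = M' := by
  obtain ⟨R, hirr, htr, htot, hR⟩ := h.exists_rel hbip
  have key : ∀ a ∈ A, ∀ y, s(a, y) ∈ M ↔ s(a, y) ∈ M' := by
    have hwf : WellFounded (fun a b => R b a) := by
      have : IsTrans V (fun a b => R b a) := ⟨fun a b c h h' => htr c b a h' h⟩
      have : Std.Irrefl (fun a b => R b a) := ⟨fun a => hirr a⟩
      exact Finite.wellFounded_of_trans_of_irrefl _
    intro a
    induction a using hwf.induction with
    | _ a ih =>
      intro ha
      have h1 : ∀ x ∈ A, R a x → ∀ y, s(x, y) ∈ M ↔ s(x, y) ∈ M' := fun x hx hax => ih x hax hx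
      have h2 : ∀ x ∈ A, R a x → ∀ y, s(x, y) ∈ M' ↔ s(x, y) ∈ M :=
        fun x hx hax y => (h1 x hx hax y).symm
      -- whichever of the two situations `a` prefers occurs in both matchings
      have one : ∀ N N' : Set (Sym2 V), P.IsStable N → P.IsStable N' →
          (∀ x ∈ A, R a x → ∀ y, s(x, y) ∈ N ↔ s(x, y) ∈ N') → ∀ b, s(a, b) ∈ N →
          s(a, b) ∈ N' := by
        intro N N' hN hN' hag b hb
        by_cases hw : ∀ w, s(a, w) ∈ N' → w ≠ b → P.lt a w b
        · exact hN.mem_of_agree_above hbip hR hN' ha hb hag hw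
        · push Not at hw
          obtain ⟨w, hwN, hwb, hlt⟩ := hw
          have hlt' := (P.total a w b (hN'.1.adj hwN) (hN.1.adj hb) hwb).resolve_left hlt
          have : s(a, w) ∈ N := by
            refine hN'.mem_of_agree_above hbip hR hN ha hwN
              (fun x hx hax y => (hag x hx hax y).symm) (fun z hz _ => ?_)
            rwa [hN.1.partner_unique hz hb]
          exact absurd (hN.1.partner_unique this hb) hwb
      exact fun y => ⟨one M M' hM hM' h1 y, one M' M hM' hM h2 y⟩
  ext e
  induction e using Sym2.ind with
  | _ a b =>
    constructor
    · intro he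
      rcases hbip.mem_of_adj (hM.1.adj he) with ⟨ha, -⟩ | ⟨-, hb⟩
      · exact (key a ha b).mp he
      · rw [Sym2.eq_swap] at he ⊢
        exact (key b hb a).mp he
    · intro he
      rcases hbip.mem_of_adj (hM'.1.adj he) with ⟨ha, -⟩ | ⟨-, hb⟩
      · exact (key a ha b).mpr he
      · rw [Sym2.eq_swap] at he ⊢
        exact (key b hb a).mpr he

/-! ### Solutions are stable after deleting the prescribed blocking edges -/

variable {S : Set (Sym2 V)}

theorem IsBipartiteWith_deleteEdges (hbip : P.graph.IsBipartiteWith A B) :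
    (P.deleteEdges S).graph.IsBipartiteWith A B :=
  ⟨hbip.disjoint, fun _ _ h => hbip.mem_of_adj (SimpleGraph.deleteEdges_le S h)⟩

theorem HasMasterList.deleteEdges (h : P.HasMasterList A B) :
    (P.deleteEdges S).HasMasterList A B := by
  obtain ⟨r, hr, hb⟩ := h
  refine ⟨r, hr, fun b hbB a a' ha ha' => ?_⟩
  rw [← hb b hbB a a' (SimpleGraph.deleteEdges_le S ha) (SimpleGraph.deleteEdges_le S ha')]
  exact ⟨fun h => h.1, fun h => ⟨h, ha, ha'⟩⟩

theorem deleteEdges_adj {a b : V} :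
    (P.deleteEdges S).graph.Adj a b ↔ P.graph.Adj a b ∧ s(a, b) ∉ S :=
  SimpleGraph.deleteEdges_adj

theorem IsSolution.isStable_deleteEdges (h : P.IsSolution S M) :
    (P.deleteEdges S).IsStable M := by
  obtain ⟨⟨hM, -⟩, hbp⟩ := h
  have hMS : ∀ a b, s(a, b) ∈ M → (P.deleteEdges S).graph.Adj a b := by
    intro a b hab
    refine deleteEdges_adj.mpr ⟨hM.adj hab, fun hS => ?_⟩
    rw [← hbp, mk_mem_bp] at hS
    exact P.irrefl _ _ (hS.2.1 b hab)
  refine ⟨isMatching_of_partner_unique hMS fun v a b => hM.partner_unique,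
    bp_eq_empty_iff.mpr fun a b hab h₁ h₂ => ?_⟩
  have := deleteEdges_adj.mp hab
  refine this.2 ?_
  rw [← hbp, mk_mem_bp]
  exact ⟨this.1, fun w hw => (h₁ w hw).1, fun w hw => (h₂ w hw).1⟩

theorem IsMasterListInstance.existsUnique_isStable [Finite V] (h : P.IsMasterListInstance A B S) :
    ∃ M₀, (P.deleteEdges S).IsStable M₀ ∧ ∀ M, (P.deleteEdges S).IsStable M → M = M₀ := by
  have hbip := IsBipartiteWith_deleteEdges (S := S) h.bipartite
  rcases h.master with hm | hm
  · obtain ⟨M₀, hM₀⟩ := hm.deleteEdges.exists_isStable hbip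
    exact ⟨M₀, hM₀, fun M hM => hm.deleteEdges.isStable_unique hbip hM hM₀⟩
  · obtain ⟨M₀, hM₀⟩ := hm.deleteEdges.exists_isStable hbip.symm
    exact ⟨M₀, hM₀, fun M hM => hm.deleteEdges.isStable_unique hbip.symm hM hM₀⟩

end PrefSystem

/-! ### Votes and partners -/

namespace PrefSystem

variable {V : Type*} {P : PrefSystem V} {A B : Set V} {M N : Set (Sym2 V)}

open Classical in
/-- The partner of `v` in the matching `M`; an unmatched vertex is its own partner. -/
noncomputable def partner (M : Set (Sym2 V)) (v : V) : V :=
  if h : ∃ u, s(v, u) ∈ M then h.choose else v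

theorem mem_partner {v : V} (h : partner M v ≠ v) : s(v, partner M v) ∈ M := by
  unfold partner at h ⊢
  split_ifs with h'
  · exact h'.choose_spec
  · simp [h'] at h

theorem IsMatching.partner_eq (hM : P.IsMatching M) {v u : V} (h : s(v, u) ∈ M) :
    partner M v = u := by
  have h' : ∃ u, s(v, u) ∈ M := ⟨u, h⟩
  unfold partner
  rw [dif_pos h']
  exact hM.partner_unique h'.choose_spec h

theorem partner_eq_self {v : V} (h : ∀ u, s(v, u) ∉ M) : partner M v = v := by
  unfold partner
  rw [dif_neg (by push Not; exact h)]

theorem IsMatching.partner_ne (hM : P.IsMatching M) {v u : V} (h : s(v, u) ∈ M) :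
    partner M v ≠ v := by
  rw [hM.partner_eq h]
  exact (hM.adj h).ne'

theorem IsMatching.partner_partner (hM : P.IsMatching M) (v : V) :
    partner M (partner M v) = v := by
  by_cases h : partner M v = v
  · rw [h, h]
  · exact hM.partner_eq (Sym2.eq_swap ▸ mem_partner h)

theorem IsMatching.adj_partner (hM : P.IsMatching M) {v : V} (h : partner M v ≠ v) :
    P.graph.Adj v (partner M v) :=
  hM.adj (mem_partner h)

/-- The involution that exchanges the endpoints of the edges of `M`. -/
noncomputable def IsMatching.partnerPerm (hM : P.IsMatching M) : Equiv.Perm V :=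
  ⟨partner M, partner M, hM.partner_partner, hM.partner_partner⟩

open Classical in
/-- The vote of `v` between the matching `M` and the possible new partner `w`, where `w = v`
stands for being unmatched: `1` if `v` prefers `w`, `-1` if `v` prefers `M`, `0` in case of a
tie. -/
noncomputable def vote (P : PrefSystem V) (M : Set (Sym2 V)) (v w : V) : ℝ :=
  if w = partner M v then 0 else if P.graph.Adj v w ∧ P.Wants M v w then 1 else -1

theorem vote_partner (v : V) : P.vote M v (partner M v) = 0 := by simp [vote]

theorem neg_one_le_vote (v w : V) : -1 ≤ P.vote M v w := by
  unfold vote; split_ifs <;> norm_num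

theorem vote_le_one (v w : V) : P.vote M v w ≤ 1 := by
  unfold vote; split_ifs <;> norm_num

theorem vote_self_of_matched {v : V} (h : partner M v ≠ v) : P.vote M v v = -1 := by
  simp [vote, h.symm]

theorem Wants.ne_partner {v w : V} (h : P.Wants M v w) (hadj : P.graph.Adj v w) :
    w ≠ partner M v := by
  intro hw
  refine P.irrefl v w (h w ?_)
  rw [hw] at hadj ⊢
  exact mem_partner hadj.ne'

theorem vote_eq_one {v w : V} (h : P.Wants M v w) (hadj : P.graph.Adj v w) :
    P.vote M v w = 1 := by
  rw [vote, if_neg (h.ne_partner hadj), if_pos ⟨hadj, h⟩]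

theorem wants_of_unmatched {v : V} (w : V) (h : ∀ u, s(v, u) ∉ M) : P.Wants M v w :=
  fun u hu => absurd hu (h u)

theorem IsMatching.vertexPrefers_iff (hN : P.IsMatching N) (v : V) :
    P.VertexPrefers N M v ↔ P.vote M v (partner N v) = 1 := by
  constructor
  · rintro ⟨u, hu, hlt⟩
    rw [hN.partner_eq hu]
    exact vote_eq_one hlt (hN.adj hu)
  · intro h
    unfold vote at h
    split_ifs at h with h1 h2
    · norm_num at h
    · exact ⟨partner N v, mem_partner h2.1.ne', h2.2⟩
    · norm_num at h

theorem IsMatching.vertexPrefers_iff' (hM : P.IsMatching M) (hN : P.IsMatching N) (v : V) :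
    P.VertexPrefers M N v ↔ P.vote M v (partner N v) = -1 := by
  constructor
  · rintro ⟨u, hu, hlt⟩
    unfold vote
    have hpu := hM.partner_eq hu
    rw [if_neg, if_neg]
    · rintro ⟨hadj, hw⟩
      exact asymm (hw u hu) (hlt _ (mem_partner hadj.ne'))
    · rw [hpu]
      intro h
      have : s(v, partner N v) ∈ N := mem_partner (by rw [h]; exact (hM.adj hu).ne')
      rw [h] at this
      exact P.irrefl _ _ (hlt u this)
  · intro h
    unfold vote at h
    split_ifs at h with h1 h2
    · norm_num at h
    · norm_num at h
    · have hmatched : partner M v ≠ v := by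
        intro hv
        rw [hv] at h1
        refine h2 ⟨hN.adj_partner h1, wants_of_unmatched _ fun u hu => ?_⟩
        exact hM.partner_ne hu hv
      refine ⟨partner M v, mem_partner hmatched, fun w hw => ?_⟩
      have hwN := hN.partner_eq hw
      rw [hwN] at h1 h2
      have hadj := hN.adj hw
      refine (P.total v w _ hadj (hM.adj_partner hmatched) h1).resolve_right fun hlt => ?_
      refine h2 ⟨hadj, fun x hx => ?_⟩
      rw [← hM.partner_eq hx]
      exact hlt

theorem IsMatching.morePopular_iff [Fintype V] (hM : P.IsMatching M) (hN : P.IsMatching N) :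
    P.MorePopular N M ↔ 0 < ∑ v, P.vote M v (partner N v) := by
  classical
  have h1 : ∑ v, P.vote M v (partner N v) =
      ({v | P.VertexPrefers N M v}.ncard : ℝ) - ({v | P.VertexPrefers M N v}.ncard : ℝ) := by
    rw [Set.ncard_eq_toFinset_card', Set.ncard_eq_toFinset_card', Set.toFinset_ofPred,
      Set.toFinset_ofPred, Finset.card_filter, Finset.card_filter]
    push_cast
    rw [← Finset.sum_sub_distrib]
    refine Finset.sum_congr rfl fun v _ => ?_
    rw [hN.vertexPrefers_iff, hM.vertexPrefers_iff' hN]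
    unfold vote
    split_ifs <;> norm_num at *
  rw [h1, sub_pos, Nat.cast_lt]
  rfl

theorem isMatching_of_involutive (f : V → V) (hf : ∀ v, f (f v) = v)
    (hadj : ∀ v, f v ≠ v → P.graph.Adj v (f v)) :
    ∃ N, P.IsMatching N ∧ ∀ v, partner N v = f v := by
  have hmem : ∀ a b, s(a, b) ∈ {e | ∃ v, f v ≠ v ∧ e = s(v, f v)} → f a = b ∧ a ≠ b := by
    rintro a b ⟨v, hv, he⟩
    rcases Sym2.eq_iff.mp he with ⟨rfl, rfl⟩ | ⟨rfl, rfl⟩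
    · exact ⟨rfl, hv.symm⟩
    · exact ⟨hf _, hv⟩
  have hN : P.IsMatching {e | ∃ v, f v ≠ v ∧ e = s(v, f v)} := by
    refine isMatching_of_partner_unique ?_ ?_
    · intro a b h
      obtain ⟨rfl, h2⟩ := hmem a b h
      exact hadj a h2.symm
    · intro v a b ha hb
      rw [← (hmem v a ha).1, ← (hmem v b hb).1]
  refine ⟨_, hN, fun v => ?_⟩
  by_cases hv : f v = v
  · rw [hv]
    exact partner_eq_self fun u hu => (hmem v u hu).2 ((hmem v u hu).1 ▸ hv.symm)
  · exact hN.partner_eq ⟨v, hv, rfl⟩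

/-! ### A criterion for popularity -/

/-- The vertices that have to carry the label `1` in every dual certificate for the popularity of
`M` with labels in `[-1, 1]`: the endpoints of blocking edges, and each vertex `x` joined to the
partner `m` of such a vertex by an edge that at least one of `m`, `x` prefers to `M`. -/
inductive Forced (P : PrefSystem V) (M : Set (Sym2 V)) : V → Prop
  | seed {a b : V} (h : s(a, b) ∈ P.bp M) : Forced P M a
  | step {v m x : V} (hv : Forced P M v) (hm : s(v, m) ∈ M) (hx : P.graph.Adj m x)
      (hw : P.Wants M m x ∨ P.Wants M x m) : Forced P M x

open Classical in
/-- The dual certificate: `1` on forced vertices, `-1` on their partners, `0` elsewhere. -/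
noncomputable def label (P : PrefSystem V) (M : Set (Sym2 V)) (v : V) : ℝ :=
  (if P.Forced M v then 1 else 0) - (if P.Forced M (partner M v) then 1 else 0)

/-- If every forced vertex is matched to a vertex that is not forced, then the labels bound the
votes on every edge and at every vertex, and they add up to `0`. -/
theorem isPopular_of_forced [Finite V] (hM : P.IsMatching M)
    (h : ∀ v, P.Forced M v → ∃ m, s(v, m) ∈ M ∧ ¬ P.Forced M m) : P.IsPopular M := by
  classical
  have := Fintype.ofFinite V
  refine ⟨hM, fun N hN => ?_⟩
  rw [hM.morePopular_iff hN, not_lt]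
  have hnot : ∀ v, P.Forced M v → ¬ P.Forced M (partner M v) := by
    intro v hv
    obtain ⟨m, hm, hmf⟩ := h v hv
    rwa [hM.partner_eq hm]
  have hsum : ∑ v, P.label M v = 0 := by
    have h1 : ∑ v, P.label M (partner M v) = ∑ v, P.label M v :=
      Equiv.sum_comp hM.partnerPerm (P.label M)
    have h2 : ∑ v, (P.label M v + P.label M (partner M v)) = 0 := by
      refine Finset.sum_eq_zero fun v _ => ?_
      simp only [label, hM.partner_partner]
      ring
    rw [Finset.sum_add_distrib, h1] at h2
    linarith
  have hself : ∀ v, P.vote M v v ≤ P.label M v := by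
    intro v
    by_cases hv : partner M v = v
    · have : P.vote M v v = 0 := by
        conv_lhs => rw [← hv]
        simp [vote, hv]
      rw [this, label, hv, sub_self]
    · rw [vote_self_of_matched hv, label]
      split_ifs <;> norm_num
  have hedge : ∀ v w, P.graph.Adj v w →
      P.vote M v w + P.vote M w v ≤ P.label M v + P.label M w := by
    intro v w hvw
    by_cases hmw : s(v, w) ∈ M
    · have e1 := hM.partner_eq hmw
      have e2 : partner M w = v := hM.partner_eq (Sym2.eq_swap ▸ hmw)
      have v1 : P.vote M v w = 0 := by rw [← e1, vote_partner]
      have v2 : P.vote M w v = 0 := by rw [← e2, vote_partner]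
      simp only [label, e1, e2, v1, v2]
      linarith
    · by_cases hw1 : P.Wants M v w <;> by_cases hw2 : P.Wants M w v
      · have f1 : P.Forced M v := .seed (mk_mem_bp.mpr ⟨hvw, hw1, hw2⟩)
        have f2 : P.Forced M w := .seed (mk_mem_bp.mpr ⟨hvw.symm, hw2, hw1⟩)
        have b1 := P.vote_le_one (M := M) v w
        have b2 := P.vote_le_one (M := M) w v
        simp only [label, f1, f2, hnot v f1, hnot w f2, if_true, if_false]
        linarith
      all_goals
        -- a vertex labelled `-1` forces its neighbour unless both prefer their partners
        have key : ∀ x y, P.graph.Adj x y → (P.Wants M x y ∨ P.Wants M y x) →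
            P.Forced M (partner M x) → P.Forced M y := by
          intro x y hxy hw hf
          obtain ⟨m, hm, -⟩ := h _ hf
          have := hM.partner_eq hm
          rw [hM.partner_partner] at this
          subst this
          exact .step hf hm hxy hw
        have lb : ∀ x, -1 ≤ P.label M x := by
          intro x
          unfold label
          split_ifs <;> norm_num
      · have b1 := P.vote_le_one (M := M) v w
        have b2 : P.vote M w v = -1 := by
          rw [vote, if_neg, if_neg (fun h => hw2 h.2)]
          intro hv
          exact hmw (Sym2.eq_swap ▸ (hv ▸ mem_partner (by rw [← hv]; exact hvw.ne)))
        have k1 := key v w hvw (Or.inl hw1)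
        have k2 := key w v hvw.symm (Or.inr hw1)
        have n1 := hnot v
        have n2 := hnot w
        unfold label
        split_ifs <;> first | linarith | (exfalso; tauto)
      · have b1 := P.vote_le_one (M := M) w v
        have b2 : P.vote M v w = -1 := by
          rw [vote, if_neg, if_neg (fun h => hw1 h.2)]
          intro hv
          exact hmw (hv ▸ mem_partner (by rw [← hv]; exact hvw.ne'))
        have k1 := key v w hvw (Or.inr hw2)
        have k2 := key w v hvw.symm (Or.inl hw2)
        have n1 := hnot v
        have n2 := hnot w
        unfold label
        split_ifs <;> first | linarith | (exfalso; tauto)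
      · have b1 : P.vote M w v = -1 := by
          rw [vote, if_neg, if_neg (fun h => hw2 h.2)]
          intro hv
          exact hmw (Sym2.eq_swap ▸ (hv ▸ mem_partner (by rw [← hv]; exact hvw.ne)))
        have b2 : P.vote M v w = -1 := by
          rw [vote, if_neg, if_neg (fun h => hw1 h.2)]
          intro hv
          exact hmw (hv ▸ mem_partner (by rw [← hv]; exact hvw.ne'))
        have := lb v
        have := lb w
        linarith
  have h1 : ∑ v, P.vote M (partner N v) v = ∑ v, P.vote M v (partner N v) := by
    rw [← Equiv.sum_comp hN.partnerPerm (fun v => P.vote M v (partner N v))]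
    refine Finset.sum_congr rfl fun v _ => ?_
    show _ = P.vote M (partner N v) (partner N (partner N v))
    rw [hN.partner_partner]
  have h2 : ∑ v, P.label M (partner N v) = ∑ v, P.label M v :=
    Equiv.sum_comp hN.partnerPerm (P.label M)
  have h3 : ∑ v, (P.vote M v (partner N v) + P.vote M (partner N v) v) ≤
      ∑ v, (P.label M v + P.label M (partner N v)) := by
    refine Finset.sum_le_sum fun v _ => ?_
    by_cases hv : partner N v = v
    · rw [hv]
      have := hself v
      linarith
    · exact hedge _ _ (hN.adj_partner hv)
  rw [Finset.sum_add_distrib, Finset.sum_add_distrib, h1, h2, hsum] at h3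
  linarith

end PrefSystem

/-! ### Necessity of the criterion -/

namespace PrefSystem

variable {V : Type*} {P : PrefSystem V} {A B : Set V} {M N : Set (Sym2 V)}

/-- A fractional exchange for `M`: a symmetric matrix `Y`, a perturbation of the fractional
matching `M`, where the diagonal entries measure to which extent a vertex is unmatched.  It may be
negative only at the edges of `M` (and at `(v, v)` for unmatched `v`).  Its row sums are `d`, and it
gains at least `c` in the total vote. -/
structure IsExchange [Fintype V] (P : PrefSystem V) (M : Set (Sym2 V)) (Y : V → V → ℝ)
    (d : V → ℝ) (c : ℝ) : Prop where
  symm : ∀ v w, Y v w = Y w v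
  nonneg : ∀ v w, w ≠ partner M v → 0 ≤ Y v w
  supp : ∀ v w, Y v w ≠ 0 → v = w ∨ P.graph.Adj v w
  row : ∀ v, ∑ w, Y v w = d v
  gain : c ≤ ∑ v, ∑ w, Y v w * P.vote M v w

theorem IsExchange.add [Fintype V] {Y Z : V → V → ℝ} {d e : V → ℝ} {a b : ℝ}
    (hY : P.IsExchange M Y d a) (hZ : P.IsExchange M Z e b) :
    P.IsExchange M (fun v w => Y v w + Z v w) (fun v => d v + e v) (a + b) where
  symm v w := by rw [hY.symm, hZ.symm]
  nonneg v w h := add_nonneg (hY.nonneg v w h) (hZ.nonneg v w h)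
  supp v w h := by
    by_cases h0 : Y v w = 0
    · exact hZ.supp v w fun h1 => h (by rw [h0, h1, add_zero])
    · exact hY.supp v w h0
  row v := by rw [Finset.sum_add_distrib, hY.row, hZ.row]
  gain := by
    simp only [add_mul, Finset.sum_add_distrib]
    exact add_le_add hY.gain hZ.gain

open Classical in
/-- The symmetric matrix with entries `t` at `(a, b)` and `(b, a)`, and `2t` if `a = b`. -/
noncomputable def edgeMatrix (t : ℝ) (a b : V) (v w : V) : ℝ :=
  (if v = a ∧ w = b then t else 0) + (if v = b ∧ w = a then t else 0)

open Classical in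
theorem isExchange_edgeMatrix [Fintype V] (hM : P.IsMatching M) (t : ℝ) (a b : V)
    (hab : a = b ∨ P.graph.Adj a b) (ht : 0 ≤ t ∨ b = partner M a) :
    P.IsExchange M (edgeMatrix t a b)
      (fun v => (if v = a then t else 0) + (if v = b then t else 0))
      (t * (P.vote M a b + P.vote M b a)) where
  symm v w := by
    unfold edgeMatrix
    rw [add_comm]
    exact congrArg₂ _ (if_congr and_comm rfl rfl) (if_congr and_comm rfl rfl)
  nonneg v w h := by
    unfold edgeMatrix
    have key : ¬ 0 ≤ t → ¬ (v = a ∧ w = b) ∧ ¬ (v = b ∧ w = a) := by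
      intro h0
      have hb := ht.resolve_left h0
      refine ⟨?_, ?_⟩
      · rintro ⟨rfl, rfl⟩
        exact h hb
      · rintro ⟨rfl, rfl⟩
        rw [hb, hM.partner_partner] at h
        exact h rfl
    split_ifs <;> first | linarith | (by_cases h0 : 0 ≤ t <;> first | linarith | tauto)
  supp v w h := by
    unfold edgeMatrix at h
    by_cases h1 : v = a ∧ w = b
    · rw [h1.1, h1.2]
      exact hab
    · by_cases h2 : v = b ∧ w = a
      · rw [h2.1, h2.2]
        exact hab.imp Eq.symm SimpleGraph.Adj.symm
      · simp [h1, h2] at h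
  row v := by
    unfold edgeMatrix
    simp [Finset.sum_add_distrib, ite_and]
  gain := by
    unfold edgeMatrix
    apply le_of_eq
    simp [Finset.sum_add_distrib, add_mul, ite_and, ite_mul]
    ring

theorem IsExchange.congr [Fintype V] {Y : V → V → ℝ} {d e : V → ℝ} {a b : ℝ}
    (hY : P.IsExchange M Y d a) (hd : ∀ v, d v = e v) (hb : b ≤ a) : P.IsExchange M Y e b :=
  ⟨hY.symm, hY.nonneg, hY.supp, fun v => by rw [hY.row, hd], hb.trans hY.gain⟩

open Classical in
/-- For a forced vertex `v` some exchange gains at least `1` at the only expense of matching `v`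
once too often: follow the derivation of `v` back to a blocking edge. -/
theorem Forced.exists_isExchange [Fintype V] (hM : P.IsMatching M) {v : V} (hv : P.Forced M v) :
    ∃ Y, P.IsExchange M Y (fun x => if x = v then 1 else 0) 1 := by
  induction hv with
  | @seed a b h =>
    obtain ⟨hab, h1, h2⟩ := mk_mem_bp.mp h
    have e1 := isExchange_edgeMatrix hM 1 a b (Or.inr hab) (Or.inl zero_le_one)
    have w1 := vote_eq_one h1 hab
    have w2 := vote_eq_one h2 hab.symm
    have w3 : P.vote M b (partner M b) = 0 := vote_partner b
    by_cases hb : partner M b = b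
    · have e2 := isExchange_edgeMatrix hM (-(1 / 2)) b b (Or.inl rfl) (Or.inr hb.symm)
      refine ⟨_, (e1.add e2).congr (fun v => ?_) ?_⟩
      · split_ifs <;> norm_num
      · rw [hb] at w3
        rw [w1, w2, w3]
        norm_num
    · have e2 := isExchange_edgeMatrix hM (-1) b (partner M b)
        (Or.inr (hM.adj_partner hb)) (Or.inr rfl)
      have e3 := isExchange_edgeMatrix hM (1 / 2) (partner M b) (partner M b) (Or.inl rfl)
        (Or.inl (by norm_num))
      have w4 : P.vote M (partner M b) b = 0 := by
        conv_lhs => rw [← hM.partner_partner b]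
        rw [hM.partner_partner, vote_partner]
      have w5 : P.vote M (partner M b) (partner M b) = -1 := by
        apply vote_self_of_matched
        rw [hM.partner_partner]
        exact fun h => hb h.symm
      refine ⟨_, ((e1.add e2).add e3).congr (fun v => ?_) ?_⟩
      · split_ifs <;> norm_num
      · rw [w1, w2, w3, w4, w5]
        norm_num
  | @step v m x hv hm hx hw ih =>
    obtain ⟨Y, hY⟩ := ih
    have hp := hM.partner_eq hm
    have hp' : partner M m = v := hM.partner_eq (Sym2.eq_swap ▸ hm)
    have e1 := isExchange_edgeMatrix hM (-1) v m (Or.inr (hM.adj hm)) (Or.inr hp.symm)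
    have e2 := isExchange_edgeMatrix hM 1 m x (Or.inr hx) (Or.inl zero_le_one)
    have w1 : P.vote M v m = 0 := by rw [← hp, vote_partner]
    have w2 : P.vote M m v = 0 := by rw [← hp', vote_partner]
    have w3 : 0 ≤ P.vote M m x + P.vote M x m := by
      have b1 := P.neg_one_le_vote (M := M) m x
      have b2 := P.neg_one_le_vote (M := M) x m
      rcases hw with hw | hw
      · have := vote_eq_one hw hx
        linarith
      · have := vote_eq_one hw hx.symm
        linarith
    refine ⟨_, ((hY.add e1).add e2).congr (fun v => ?_) ?_⟩
    · split_ifs <;> norm_num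
    · rw [w1, w2]
      linarith

/-- If an exchange without defect in the row sums makes a positive gain, then `M` is not popular:
a small multiple of it, added to `M`, gives a doubly stochastic matrix; by Birkhoff's theorem a
permutation `σ` supported by edges and fixed points makes a positive gain, and since the graph is
bipartite, `σ` splits into two matchings. -/
theorem IsExchange.not_isPopular [Fintype V] (hbip : P.graph.IsBipartiteWith A B)
    (hM : P.IsMatching M) {Y : V → V → ℝ} {c : ℝ} (hY : P.IsExchange M Y (fun _ => 0) c)
    (hc : 0 < c) : ¬ P.IsPopular M := by
  classical
  rintro ⟨-, hpop⟩
  have noinv : ∀ f : V → V, (∀ v, f (f v) = v) → (∀ v, f v ≠ v → P.graph.Adj v (f v)) →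
      ∑ v, P.vote M v (f v) ≤ 0 := by
    intro f hf hadj
    obtain ⟨N, hN, hNf⟩ := isMatching_of_involutive f hf hadj
    have := hpop N hN
    rw [hM.morePopular_iff hN, not_lt] at this
    simpa only [hNf] using this
  set K : ℝ := 1 + ∑ v, ∑ w, |Y v w| with hK
  have hKpos : 0 < K := by positivity
  have hYK : ∀ v w, -K ≤ Y v w := by
    intro v w
    have h1 : |Y v w| ≤ ∑ w, |Y v w| :=
      Finset.single_le_sum (f := fun w => |Y v w|) (fun _ _ => abs_nonneg _) (Finset.mem_univ w)
    have h2 : ∑ w, |Y v w| ≤ ∑ v, ∑ w, |Y v w| :=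
      Finset.single_le_sum (f := fun v => ∑ w, |Y v w|)
        (fun _ _ => Finset.sum_nonneg fun _ _ => abs_nonneg _) (Finset.mem_univ v)
    have := neg_abs_le (Y v w)
    linarith
  let X : Matrix V V ℝ := fun v w => (if w = partner M v then 1 else 0) + K⁻¹ * Y v w
  have hXsymm : ∀ v w, X v w = X w v := by
    intro v w
    have : w = partner M v ↔ v = partner M w :=
      ⟨fun h => by rw [h, hM.partner_partner], fun h => by rw [h, hM.partner_partner]⟩
    simp only [X, hY.symm v w, this]
  have hXrow : ∀ v, ∑ w, X v w = 1 := by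
    intro v
    simp only [X, Finset.sum_add_distrib, ← Finset.mul_sum, hY.row]
    simp
  have hX0 : ∀ v w, 0 ≤ X v w := by
    intro v w
    simp only [X]
    split_ifs with h
    · have := mul_le_mul_of_nonneg_left (hYK v w) (inv_nonneg.mpr hKpos.le)
      rw [mul_neg, inv_mul_cancel₀ hKpos.ne'] at this
      linarith
    · have := mul_nonneg (inv_nonneg.mpr hKpos.le) (hY.nonneg v w h)
      linarith
  have hXsupp : ∀ v w, X v w ≠ 0 → v = w ∨ P.graph.Adj v w := by
    intro v w h
    by_cases h1 : w = partner M v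
    · by_cases h2 : partner M v = v
      · left; rw [h1, h2]
      · right; rw [h1]; exact hM.adj_partner h2
    · refine hY.supp v w fun h0 => h ?_
      simp [X, h1, h0]
  have hXds : X ∈ doublyStochastic ℝ V := by
    rw [mem_doublyStochastic_iff_sum]
    refine ⟨hX0, hXrow, fun w => ?_⟩
    simp only [hXsymm _ w]
    exact hXrow w
  have hXgain : 0 < ∑ v, ∑ w, X v w * (P.vote M v w + P.vote M w v) := by
    have h1 : 0 < ∑ v, ∑ w, X v w * P.vote M v w := by
      have : ∀ v w, X v w * P.vote M v w = K⁻¹ * (Y v w * P.vote M v w) := by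
        intro v w
        simp only [X]
        split_ifs with h
        · rw [h, vote_partner]; ring
        · ring
      simp only [this, ← Finset.mul_sum]
      exact mul_pos (inv_pos.mpr hKpos) (hc.trans_le hY.gain)
    have h2 : ∑ v, ∑ w, X v w * P.vote M w v = ∑ v, ∑ w, X v w * P.vote M v w := by
      rw [Finset.sum_comm]
      exact Finset.sum_congr rfl fun v _ => Finset.sum_congr rfl fun w _ => by rw [hXsymm]
    simp only [mul_add, Finset.sum_add_distrib, h2]
    linarith
  obtain ⟨c, hc0, -, hcX⟩ := exists_eq_sum_perm_of_mem_doublyStochastic hXds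
  have hXc : ∀ v w, X v w = ∑ σ : Equiv.Perm V, if σ v = w then c σ else 0 := by
    intro v w
    have := congrFun (congrFun hcX v) w
    rw [← this]
    simp [Matrix.sum_apply, Equiv.Perm.permMatrix, PEquiv.toMatrix_apply, eq_comm]
  have hswap : ∑ v, ∑ w, X v w * (P.vote M v w + P.vote M w v) =
      ∑ σ : Equiv.Perm V, c σ * ∑ v, (P.vote M v (σ v) + P.vote M (σ v) v) := by
    simp only [hXc, Finset.sum_mul, Finset.mul_sum, ite_mul, zero_mul]
    have h1 : ∀ v, (∑ w, ∑ σ : Equiv.Perm V,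
        if σ v = w then c σ * (P.vote M v w + P.vote M w v) else 0) =
        ∑ σ : Equiv.Perm V, c σ * (P.vote M v (σ v) + P.vote M (σ v) v) := by
      intro v
      rw [Finset.sum_comm]
      simp
    simp only [h1]
    exact Finset.sum_comm
  rw [hswap] at hXgain
  obtain ⟨σ, -, hσ⟩ := Finset.exists_lt_of_sum_lt (s := Finset.univ)
    (f := fun _ : Equiv.Perm V => (0 : ℝ)) (by simpa using hXgain)
  have hcσ : 0 < c σ := lt_of_le_of_ne (hc0 σ) fun h => by simp [← h] at hσ
  have hgain : 0 < ∑ v, (P.vote M v (σ v) + P.vote M (σ v) v) := pos_of_mul_pos_right hσ hcσ.le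
  have hadj : ∀ v, σ v ≠ v → P.graph.Adj v (σ v) := by
    intro v hv
    refine (hXsupp v (σ v) ?_).resolve_left hv.symm
    rw [hXc]
    apply ne_of_gt
    refine lt_of_lt_of_le hcσ ?_
    have := Finset.single_le_sum (f := fun τ : Equiv.Perm V => if τ v = σ v then c τ else 0)
      (fun τ _ => by split_ifs <;> simp [hc0]) (Finset.mem_univ σ)
    simpa using this
  have hadj' : ∀ v, σ.symm v ≠ v → P.graph.Adj v (σ.symm v) := by
    intro v hv
    have := hadj (σ.symm v) (by rw [σ.apply_symm_apply]; exact hv.symm)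
    rw [σ.apply_symm_apply] at this
    exact this.symm
  -- `σ` on one side of the bipartition, completed by its inverse on the other side
  have split : ∀ C : Set V, (∀ v, σ v ≠ v → (v ∈ C ↔ σ v ∉ C)) →
      ∑ v, P.vote M v (if v ∈ C then σ v else σ.symm v) ≤ 0 := by
    intro C hC
    have hC' : ∀ v, σ.symm v ≠ v → (v ∈ C ↔ σ.symm v ∉ C) := by
      intro v hv
      have := hC (σ.symm v) (by rw [σ.apply_symm_apply]; exact hv.symm)
      rw [σ.apply_symm_apply] at this
      tauto
    refine noinv (fun v => if v ∈ C then σ v else σ.symm v) (fun v => ?_) (fun v hv => ?_)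
    · by_cases hvC : v ∈ C
      · rw [if_pos hvC]
        by_cases h : σ v = v
        · rw [h, if_pos hvC, h]
        · rw [if_neg ((hC v h).mp hvC), σ.symm_apply_apply]
      · rw [if_neg hvC]
        by_cases h : σ.symm v = v
        · rw [h, if_neg hvC, h]
        · have : σ.symm v ∈ C := by
            by_contra hcon
            exact hvC ((hC' v h).mpr hcon)
          rw [if_pos this, σ.apply_symm_apply]
    · by_cases hvC : v ∈ C
      · simp only [if_pos hvC] at hv ⊢
        exact hadj v hv
      · simp only [if_neg hvC] at hv ⊢
        exact hadj' v hv
  have hAC : ∀ v, σ v ≠ v → (v ∈ A ↔ σ v ∉ A) := by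
    intro v hv
    have hd : ∀ x, x ∈ A → x ∉ B := fun x hx => Set.disjoint_left.mp hbip.disjoint hx
    rcases hbip.mem_of_adj (hadj v hv) with ⟨h1, h2⟩ | ⟨h1, h2⟩
    · exact ⟨fun _ h => hd _ h h2, fun _ => h1⟩
    · exact ⟨fun h => absurd h1 (hd _ h), fun h => absurd h2 h⟩
  have s1 := split A hAC
  have s2 := split Aᶜ fun v hv => by simpa using not_congr (hAC v hv)
  have s3 : ∑ v, P.vote M v (σ.symm v) = ∑ v, P.vote M (σ v) v := by
    rw [← Equiv.sum_comp σ]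
    simp
  have s4 : (∑ v, P.vote M v (if v ∈ A then σ v else σ.symm v)) +
      ∑ v, P.vote M v (if v ∈ Aᶜ then σ v else σ.symm v) =
      ∑ v, (P.vote M v (σ v) + P.vote M v (σ.symm v)) := by
    rw [← Finset.sum_add_distrib]
    refine Finset.sum_congr rfl fun v _ => ?_
    by_cases h : v ∈ A
    · simp [h]
    · simp [h]; ring
  rw [Finset.sum_add_distrib (g := fun v => P.vote M v (σ.symm v)), s3] at s4
  rw [Finset.sum_add_distrib, ← s4] at hgain
  refine absurd hgain (not_lt.mpr ?_)
  convert add_nonpos s1 s2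

theorem IsPopular.exists_partner_of_forced [Finite V] (hbip : P.graph.IsBipartiteWith A B)
    (h : P.IsPopular M) {v : V} (hv : P.Forced M v) : ∃ m, s(v, m) ∈ M ∧ ¬ P.Forced M m := by
  classical
  have := Fintype.ofFinite V
  have hM := h.1
  by_contra hcon
  push Not at hcon
  obtain ⟨Y, hY⟩ := hv.exists_isExchange hM
  by_cases hm : partner M v = v
  · have e := isExchange_edgeMatrix hM (-(1 / 2)) v v (Or.inl rfl) (Or.inr hm.symm)
    have w : P.vote M v v = 0 := by
      have := P.vote_partner (M := M) v
      rwa [hm] at this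
    refine ((hY.add e).congr (e := fun _ => 0) (b := 1) (fun x => ?_) ?_).not_isPopular hbip hM
      zero_lt_one h
    · split_ifs <;> norm_num
    · rw [w]; norm_num
  · obtain ⟨Z, hZ⟩ := (hcon _ (mem_partner hm)).exists_isExchange hM
    have e := isExchange_edgeMatrix hM (-1) v (partner M v) (Or.inr (hM.adj_partner hm))
      (Or.inr rfl)
    have w1 : P.vote M v (partner M v) = 0 := vote_partner v
    have w2 : P.vote M (partner M v) v = 0 := by
      have := P.vote_partner (M := M) (partner M v)
      rwa [hM.partner_partner] at this
    refine (((hY.add hZ).add e).congr (e := fun _ => 0) (b := 1)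
      (fun x => ?_) ?_).not_isPopular hbip hM zero_lt_one h
    · split_ifs <;> norm_num
    · rw [w1, w2]; norm_num

/-- In a bipartite graph, a matching is popular if and only if every forced vertex is matched to
a vertex that is not forced. -/
theorem IsMatching.isPopular_iff [Finite V] (hbip : P.graph.IsBipartiteWith A B)
    (hM : P.IsMatching M) :
    P.IsPopular M ↔ ∀ v, P.Forced M v → ∃ m, s(v, m) ∈ M ∧ ¬ P.Forced M m :=
  ⟨fun h _ hv => h.exists_partner_of_forced hbip hv, isPopular_of_forced hM⟩

end PrefSystem

/-! ### Reasoning about programs of the random access machine -/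

namespace Mach

/-- Started in `m`, the program `p` halts within `T` steps, with words bounded by `W`, in a state
satisfying `Q`. -/
def Ok (W : ℕ) (p : RamProg) (m : RamState) (T : ℕ) (Q : RamState → Prop) : Prop :=
  ∃ t m', RamExec W p m t m' ∧ t ≤ T ∧ Q m'

variable {W : ℕ} {m : RamState} {Q : RamState → Prop}

theorem Ok.mono {p : RamProg} {T T' : ℕ} {Q' : RamState → Prop} (h : Ok W p m T Q) (hT : T ≤ T')
    (hQ : ∀ m', Q m' → Q' m') : Ok W p m T' Q' := by
  obtain ⟨t, m', h, ht, hq⟩ := h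
  exact ⟨t, m', h, ht.trans hT, hQ m' hq⟩

theorem ok_seq {p q : RamProg} {T₁ T₂ : ℕ} (h : Ok W p m T₁ fun m' => Ok W q m' T₂ Q) :
    Ok W (.seq p q) m (T₁ + T₂) Q := by
  obtain ⟨t₁, m₁, h₁, ht₁, t₂, m₂, h₂, ht₂, hq⟩ := h
  exact ⟨_, m₂, .seq _ _ _ _ _ _ _ h₁ h₂, add_le_add ht₁ ht₂, hq⟩

theorem ok_skip (h : Q m) : Ok W .skip m 1 Q := ⟨_, _, .skip m, le_rfl, h⟩

theorem ok_const {r c : ℕ} (hc : c ≤ W) (h : Q (m.setReg r c)) : Ok W (.const r c) m 1 Q :=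
  ⟨_, _, .const m r c hc, le_rfl, h⟩

theorem ok_copy {r i : ℕ} (h : Q (m.setReg r (m.reg i))) : Ok W (.copy r i) m 1 Q :=
  ⟨_, _, .copy m r i, le_rfl, h⟩

theorem ok_add {r i j : ℕ} (hc : m.reg i + m.reg j ≤ W)
    (h : Q (m.setReg r (m.reg i + m.reg j))) : Ok W (.add r i j) m 1 Q :=
  ⟨_, _, .add m r i j hc, le_rfl, h⟩

theorem ok_sub {r i j : ℕ} (h : Q (m.setReg r (m.reg i - m.reg j))) : Ok W (.sub r i j) m 1 Q :=
  ⟨_, _, .sub m r i j, le_rfl, h⟩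

theorem ok_load {r i : ℕ} (h : Q (m.setReg r (m.mem (m.reg i)))) : Ok W (.load r i) m 1 Q :=
  ⟨_, _, .load m r i, le_rfl, h⟩

theorem ok_store {i j : ℕ} (h : Q (m.setMem (m.reg i) (m.reg j))) : Ok W (.store i j) m 1 Q :=
  ⟨_, _, .store m i j, le_rfl, h⟩

theorem ok_ifLt {i j : ℕ} {p q : RamProg} {T₁ T₂ : ℕ} (hp : m.reg i < m.reg j → Ok W p m T₁ Q)
    (hq : ¬ m.reg i < m.reg j → Ok W q m T₂ Q) : Ok W (.ifLt i j p q) m (1 + max T₁ T₂) Q := by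
  by_cases h : m.reg i < m.reg j
  · obtain ⟨t, m', h', ht, hQ⟩ := hp h
    exact ⟨_, m', .ifTrue _ _ _ _ _ _ _ h h', by omega, hQ⟩
  · obtain ⟨t, m', h', ht, hQ⟩ := hq h
    exact ⟨_, m', .ifFalse _ _ _ _ _ _ _ h h', by omega, hQ⟩

/-- A loop that counts register `i` up to register `j` runs through its body as often as the
difference says. -/
theorem ok_count {i j : ℕ} {p : RamProg} {T : ℕ} (Inv : ℕ → RamState → Prop) (N : ℕ)
    (hcond : ∀ k m, Inv k m → k ≤ N → (m.reg i < m.reg j ↔ k < N))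
    (hbody : ∀ k m, Inv k m → k < N → Ok W p m T (Inv (k + 1))) (h0 : Inv 0 m) :
    Ok W (.whileLt i j p) m (N * (1 + T) + 1) (Inv N) := by
  suffices h : ∀ d k m, k + d = N → Inv k m →
      Ok W (.whileLt i j p) m (d * (1 + T) + 1) (Inv N) from h N 0 m (by omega) h0
  intro d
  induction d with
  | zero =>
    intro k m hk hi
    have hk' : k = N := by omega
    subst hk'
    refine ⟨1, m, .whileDone _ _ _ _ ?_, by omega, hi⟩
    rw [hcond k m hi le_rfl]
    exact lt_irrefl k
  | succ d ih =>
    intro k m hk hi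
    obtain ⟨t₁, m₁, h₁, ht₁, hi₁⟩ := hbody k m hi (by omega)
    obtain ⟨t₂, m₂, h₂, ht₂, hi₂⟩ := ih (k + 1) m₁ (by omega) hi₁
    refine ⟨_, m₂, .whileStep _ _ _ _ _ _ _ _ ((hcond k m hi (by omega)).mpr (by omega)) h₁ h₂,
      ?_, hi₂⟩
    rw [Nat.succ_mul]
    omega

@[simp] theorem reg_setReg (m : RamState) (r x r' : ℕ) :
    (m.setReg r x).reg r' = if r' = r then x else m.reg r' := by
  simp [RamState.setReg, Function.update_apply]

@[simp] theorem mem_setReg (m : RamState) (r x : ℕ) : (m.setReg r x).mem = m.mem := rfl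

@[simp] theorem reg_setMem (m : RamState) (a x : ℕ) : (m.setMem a x).reg = m.reg := rfl

@[simp] theorem mem_setMem (m : RamState) (a x a' : ℕ) :
    (m.setMem a x).mem a' = if a' = a then x else m.mem a' := by
  simp [RamState.setMem, Function.update_apply]

/-! ### A machine with arrays, and its compilation -/

/-- Expressions over registers, sixteen arrays and the input. -/
inductive Exp where
  | reg (r : ℕ)
  | lit (c : ℕ)
  | arr (j : Fin 16) (e : Exp)
  | inp (e : Exp)
  | succ (e : Exp)
  | pred (e : Exp)

/-- Loop-free commands; `out` writes to the output area, and `ite e e'` tests `e < e'`. -/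
inductive Cmd where
  | skip
  | set (r : ℕ) (e : Exp)
  | store (j : Fin 16) (e e' : Exp)
  | out (e e' : Exp)
  | seq (c c' : Cmd)
  | ite (e e' : Exp) (c c' : Cmd)

/-- States of the array machine: registers, arrays, and the output area. -/
structure Store where
  reg : ℕ → ℕ
  arr : Fin 16 → ℕ → ℕ
  out : ℕ → ℕ

/-- The value of an expression; `I` is the (read-only) input. -/
def Exp.eval (I : ℕ → ℕ) (s : Store) : Exp → ℕ
  | .reg r => s.reg r
  | .lit c => c
  | .arr j e => s.arr j (e.eval I s)
  | .inp e => I (e.eval I s)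
  | .succ e => e.eval I s + 1
  | .pred e => e.eval I s - 1

/-- Assign to a register. -/
def Store.setReg (s : Store) (r x : ℕ) : Store := { s with reg := Function.update s.reg r x }

/-- Assign to an entry of an array. -/
def Store.setArr (s : Store) (j : Fin 16) (a x : ℕ) : Store :=
  { s with arr := Function.update s.arr j (Function.update (s.arr j) a x) }

/-- Assign to a cell of the output area. -/
def Store.setOut (s : Store) (a x : ℕ) : Store := { s with out := Function.update s.out a x }

/-- The effect of a command. -/
def Cmd.eval (I : ℕ → ℕ) : Cmd → Store → Store
  | .skip, s => s
  | .set r e, s => s.setReg r (e.eval I s)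
  | .store j e e', s => s.setArr j (e.eval I s) (e'.eval I s)
  | .out e e', s => s.setOut (e.eval I s) (e'.eval I s)
  | .seq c c', s => c'.eval I (c.eval I s)
  | .ite e e' c c', s => if e.eval I s < e'.eval I s then c.eval I s else c'.eval I s

/-- A bound for the growth of numbers under evaluation. -/
def Exp.size : Exp → ℕ
  | .reg _ => 1
  | .lit c => c + 1
  | .arr _ e => e.size + 1
  | .inp e => e.size + 1
  | .succ e => e.size + 1
  | .pred e => e.size + 1

/-- A bound for the growth of numbers under execution. -/
def Cmd.size : Cmd → ℕ
  | .skip => 0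
  | .set _ e => e.size
  | .store _ e e' => e.size + e'.size
  | .out e e' => e.size + e'.size
  | .seq c c' => c.size + c'.size
  | .ite e e' c c' => e.size + e'.size + c.size + c'.size

/-- Convert the index in temporary register `t` into an address of array `j`.  Entry `x` of array
`j` has the address `3 * L + 16 * x + j`, where `L` is the length of the input and register `4`
holds `3 * L`. -/
def addr (t : ℕ) (j : Fin 16) : RamProg :=
  .seq (.add t t t) <| .seq (.add t t t) <| .seq (.add t t t) <| .seq (.add t t t) <|
    .seq (.add t t 4) <| .seq (.const 7 j) (.add t t 7)

/-- Code that evaluates an expression into the temporary register `t`, using register `7`. -/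
def Exp.compile (t : ℕ) : Exp → RamProg
  | .reg r => .copy t (8 + r)
  | .lit c => .const t c
  | .arr j e => .seq (e.compile t) (.seq (addr t j) (.load t t))
  | .inp e => .seq (e.compile t) (.ifLt t 2 (.load t t) (.const t 0))
  | .succ e => .seq (e.compile t) (.seq (.const 7 1) (.add t t 7))
  | .pred e => .seq (e.compile t) (.seq (.const 7 1) (.sub t t 7))

/-- Code for a command. -/
def Cmd.compile : Cmd → RamProg
  | .skip => .skip
  | .set r e => .seq (e.compile 5) (.copy (8 + r) 5)
  | .store j e e' => .seq (e.compile 5) (.seq (addr 5 j) (.seq (e'.compile 6) (.store 5 6)))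
  | .out e e' => .seq (e.compile 5) (.seq (e'.compile 6)
      (.ifLt 5 3 (.seq (.add 5 5 2) (.store 5 6)) .skip))
  | .seq c c' => .seq c.compile c'.compile
  | .ite e e' c c' => .seq (e.compile 5) (.seq (e'.compile 6) (.ifLt 5 6 c.compile c'.compile))

/-- Time bound for `Exp.compile`. -/
def Exp.time : Exp → ℕ
  | .reg _ => 1
  | .lit _ => 1
  | .arr _ e => e.time + (7 + 1)
  | .inp e => e.time + (1 + max 1 1)
  | .succ e => e.time + (1 + 1)
  | .pred e => e.time + (1 + 1)

/-- Time bound for `Cmd.compile`. -/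
def Cmd.time : Cmd → ℕ
  | .skip => 1
  | .set _ e => e.time + 1
  | .store _ e e' => e.time + (7 + (e'.time + 1))
  | .out e e' => e.time + (e'.time + (1 + max (1 + 1) 1))
  | .seq c c' => c.time + c'.time
  | .ite e e' c c' => e.time + (e'.time + (1 + max c.time c'.time))

/-- The machine state `m` represents the store `s`, for an input `I` of length `L`.  Registers
`0`, …, `7` are used by the compiled code.  The cells below `L` hold the input, those from `L` to
`3 * L - 1` the output, and the remaining ones the interleaved arrays. -/
structure Sim (L : ℕ) (I : ℕ → ℕ) (s : Store) (m : RamState) : Prop where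
  reg2 : m.reg 2 = L
  reg3 : m.reg 3 = 2 * L
  reg4 : m.reg 4 = 3 * L
  reg : ∀ r, m.reg (8 + r) = s.reg r
  inp : ∀ x < L, m.mem x = I x
  out : ∀ x < 2 * L, m.mem (L + x) = s.out x
  arr : ∀ (j : Fin 16) x, m.mem (3 * L + 16 * x + j) = s.arr j x

/-- All numbers in the registers and arrays of `s` and in the input are at most `b`. -/
structure Store.Bounded (I : ℕ → ℕ) (s : Store) (b : ℕ) : Prop where
  reg : ∀ r, s.reg r ≤ b
  arr : ∀ j x, s.arr j x ≤ b
  inp : ∀ x, I x ≤ b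

theorem Exp.eval_le {I : ℕ → ℕ} {s : Store} {b : ℕ} (h : s.Bounded I b) (e : Exp) :
    e.eval I s ≤ b + e.size := by
  induction e with
  | reg r => have := h.reg r; simp only [Exp.eval, Exp.size]; omega
  | lit c => simp only [Exp.eval, Exp.size]; omega
  | arr j e ih => have := h.arr j (e.eval I s); simp only [Exp.eval, Exp.size]; omega
  | inp e ih => have := h.inp (e.eval I s); simp only [Exp.eval, Exp.size]; omega
  | succ e ih => simp only [Exp.eval, Exp.size]; omega
  | pred e ih => simp only [Exp.eval, Exp.size]; omega

theorem Store.Bounded.mono {I : ℕ → ℕ} {s : Store} {b b' : ℕ} (h : s.Bounded I b) (hb : b ≤ b') :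
    s.Bounded I b' :=
  ⟨fun r => (h.reg r).trans hb, fun j x => (h.arr j x).trans hb, fun x => (h.inp x).trans hb⟩

theorem Cmd.eval_bounded {I : ℕ → ℕ} {s : Store} {b : ℕ} (h : s.Bounded I b) (c : Cmd) :
    (c.eval I s).Bounded I (b + c.size) := by
  induction c generalizing s b with
  | skip => exact h
  | set r e =>
    have h1 := e.eval_le h
    have h2 := h.mono (Nat.le_add_right b e.size)
    refine ⟨fun r' => ?_, h2.arr, h2.inp⟩
    simp only [Cmd.eval, Store.setReg, Function.update_apply]
    split_ifs
    · exact h1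
    · exact h2.reg r'
  | store j e e' =>
    have h1 := e'.eval_le h
    have h2 : s.Bounded I (b + (e.size + e'.size)) := h.mono (Nat.le_add_right b _)
    refine ⟨h2.reg, fun j' x => ?_, h2.inp⟩
    have h3 := h2.arr j' x
    simp only [Cmd.eval, Store.setArr, Function.update_apply, Cmd.size]
    split_ifs with hj
    · subst hj
      rw [Function.update_apply]
      split_ifs
      · omega
      · exact h3
    · exact h3
  | out e e' => exact ⟨fun r => (h.mono (Nat.le_add_right b _)).reg r,
      fun j x => (h.mono (Nat.le_add_right b _)).arr j x, (h.mono (Nat.le_add_right b _)).inp⟩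
  | seq c c' ih ih' =>
    have := ih' (ih h)
    rwa [add_assoc] at this
  | ite e e' c c' ih ih' =>
    simp only [Cmd.eval, Cmd.size]
    split_ifs
    · exact (ih h).mono (by omega)
    · exact (ih' h).mono (by omega)

theorem ok_addr {t x L : ℕ} {j : Fin 16} (ht : t = 5 ∨ t = 6) (hx : m.reg t = x)
    (h4 : m.reg 4 = 3 * L) (hW : 3 * L + 16 * x + 16 ≤ W) :
    Ok W (addr t j) m 7 fun m' => m'.reg t = 3 * L + 16 * x + j ∧ m'.mem = m.mem ∧
      ∀ r, r ≠ t → r ≠ 7 → m'.reg r = m.reg r := by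
  have hj := j.isLt
  have h4t : 4 ≠ t := by omega
  have h7t : t ≠ 7 := by omega
  unfold addr
  refine ok_seq (T₁ := 1) (T₂ := 6) (ok_add (by omega) ?_)
  refine ok_seq (T₁ := 1) (T₂ := 5) (ok_add (by simp; omega) ?_)
  refine ok_seq (T₁ := 1) (T₂ := 4) (ok_add (by simp; omega) ?_)
  refine ok_seq (T₁ := 1) (T₂ := 3) (ok_add (by simp; omega) ?_)
  refine ok_seq (T₁ := 1) (T₂ := 2) (ok_add (by simp [h4t]; omega) ?_)
  refine ok_seq (T₁ := 1) (T₂ := 1) (ok_const (by omega) ?_)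
  refine ok_add (by simp [h4t, h7t]; omega) ⟨?_, rfl, fun r hr h7 => ?_⟩
  · simp [h4t, h7t]; omega
  · simp [hr, h7]

/-- The code for an expression is correct.  The bound `b` on the numbers in the store bounds the
addresses that the code computes. -/
theorem ok_exp {L : ℕ} {I : ℕ → ℕ} (hI : ∀ x, L ≤ x → I x = 0) {s : Store} {b : ℕ}
    (hs : s.Bounded I b) {t : ℕ} (ht : t = 5 ∨ t = 6) (e : Exp)
    (hW : 3 * L + 16 * (b + e.size) + 16 ≤ W) (h : Sim L I s m) :
    Ok W (e.compile t) m e.time fun m' => m'.reg t = e.eval I s ∧ m'.mem = m.mem ∧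
      ∀ r, r ≠ t → r ≠ 7 → m'.reg r = m.reg r := by
  have h7t : t ≠ 7 := by omega
  induction e with
  | reg r =>
    refine ok_copy ⟨?_, rfl, fun r hr h7 => ?_⟩
    · simp [h.reg, Exp.eval]
    · simp [hr]
  | lit c =>
    refine ok_const (by simp only [Exp.size] at hW; omega) ⟨?_, rfl, fun r hr h7 => ?_⟩
    · simp [Exp.eval]
    · simp [hr]
  | arr j e ih =>
    simp only [Exp.size] at hW
    have he := e.eval_le hs
    refine ok_seq ((ih (by omega)).mono le_rfl ?_)
    rintro m₁ ⟨e1, e2, e3⟩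
    refine ok_seq ((ok_addr (x := e.eval I s) (L := L) ht e1
      (by rw [e3 4 (by omega) (by omega), h.reg4]) (by omega)).mono le_rfl ?_)
    rintro m₂ ⟨f1, f2, f3⟩
    refine ok_load ⟨?_, by rw [mem_setReg, f2, e2], fun r hr h7 => ?_⟩
    · simp [f1, f2, e2, h.arr, Exp.eval]
    · simp [hr, f3 r hr h7, e3 r hr h7]
  | inp e ih =>
    simp only [Exp.size] at hW
    have he := e.eval_le hs
    refine ok_seq ((ih (by omega)).mono le_rfl ?_)
    rintro m₁ ⟨e1, e2, e3⟩
    have h2 : m₁.reg 2 = L := by rw [e3 2 (by omega) (by omega), h.reg2]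
    refine ok_ifLt (fun hlt => ok_load ⟨?_, by rw [mem_setReg, e2], fun r hr h7 => ?_⟩)
      (fun hlt => ok_const (Nat.zero_le _) ⟨?_, by rw [mem_setReg, e2], fun r hr h7 => ?_⟩)
    · rw [h2, e1] at hlt
      simp [e1, e2, h.inp _ hlt, Exp.eval]
    · simp [hr, e3 r hr h7]
    · rw [h2, e1, not_lt] at hlt
      simp [hI _ hlt, Exp.eval]
    · simp [hr, e3 r hr h7]
  | succ e ih =>
    simp only [Exp.size] at hW
    have he := e.eval_le hs
    refine ok_seq ((ih (by omega)).mono le_rfl ?_)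
    rintro m₁ ⟨e1, e2, e3⟩
    refine ok_seq (ok_const (by omega) (ok_add (by simp [h7t, e1]; omega) ⟨?_, ?_, ?_⟩))
    · simp [h7t, e1, Exp.eval]
    · simp [e2]
    · intro r hr h7
      simp [hr, h7, e3 r hr h7]
  | pred e ih =>
    simp only [Exp.size] at hW
    refine ok_seq ((ih (by omega)).mono le_rfl ?_)
    rintro m₁ ⟨e1, e2, e3⟩
    refine ok_seq (ok_const (by omega) (ok_sub ⟨?_, ?_, ?_⟩))
    · simp [h7t, e1, Exp.eval]
    · simp [e2]
    · intro r hr h7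
      simp [hr, h7, e3 r hr h7]

/-- `Sim` does not depend on registers `0`, `1`, `5`, `6` and `7`. -/
theorem Sim.of_eq {L : ℕ} {I : ℕ → ℕ} {s : Store} {m m' : RamState} (h : Sim L I s m)
    (hmem : m'.mem = m.mem)
    (hreg : ∀ r, r ≠ 0 → r ≠ 1 → r ≠ 5 → r ≠ 6 → r ≠ 7 → m'.reg r = m.reg r) : Sim L I s m' where
  reg2 := by rw [hreg 2 (by omega) (by omega) (by omega) (by omega) (by omega), h.reg2]
  reg3 := by rw [hreg 3 (by omega) (by omega) (by omega) (by omega) (by omega), h.reg3]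
  reg4 := by rw [hreg 4 (by omega) (by omega) (by omega) (by omega) (by omega), h.reg4]
  reg r := by rw [hreg _ (by omega) (by omega) (by omega) (by omega) (by omega), h.reg]
  inp := by rw [hmem]; exact h.inp
  out := by rw [hmem]; exact h.out
  arr := by rw [hmem]; exact h.arr

/-- The code for a command is correct. -/
theorem ok_cmd {L : ℕ} {I : ℕ → ℕ} (hI : ∀ x, L ≤ x → I x = 0) {s : Store} {b : ℕ}
    (hs : s.Bounded I b) (c : Cmd) (hW : 3 * L + 16 * (b + c.size) + 16 ≤ W) (h : Sim L I s m) :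
    Ok W c.compile m c.time fun m' => Sim L I (c.eval I s) m' ∧
      m'.reg 0 = m.reg 0 ∧ m'.reg 1 = m.reg 1 := by
  induction c generalizing s m b with
  | skip => exact ok_skip ⟨h, rfl, rfl⟩
  | set r e =>
    simp only [Cmd.size] at hW
    refine ok_seq ((ok_exp hI hs (Or.inl rfl) e hW h).mono le_rfl ?_)
    rintro m₁ ⟨e1, e2, e3⟩
    refine ok_copy ⟨?_, ?_, ?_⟩
    · have h1 : Sim L I s m₁ := h.of_eq e2 fun r _ _ h5 _ h7 => e3 r h5 h7
      refine ⟨?_, ?_, ?_, fun r' => ?_, h1.inp, h1.out, h1.arr⟩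
      · rw [reg_setReg, if_neg (by omega), h1.reg2]
      · rw [reg_setReg, if_neg (by omega), h1.reg3]
      · rw [reg_setReg, if_neg (by omega), h1.reg4]
      · simp only [reg_setReg, Cmd.eval, Store.setReg, Function.update_apply, e1, h1.reg]
        exact if_congr (by omega) rfl rfl
    · rw [reg_setReg, if_neg (by omega), e3 0 (by omega) (by omega)]
    · rw [reg_setReg, if_neg (by omega), e3 1 (by omega) (by omega)]
  | store j e e' =>
    simp only [Cmd.size] at hW
    have he := e.eval_le hs
    refine ok_seq ((ok_exp hI hs (Or.inl rfl) e (by omega) h).mono le_rfl ?_)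
    rintro m₁ ⟨e1, e2, e3⟩
    refine ok_seq ((ok_addr (x := e.eval I s) (L := L) (Or.inl rfl) e1
      (by rw [e3 4 (by omega) (by omega), h.reg4]) (by omega)).mono le_rfl ?_)
    rintro m₂ ⟨f1, f2, f3⟩
    have h2 : Sim L I s m₂ := h.of_eq (f2.trans e2) fun r _ _ h5 _ h7 => by
      rw [f3 r h5 h7, e3 r h5 h7]
    refine ok_seq ((ok_exp hI hs (Or.inr rfl) e' (by omega) h2).mono le_rfl ?_)
    rintro m₃ ⟨g1, g2, g3⟩
    have h3 : Sim L I s m₃ := h2.of_eq g2 fun r _ _ _ h6 h7 => by rw [g3 r h6 h7]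
    have h5 : m₃.reg 5 = 3 * L + 16 * e.eval I s + j := by rw [g3 5 (by omega) (by omega), f1]
    have hj := j.isLt
    refine ok_store ⟨⟨h3.reg2, h3.reg3, h3.reg4, h3.reg, fun x hx => ?_, fun x hx => ?_,
      fun j' x => ?_⟩, ?_, ?_⟩
    · rw [mem_setMem, if_neg (by omega), h3.inp x hx]
    · rw [mem_setMem, if_neg (by omega), h3.out x hx]
      rfl
    · have hj' := j'.isLt
      rw [mem_setMem, h5, g1, h3.arr]
      simp only [Cmd.eval, Store.setArr, Function.update_apply]
      by_cases hjj : j' = j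
      · subst hjj
        rw [if_pos rfl, Function.update_apply]
        exact if_congr (by omega) rfl rfl
      · rw [if_neg hjj, if_neg]
        intro hc
        exact hjj (Fin.ext (by omega))
    · simp [g3, f3, e3]
    · simp [g3, f3, e3]
  | out e e' =>
    simp only [Cmd.size] at hW
    have he := e.eval_le hs
    refine ok_seq ((ok_exp hI hs (Or.inl rfl) e (by omega) h).mono le_rfl ?_)
    rintro m₁ ⟨e1, e2, e3⟩
    have h1 : Sim L I s m₁ := h.of_eq e2 fun r _ _ h5 _ h7 => e3 r h5 h7
    refine ok_seq ((ok_exp hI hs (Or.inr rfl) e' (by omega) h1).mono le_rfl ?_)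
    rintro m₂ ⟨f1, f2, f3⟩
    have h2 : Sim L I s m₂ := h1.of_eq f2 fun r _ _ _ h6 h7 => f3 r h6 h7
    have h5 : m₂.reg 5 = e.eval I s := by rw [f3 5 (by omega) (by omega), e1]
    refine ok_ifLt (fun hlt => ?_) (fun hlt => ?_)
    · rw [h5, h2.reg3] at hlt
      refine ok_seq (ok_add (by rw [h5, h2.reg2]; omega)
        (ok_store ⟨⟨?_, ?_, ?_, fun r => ?_, fun x hx => ?_, fun x hx => ?_,
        fun j' x => ?_⟩, ?_, ?_⟩))
      · simp [h2.reg2]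
      · simp [h2.reg3]
      · simp [h2.reg4]
      · rw [reg_setMem, reg_setReg, if_neg (by omega), h2.reg]
        rfl
      · rw [mem_setMem, if_neg, mem_setReg, h2.inp x hx]
        simp [h5, h2.reg2]; omega
      · rw [mem_setMem, mem_setReg, h2.out x hx]
        simp only [Cmd.eval, Store.setOut, Function.update_apply]
        exact if_congr (by simp [h5, h2.reg2]; omega) (by simp [f1]) rfl
      · rw [mem_setMem, mem_setReg, h2.arr, if_neg]
        · rfl
        · simp [h5, h2.reg2]; omega
      · simp [f3, e3]
      · simp [f3, e3]
    · rw [h5, h2.reg3] at hlt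
      refine ok_skip ⟨⟨h2.reg2, h2.reg3, h2.reg4, h2.reg, h2.inp, fun x hx => ?_, h2.arr⟩, ?_, ?_⟩
      · rw [h2.out x hx]
        simp only [Cmd.eval, Store.setOut, Function.update_apply]
        rw [if_neg (by omega)]
      · simp [f3, e3]
      · simp [f3, e3]
  | seq c c' ih ih' =>
    simp only [Cmd.size] at hW
    refine ok_seq ((ih hs (by omega) h).mono le_rfl ?_)
    rintro m₁ ⟨e1, e2, e3⟩
    refine (ih' (c.eval_bounded hs) (by omega) e1).mono le_rfl ?_
    rintro m₂ ⟨f1, f2, f3⟩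
    exact ⟨f1, f2.trans e2, f3.trans e3⟩
  | ite e e' c c' ih ih' =>
    simp only [Cmd.size] at hW
    refine ok_seq ((ok_exp hI hs (Or.inl rfl) e (by omega) h).mono le_rfl ?_)
    rintro m₁ ⟨e1, e2, e3⟩
    have h1 : Sim L I s m₁ := h.of_eq e2 fun r _ _ h5 _ h7 => e3 r h5 h7
    refine ok_seq ((ok_exp hI hs (Or.inr rfl) e' (by omega) h1).mono le_rfl ?_)
    rintro m₂ ⟨f1, f2, f3⟩
    have h2 : Sim L I s m₂ := h1.of_eq f2 fun r _ _ _ h6 h7 => f3 r h6 h7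
    have h5 : m₂.reg 5 = e.eval I s := by rw [f3 5 (by omega) (by omega), e1]
    refine ok_ifLt (fun hlt => ?_) (fun hlt => ?_)
    · rw [h5, f1] at hlt
      simp only [Cmd.eval, if_pos hlt]
      refine (ih hs (by omega) h2).mono le_rfl ?_
      rintro m₃ ⟨g1, g2, g3⟩
      exact ⟨g1, by simp [g2, f3, e3], by simp [g3, f3, e3]⟩
    · rw [h5, f1] at hlt
      simp only [Cmd.eval, if_neg hlt]
      refine (ih' hs (by omega) h2).mono le_rfl ?_
      rintro m₃ ⟨g1, g2, g3⟩
      exact ⟨g1, by simp [g2, f3, e3], by simp [g3, f3, e3]⟩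

end Mach

/-! ### Programs that consist of phases -/

namespace Mach

variable {W : ℕ} {m : RamState} {Q : RamState → Prop}

/-- A phase of a program: an initial command, and a body that is executed `4 * L` times, where `L`
is the length of the input. -/
structure Phase where
  init : Cmd
  body : Cmd

/-- The effect of a phase. -/
def Phase.eval (I : ℕ → ℕ) (L : ℕ) (p : Phase) (s : Store) : Store :=
  (p.body.eval I)^[4 * L] (p.init.eval I s)

/-- Code for a phase: registers `0` and `1` count the executions of the body. -/
def Phase.compile (p : Phase) : RamProg :=
  .seq p.init.compile <| .seq (.copy 1 2) <| .seq (.add 1 1 1) <| .seq (.add 1 1 1) <|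
    .seq (.const 0 0) <| .whileLt 0 1 (.seq p.body.compile (.seq (.const 7 1) (.add 0 0 7)))

theorem Cmd.iterate_eval_bounded {I : ℕ → ℕ} {s : Store} {b : ℕ} (h : s.Bounded I b) (c : Cmd)
    (k : ℕ) : ((c.eval I)^[k] s).Bounded I (b + k * c.size) := by
  induction k with
  | zero => simpa using h
  | succ k ih =>
    rw [Function.iterate_succ_apply']
    have := c.eval_bounded ih
    rwa [add_assoc, ← Nat.succ_mul] at this

theorem Phase.eval_bounded {I : ℕ → ℕ} {s : Store} {b L : ℕ} (h : s.Bounded I b) (p : Phase) :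
    (p.eval I L s).Bounded I (b + p.init.size + 4 * L * p.body.size) :=
  p.body.iterate_eval_bounded (p.init.eval_bounded h) _

/-- The code for a phase is correct.  Numbers grow by at most a constant in each of the `4 * L`
executions of the body. -/
theorem ok_phase {L : ℕ} {I : ℕ → ℕ} (hI : ∀ x, L ≤ x → I x = 0) {s : Store} {b : ℕ}
    (hs : s.Bounded I b) (p : Phase)
    (hW : 3 * L + 16 * (b + p.init.size + 4 * L * p.body.size + p.body.size) + 16 + 4 * L ≤ W)
    (h : Sim L I s m) :
    Ok W p.compile m (p.init.time + (1 + (1 + (1 + (1 + (4 * L * (1 + (p.body.time + 2)) + 1))))))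
      (Sim L I (p.eval I L s)) := by
  refine ok_seq ((ok_cmd hI hs p.init (by omega) h).mono le_rfl ?_)
  rintro m₁ ⟨h1, -, -⟩
  have h2 := h1.reg2
  refine ok_seq (ok_copy (ok_seq (ok_add (by simp [h2]; omega)
    (ok_seq (ok_add (by simp [h2]; omega) (ok_seq (ok_const (Nat.zero_le _)
    ((ok_count (fun k m => Sim L I ((p.body.eval I)^[k] (p.init.eval I s)) m ∧ m.reg 0 = k ∧
      m.reg 1 = 4 * L) (4 * L) ?_ ?_ ?_).mono le_rfl fun m' h' => h'.1))))))))
  · rintro k m ⟨-, e0, e1⟩ -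
    rw [e0, e1]
  · rintro k m₂ ⟨e2, e0, e1⟩ hk
    have hb : ((p.body.eval I)^[k] (p.init.eval I s)).Bounded I
        (b + p.init.size + 4 * L * p.body.size) :=
      (p.body.iterate_eval_bounded (p.init.eval_bounded hs) k).mono
        (Nat.add_le_add_left (Nat.mul_le_mul_right _ hk.le) _)
    refine ok_seq (T₂ := 2) ((ok_cmd hI hb p.body (by omega) e2).mono le_rfl ?_)
    rintro m₃ ⟨f1, f2, f3⟩
    refine ok_seq (T₁ := 1) (T₂ := 1) (ok_const (by omega) (ok_add (by simp [f2, e0]; omega)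
      ⟨?_, ?_, ?_⟩))
    · rw [Function.iterate_succ_apply']
      refine f1.of_eq rfl fun r h0 h1 h5 h6 h7 => ?_
      simp [h0, h7]
    · simp [f2, e0]
    · simp [f3, e1]
  · refine ⟨?_, by simp, ?_⟩
    · refine h1.of_eq rfl fun r h0 h1 h5 h6 h7 => ?_
      simp [h0, h1]
    · simp [h2]; omega

/-- The effect of a sequence of phases. -/
def evalPhases (I : ℕ → ℕ) (L : ℕ) (ps : List Phase) (s : Store) : Store :=
  ps.foldl (fun s p => p.eval I L s) s

/-- Code for a sequence of phases. -/
def compilePhases : List Phase → RamProg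
  | [] => .skip
  | p :: ps => .seq p.compile (compilePhases ps)

theorem ok_phases (ps : List Phase) : ∃ K, ∀ (L : ℕ) (I : ℕ → ℕ), (∀ x, L ≤ x → I x = 0) →
    ∀ (s : Store) (b W : ℕ) (m : RamState), s.Bounded I b → K * (b + L + 1) ≤ W → Sim L I s m →
      Ok W (compilePhases ps) m (K * (L + 1)) (Sim L I (evalPhases I L ps s)) := by
  induction ps with
  | nil => exact ⟨1, fun L I hI s b W m hs hW h => (ok_skip h).mono (by omega) fun _ h => h⟩
  | cons p ps ih =>
    obtain ⟨K, ih⟩ := ih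
    set i := p.init.size
    set c := p.body.size
    refine ⟨K * (i + 4 * c + 1) + 128 * (i + c + 1) + (p.init.time + 4 * p.body.time + 32),
      fun L I hI s b W m hs hW h => ?_⟩
    have hW1 : 128 * (i + c + 1) * (b + L + 1) ≤ W := by
      refine le_trans (Nat.mul_le_mul_right _ ?_) hW
      omega
    have hW2 : K * ((i + 4 * c + 1) * (b + L + 1)) ≤ W := by
      rw [← mul_assoc]
      refine le_trans (Nat.mul_le_mul_right _ ?_) hW
      omega
    refine (ok_seq ((ok_phase hI hs p ?_ h).mono le_rfl fun m₁ h₁ =>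
      ih L I hI _ (b + i + 4 * L * c) W m₁ (p.eval_bounded hs) ?_ h₁)).mono ?_ fun m' h' => h'
    · refine le_trans ?_ hW1
      nlinarith [Nat.zero_le (i * b), Nat.zero_le (i * L), Nat.zero_le (c * b),
        Nat.zero_le (c * L)]
    · refine le_trans (Nat.mul_le_mul_left K ?_) hW2
      nlinarith [Nat.zero_le (i * b), Nat.zero_le (i * L), Nat.zero_le (c * b),
        Nat.zero_le (c * L)]
    · set x := p.init.time
      set y := p.body.time
      have h1 : K * (L + 1) ≤ (K * (i + 4 * c + 1)) * (L + 1) :=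
        Nat.mul_le_mul_right _ (Nat.le_mul_of_pos_right _ (by omega))
      have h2 : x + (1 + (1 + (1 + (1 + (4 * L * (1 + (y + 2)) + 1))))) ≤
          (x + 4 * y + 32) * (L + 1) := by
        nlinarith [Nat.zero_le (x * L), Nat.zero_le (y * L)]
      calc _ ≤ (x + 4 * y + 32) * (L + 1) + (K * (i + 4 * c + 1)) * (L + 1) :=
            add_le_add h2 h1
        _ ≤ _ := by
            rw [← add_mul]
            exact Nat.mul_le_mul_right _ (by omega)

/-- An input that consists of two numbers, with the sum `bl.length`, and of the concatenation of
the blocks `bl`, each of which consists of a word, half the length of the rest, and the rest. -/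
structure IsBlockInput (w : List ℕ) (bl : List (List ℕ)) : Prop where
  eq : ∃ a b, w = a :: b :: bl.flatten ∧ a + b = bl.length
  block : ∀ l ∈ bl, ∃ x d r, l = x :: d :: r ∧ r.length = 2 * d

/-- Code that finds the length of the input by running through the blocks, stores it and its
multiples in registers `2`, `3` and `4`, and puts it into register `0` of the array machine. -/
def prelude : RamProg :=
  .seq (.const 2 2) <| .seq (.const 0 0) <| .seq (.load 1 0) <| .seq (.const 7 1) <|
  .seq (.load 5 7) <| .seq (.add 1 1 5) <|
  .seq (.whileLt 0 1 (.seq (.const 7 1) <| .seq (.add 5 2 7) <| .seq (.load 6 5) <|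
    .seq (.add 6 6 6) <| .seq (.add 2 2 6) <| .seq (.add 2 2 7) <| .seq (.add 2 2 7) <|
    .add 0 0 7)) <|
  .seq (.add 3 2 2) <| .seq (.add 4 3 2) (.copy 8 2)

/-- The store in which the phases start. -/
def Store.start (L : ℕ) : Store := ⟨fun r => if r = 0 then L else 0, fun _ _ => 0, fun _ => 0⟩

theorem ok_prelude {w : List ℕ} {bl : List (List ℕ)} (h : IsBlockInput w bl)
    (hW : 4 * w.length + 4 ≤ W) :
    Ok W prelude (RamState.init w) (16 * (w.length + 1))
      (Sim w.length (fun x => w.getD x 0) (Store.start w.length)) := by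
  obtain ⟨⟨a, b, hw, hab⟩, hblock⟩ := h
  have hlen : w.length = 2 + bl.flatten.length := by rw [hw]; simp; omega
  have hbl : ∀ l ∈ bl, 1 ≤ l.length := by
    intro l hl
    obtain ⟨x, d, r, rfl, -⟩ := hblock l hl
    simp
  have hcard : bl.length ≤ bl.flatten.length := by
    rw [List.length_flatten]
    calc bl.length = (bl.map List.length).length := by simp
      _ ≤ _ := List.length_le_sum_of_one_le _ (by simpa using hbl)
  have hm0 : w[0]?.getD 0 = a := by rw [hw]; simp
  have hm1 : w[1]?.getD 0 = b := by rw [hw]; simp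
  suffices hh : Ok W prelude (RamState.init w) (1 + (1 + (1 + (1 + (1 + (1 +
      ((bl.length * (1 + 8) + 1) + (1 + (1 + 1)))))))))
      (Sim w.length (fun x => w.getD x 0) (Store.start w.length)) from
    hh.mono (by omega) fun _ h => h
  refine ok_seq (ok_const (by omega) (ok_seq (ok_const (by omega) (ok_seq (ok_load
    (ok_seq (ok_const (by omega) (ok_seq (ok_load (ok_seq (ok_add ?_
    (ok_seq ((ok_count (fun k m => m.reg 2 = 2 + (bl.take k).flatten.length ∧ m.reg 0 = k ∧
      m.reg 1 = bl.length ∧ (∀ r, 8 ≤ r → m.reg r = 0) ∧ m.mem = fun x => w.getD x 0) bl.length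
      ?_ ?_ ?_).mono le_rfl ?_)))))))))))))
  · simp [RamState.init, hm0, hm1]; omega
  · rintro k m ⟨-, e0, e1, -⟩ -
    rw [e0, e1]
  · rintro k m ⟨e2, e0, e1, e8, em⟩ hk
    obtain ⟨x, d, r, hl, hr⟩ := hblock bl[k] (List.getElem_mem hk)
    have hsplit : bl.flatten = (bl.take k).flatten ++ (x :: d :: r) ++
        (bl.drop (k + 1)).flatten := by
      conv_lhs => rw [← List.take_append_drop k bl]
      rw [List.flatten_append, List.drop_eq_getElem_cons hk, List.flatten_cons, hl,
        List.append_assoc]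
    have hlen2 : w.length = 2 + (bl.take k).flatten.length + (2 + 2 * d) +
        (bl.drop (k + 1)).flatten.length := by
      rw [hlen, hsplit]; simp [hr]; omega
    have hd : w[2 + (bl.take k).flatten.length + 1]?.getD 0 = d := by
      have : w = (a :: b :: (bl.take k).flatten) ++ (x :: d :: r) ++
          (bl.drop (k + 1)).flatten := by rw [hw, hsplit]; simp
      rw [this, List.append_assoc, List.getElem?_append_right (by simp)]
      have : 2 + (bl.take k).flatten.length + 1 - (a :: b :: (bl.take k).flatten).length = 1 := by
        simp; omega
      rw [this]
      rfl
    have htake : (bl.take (k + 1)).flatten.length =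
        (bl.take k).flatten.length + (2 + 2 * d) := by
      rw [← List.take_concat_get' bl k hk, List.flatten_append, hl]
      simp [hr]; omega
    have hd' : m.mem (m.reg 2 + 1) = d := by
      rw [em, e2]
      simpa using hd
    refine ok_seq (T₁ := 1) (T₂ := 7) (ok_const (by omega) (ok_seq (T₁ := 1) (T₂ := 6)
      (ok_add (by simp; omega) (ok_seq (T₁ := 1) (T₂ := 5) (ok_load
      (ok_seq (T₁ := 1) (T₂ := 4) (ok_add (by simp [hd']; omega)
      (ok_seq (T₁ := 1) (T₂ := 3) (ok_add (by simp [hd']; omega)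
      (ok_seq (T₁ := 1) (T₂ := 2) (ok_add (by simp [hd']; omega)
      (ok_seq (T₁ := 1) (T₂ := 1) (ok_add (by simp [hd']; omega)
      (ok_add (by simp; omega) ⟨?_, ?_, ?_, fun r hr => ?_, ?_⟩))))))))))))))
    · rw [htake, ← Nat.add_assoc, ← e2]; simp [hd']; omega
    · simp [e0]
    · simp [e1]
    · have := e8 r hr
      simp [this, show r ≠ 0 by omega, show r ≠ 2 by omega, show r ≠ 5 by omega,
        show r ≠ 6 by omega, show r ≠ 7 by omega]
    · simp [em]
  · refine ⟨by simp, by simp, ?_, fun r hr => ?_, by simp [RamState.init]⟩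
    · simp [RamState.init, hm0, hm1]; omega
    · simp [RamState.init, show r ≠ 0 by omega, show r ≠ 1 by omega, show r ≠ 2 by omega,
        show r ≠ 5 by omega, show r ≠ 7 by omega]
  · rintro m ⟨e2, e0, e1, e8, em⟩
    rw [List.take_length, ← hlen] at e2
    refine ok_seq (ok_add (by omega) (ok_seq (ok_add (by simp [e2]; omega) (ok_copy
      ⟨?_, ?_, ?_, fun r => ?_, fun x hx => ?_, fun x hx => ?_, fun j x => ?_⟩))))
    · simp [e2]
    · simp [e2]; omega
    · simp [e2]; omega
    · by_cases hr : r = 0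
      · simp [hr, e2, Store.start]
      · have h8 := e8 (8 + r) (by omega)
        simp [hr, Store.start, h8, show 8 + r ≠ 3 by omega, show 8 + r ≠ 4 by omega]
    · simp [em]
    · simp only [mem_setReg, em, Store.start]
      rw [List.getD_eq_default _ _ (by omega)]
    · simp only [mem_setReg, em, Store.start]
      rw [List.getD_eq_default _ _ (by omega)]

/-- Code that presents the answer: registers `b` and `c` of the array machine contain `0` if there
is a solution, and the number of its edges. -/
def epilogue (b c : ℕ) : RamProg :=
  .seq (.const 7 1) <| .seq (.sub 0 7 (8 + b)) <| .seq (.copy 1 2) (.copy 2 (8 + c))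

/-- Every sequence of phases is carried out by a program of the random access machine, in time and
with words linear in the length of the input (and, for the words, in its entries). -/
theorem exists_program (ps : List Phase) (b c : ℕ) : ∃ (p : RamProg) (K : ℕ),
    ∀ (w : List ℕ) (bl : List (List ℕ)) (β W : ℕ), IsBlockInput w bl → (∀ x ∈ w, x ≤ β) →
      K * (β + w.length + 1) ≤ W →
      Ok W p (RamState.init w) (K * (w.length + 1)) fun m =>
        let s := evalPhases (fun x => w.getD x 0) w.length ps (Store.start w.length)
        m.reg 0 = 1 - s.reg b ∧ m.reg 1 = w.length ∧ m.reg 2 = s.reg c ∧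
          ∀ x < 2 * w.length, m.mem (w.length + x) = s.out x := by
  obtain ⟨K, hK⟩ := ok_phases ps
  refine ⟨.seq prelude (.seq (compilePhases ps) (epilogue b c)), 2 * K + 32,
    fun w bl β W hw hβ hW => ?_⟩
  have hbd : (Store.start w.length).Bounded (fun x => w.getD x 0) (β + w.length) := by
    refine ⟨fun r => ?_, fun j x => Nat.zero_le _, fun x => ?_⟩
    · simp only [Store.start]
      split_ifs <;> omega
    · by_cases hx : x < w.length
      · have := hβ _ (List.getElem_mem hx)
        simp only [List.getD_eq_getElem _ _ hx]
        omega
      · simp only [List.getD_eq_default _ _ (not_lt.mp hx)]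
        omega
  have hW' : 2 * (K * (β + w.length + 1)) + 32 * (β + w.length + 1) ≤ W := by
    rw [add_mul, mul_assoc] at hW
    exact hW
  have hW2 : K * (β + w.length + w.length + 1) ≤ W := by
    have : K * (β + w.length + w.length + 1) ≤ K * (2 * (β + w.length + 1)) :=
      Nat.mul_le_mul_left K (by omega)
    rw [mul_left_comm] at this
    omega
  refine (ok_seq ((ok_prelude hw (by omega)).mono le_rfl fun m hm =>
    ok_seq ((hK _ _ (fun x hx => List.getD_eq_default _ _ hx) _ _ W m hbd hW2 hm).mono le_rfl
      fun m hm => ?_))).mono (T := 16 * (w.length + 1) + (K * (w.length + 1) + 4)) ?_ fun _ h => h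
  · refine ok_seq (T₁ := 1) (T₂ := 3) (ok_const (by omega) (ok_seq (T₁ := 1) (T₂ := 2) (ok_sub
      (ok_seq (T₁ := 1) (T₂ := 1) (ok_copy (ok_copy ⟨?_, ?_, ?_, ?_⟩))))))
    · simp [hm.reg, show 8 + b ≠ 7 by omega]
    · simp [hm.reg2]
    · simp [hm.reg, show 8 + c ≠ 1 by omega, show 8 + c ≠ 7 by omega]
    · exact hm.out
  · rw [add_mul, mul_assoc]
    omega

end Mach

/-! ### The layout of the input -/

/-- The input `I`, of length `L`, decoded: the non-isolated vertices `vs` in the order of their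
blocks, those of `A` first; the preference lists `pl`; and the addresses `off k` of the blocks. -/
structure Layout {n : ℕ} (P : PrefSystem (Fin n)) (A : Set (Fin n)) (S : Set (Sym2 (Fin n)))
    (I : ℕ → ℕ) (L : ℕ) where
  vs : List (Fin n)
  pl : Fin n → List (Fin n)
  off : ℕ → ℕ
  pref : ∀ v, P.IsPrefList v (pl v)
  nodup : vs.Nodup
  mem_vs : ∀ v, v ∈ vs ↔ pl v ≠ []
  side : ∀ k (h : k < vs.length), vs[k] ∈ A ↔ k < I 0
  off_zero : off 0 = 2
  off_succ : ∀ k (h : k < vs.length), off (k + 1) = off k + 2 + 2 * (pl vs[k]).length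
  off_length : off vs.length = L
  inp_off : ∀ k (h : k < vs.length), I (off k) = vs[k]
  inp_deg : ∀ k (h : k < vs.length), I (off k + 1) = (pl vs[k]).length
  inp_nb : ∀ k (h : k < vs.length) i (hi : i < (pl vs[k]).length),
    I (off k + 2 + 2 * i) = (pl vs[k])[i]
  inp_flag : ∀ k (h : k < vs.length) i (hi : i < (pl vs[k]).length),
    I (off k + 2 + 2 * i + 1) = 0 ↔ s(vs[k], (pl vs[k])[i]) ∉ S

namespace Layout

variable {n : ℕ} {P : PrefSystem (Fin n)} {A : Set (Fin n)} {S : Set (Sym2 (Fin n))} {I : ℕ → ℕ}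
  {L : ℕ} (D : Layout P A S I L)

/-- The address of the block of `v`. -/
def hdr (v : Fin n) : ℕ := D.off (D.vs.idxOf v)

/-- The address of the entry of `u` in the preference list of `v`. -/
def adr (v u : Fin n) : ℕ := D.hdr v + 2 + 2 * (D.pl v).idxOf u

/-- `p` is the address of an entry of a preference list. -/
def IsEntry (p : ℕ) : Prop := ∃ v u, P.graph.Adj v u ∧ D.adr v u = p

theorem mem_pl {v u : Fin n} : u ∈ D.pl v ↔ P.graph.Adj v u := (D.pref v).1 u

theorem mem_vs_of_adj {v u : Fin n} (h : P.graph.Adj v u) : v ∈ D.vs :=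
  (D.mem_vs v).mpr (List.ne_nil_of_mem (D.mem_pl.mpr h))

theorem nodup_pl (v : Fin n) : (D.pl v).Nodup :=
  (D.pref v).2.imp fun h => by rintro rfl; exact P.irrefl _ _ h

theorem idx_lt {v : Fin n} (h : v ∈ D.vs) : D.vs.idxOf v < D.vs.length :=
  List.idxOf_lt_length_of_mem h

theorem vs_idx {v : Fin n} (h : v ∈ D.vs) : D.vs[D.vs.idxOf v]'(D.idx_lt h) = v :=
  List.getElem_idxOf _

theorem hdr_vs {k : ℕ} (h : k < D.vs.length) : D.hdr D.vs[k] = D.off k := by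
  rw [hdr, D.nodup.idxOf_getElem]

theorem off_succ' {v : Fin n} (h : v ∈ D.vs) :
    D.off (D.vs.idxOf v + 1) = D.hdr v + 2 + 2 * (D.pl v).length := by
  rw [D.off_succ _ (D.idx_lt h), D.vs_idx h, hdr]

theorem off_mono {j k : ℕ} (hjk : j ≤ k) (hk : k ≤ D.vs.length) : D.off j ≤ D.off k := by
  induction k with
  | zero => rw [Nat.le_zero.mp hjk]
  | succ k ih =>
    rcases hjk.lt_or_eq with h | rfl
    · have := ih (by omega) (by omega)
      rw [D.off_succ k (by omega)]
      omega
    · exact le_rfl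

theorem even_off {k : ℕ} (hk : k ≤ D.vs.length) : D.off k % 2 = 0 := by
  induction k with
  | zero => rw [D.off_zero]
  | succ k ih =>
    rw [D.off_succ k (by omega)]
    have := ih (by omega)
    omega

theorem even_hdr {v : Fin n} (h : v ∈ D.vs) : D.hdr v % 2 = 0 := D.even_off (D.idx_lt h).le

theorem even_adr {v u : Fin n} (h : P.graph.Adj v u) : D.adr v u % 2 = 0 := by
  have := D.even_hdr (D.mem_vs_of_adj h)
  unfold adr
  omega

theorem idxOf_lt {v u : Fin n} (h : P.graph.Adj v u) : (D.pl v).idxOf u < (D.pl v).length :=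
  List.idxOf_lt_length_of_mem (D.mem_pl.mpr h)

theorem pl_ne_nil {v : Fin n} (h : v ∈ D.vs) : 0 < (D.pl v).length :=
  List.length_pos_iff.mpr ((D.mem_vs v).mp h)

/-- The blocks of different vertices do not overlap. -/
theorem block_le {v w : Fin n} (hv : v ∈ D.vs) (hw : w ∈ D.vs) (h : v ≠ w) :
    D.hdr v + 2 + 2 * (D.pl v).length ≤ D.hdr w ∨ D.hdr w + 2 + 2 * (D.pl w).length ≤ D.hdr v := by
  have hne : D.vs.idxOf v ≠ D.vs.idxOf w := fun he => h ((List.idxOf_inj hv).mp he)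
  rcases hne.lt_or_gt with hlt | hlt
  · left
    rw [← D.off_succ' hv]
    exact D.off_mono hlt (D.idx_lt hw).le
  · right
    rw [← D.off_succ' hw]
    exact D.off_mono hlt (D.idx_lt hv).le

theorem block_le_length {v : Fin n} (hv : v ∈ D.vs) : D.hdr v + 2 + 2 * (D.pl v).length ≤ L := by
  rw [← D.off_succ' hv]
  exact (D.off_mono (D.idx_lt hv) le_rfl).trans D.off_length.le

theorem two_le_hdr {v : Fin n} (hv : v ∈ D.vs) : 2 ≤ D.hdr v := by
  rw [← D.off_zero]
  exact D.off_mono (Nat.zero_le _) (D.idx_lt hv).le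

theorem hdr_inj {v w : Fin n} (hv : v ∈ D.vs) (hw : w ∈ D.vs) (h : D.hdr v = D.hdr w) : v = w := by
  by_contra hne
  rcases D.block_le hv hw hne with h' | h' <;> omega

theorem adr_inj {v u v' u' : Fin n} (h : P.graph.Adj v u) (h' : P.graph.Adj v' u')
    (he : D.adr v u = D.adr v' u') : v = v' ∧ u = u' := by
  have hi := D.idxOf_lt h
  have hi' := D.idxOf_lt h'
  unfold adr at he
  have hv : v = v' := by
    by_contra hne
    rcases D.block_le (D.mem_vs_of_adj h) (D.mem_vs_of_adj h') hne with hb | hb <;> omega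
  subst hv
  exact ⟨rfl, (List.idxOf_inj (D.mem_pl.mpr h)).mp (by omega)⟩

theorem hdr_ne_adr {v w u : Fin n} (hv : v ∈ D.vs) (h : P.graph.Adj w u) :
    D.hdr v ≠ D.adr w u := by
  intro he
  have hi := D.idxOf_lt h
  unfold adr at he
  by_cases hvw : v = w
  · subst hvw; omega
  · rcases D.block_le hv (D.mem_vs_of_adj h) hvw with hb | hb <;> omega

theorem adr_lt_length {v u : Fin n} (h : P.graph.Adj v u) : D.adr v u + 2 ≤ L := by
  have hi := D.idxOf_lt h
  have := D.block_le_length (D.mem_vs_of_adj h)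
  unfold adr
  omega

theorem hdr_add_two_le {v u : Fin n} : D.hdr v + 2 ≤ D.adr v u := by
  unfold adr
  omega

theorem adr_pos {v u : Fin n} : 0 < D.adr v u := by
  unfold adr
  omega

theorem adr_lt_iff {v u u' : Fin n} (h : P.graph.Adj v u) (h' : P.graph.Adj v u') :
    D.adr v u < D.adr v u' ↔ P.lt v u' u := by
  have key : ∀ {u u'}, P.graph.Adj v u → P.graph.Adj v u' → D.adr v u < D.adr v u' →
      P.lt v u' u := by
    intro u u' h h' hlt
    unfold adr at hlt
    have := List.pairwise_iff_getElem.mp (D.pref v).2 _ _ (D.idxOf_lt h) (D.idxOf_lt h') (by omega)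
    simpa using this
  refine ⟨key h h', fun hlt => ?_⟩
  by_contra hnot
  rcases (not_lt.mp hnot).lt_or_eq with hl | he
  · exact PrefSystem.asymm hlt (key h' h hl)
  · have := (D.adr_inj h' h he).2
    subst this
    exact P.irrefl _ _ hlt

theorem adr_add_two_le {v u u' : Fin n} (h : P.graph.Adj v u) (h' : P.graph.Adj v u')
    (hlt : D.adr v u < D.adr v u') : D.adr v u + 2 ≤ D.adr v u' := by
  have := D.even_adr h
  have := D.even_adr h'
  omega

theorem not_isEntry_hdr {v : Fin n} (hv : v ∈ D.vs) : ¬ D.IsEntry (D.hdr v) := by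
  rintro ⟨w, u, h, he⟩
  exact D.hdr_ne_adr hv h he.symm

theorem not_isEntry_of_le {p : ℕ} (hp : L ≤ p) : ¬ D.IsEntry p := by
  rintro ⟨w, u, h, rfl⟩
  have := D.adr_lt_length h
  omega

theorem not_isEntry_zero : ¬ D.IsEntry 0 := by
  rintro ⟨w, u, h, he⟩
  have := D.adr_pos (v := w) (u := u)
  omega

/-- The address behind a block is `L` or that of another block. -/
theorem block_end {v : Fin n} (hv : v ∈ D.vs) :
    D.hdr v + 2 + 2 * (D.pl v).length = L ∨
      ∃ w ∈ D.vs, D.hdr w = D.hdr v + 2 + 2 * (D.pl v).length := by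
  rw [← D.off_succ' hv]
  rcases (Nat.succ_le_of_lt (D.idx_lt hv)).lt_or_eq with h | h
  · right
    exact ⟨_, List.getElem_mem h, D.hdr_vs h⟩
  · left
    exact (congrArg D.off h).trans D.off_length

/-- Two cells after an entry there is the next entry of the same list, or no entry if the list
ends there. -/
theorem next {v u : Fin n} (h : P.graph.Adj v u) :
    (∃ u', P.graph.Adj v u' ∧ D.adr v u' = D.adr v u + 2) ∨
      (¬ D.IsEntry (D.adr v u + 2) ∧ ∀ u', P.graph.Adj v u' → D.adr v u' ≤ D.adr v u) := by
  have hi := D.idxOf_lt h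
  by_cases hlast : (D.pl v).idxOf u + 1 < (D.pl v).length
  · left
    refine ⟨(D.pl v)[(D.pl v).idxOf u + 1], D.mem_pl.mp (List.getElem_mem hlast), ?_⟩
    rw [adr, (D.nodup_pl v).idxOf_getElem, adr]
    omega
  · right
    constructor
    · have hadr : D.adr v u + 2 = D.hdr v + 2 + 2 * (D.pl v).length := by unfold adr; omega
      rw [hadr]
      rcases D.block_end (D.mem_vs_of_adj h) with he | ⟨w, hw, he⟩
      · rw [he]
        exact D.not_isEntry_of_le le_rfl
      · rw [← he]
        exact D.not_isEntry_hdr hw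
    · intro u' h'
      have := D.idxOf_lt h'
      unfold adr
      omega

theorem first {v : Fin n} (hv : v ∈ D.vs) : ∃ u, P.graph.Adj v u ∧ D.adr v u = D.hdr v + 2 := by
  have hpos := D.pl_ne_nil hv
  refine ⟨(D.pl v)[0], D.mem_pl.mp (List.getElem_mem hpos), ?_⟩
  rw [adr, (D.nodup_pl v).idxOf_getElem]

theorem inp_hdr {v : Fin n} (hv : v ∈ D.vs) : I (D.hdr v) = v := by
  rw [hdr, D.inp_off _ (D.idx_lt hv), D.vs_idx hv]

theorem inp_adr {v u : Fin n} (h : P.graph.Adj v u) : I (D.adr v u) = u := by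
  have hv := D.mem_vs_of_adj h
  have hi := D.idxOf_lt h
  have hk := D.idx_lt hv
  have h1 := D.inp_nb _ hk ((D.pl v).idxOf u) (by simpa only [D.vs_idx hv] using hi)
  simp only [D.vs_idx hv] at h1
  rw [adr, hdr, h1, List.getElem_idxOf]

theorem inp_adr_succ {v u : Fin n} (h : P.graph.Adj v u) :
    I (D.adr v u + 1) = 0 ↔ s(v, u) ∉ S := by
  have hv := D.mem_vs_of_adj h
  have hi := D.idxOf_lt h
  have hk := D.idx_lt hv
  have h1 := D.inp_flag _ hk ((D.pl v).idxOf u) (by simpa only [D.vs_idx hv] using hi)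
  simp only [D.vs_idx hv, List.getElem_idxOf] at h1
  exact h1

theorem side' {v : Fin n} (hv : v ∈ D.vs) : v ∈ A ↔ D.vs.idxOf v < I 0 := by
  rw [← D.side _ (D.idx_lt hv), D.vs_idx hv]

end Layout

/-! ### Decoding the input -/

section Encoding

variable {n : ℕ} {P : PrefSystem (Fin n)} {A B : Set (Fin n)} {S : Set (Sym2 (Fin n))}

theorem length_vertexBlock (v : Fin n) (l : List (Fin n)) :
    (vertexBlock S v l).length = 2 + 2 * l.length := by
  simp [vertexBlock]
  omega

theorem getElem?_flatMap_pair {α : Type*} (f g : α → ℕ) (l : List α) (i : ℕ) (hi : i < l.length) :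
    (l.flatMap fun u => [f u, g u])[2 * i]? = some (f l[i]) ∧
      (l.flatMap fun u => [f u, g u])[2 * i + 1]? = some (g l[i]) := by
  induction l generalizing i with
  | nil => simp at hi
  | cons a l ih =>
    cases i with
    | zero => simp
    | succ i =>
      have := ih i (by simpa using hi)
      simpa [Nat.mul_succ] using this

open Classical in
/-- The words of a block. -/
theorem getElem?_vertexBlock (v : Fin n) (l : List (Fin n)) :
    (vertexBlock S v l)[0]? = some (v : ℕ) ∧ (vertexBlock S v l)[1]? = some l.length ∧
      ∀ i (hi : i < l.length), (vertexBlock S v l)[2 + 2 * i]? = some (l[i] : ℕ) ∧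
        (vertexBlock S v l)[2 + 2 * i + 1]? = some (if s(v, l[i]) ∈ S then 1 else 0) := by
  refine ⟨rfl, rfl, fun i hi => ?_⟩
  have h := getElem?_flatMap_pair (fun u : Fin n => (u : ℕ))
    (fun u => if s(v, u) ∈ S then 1 else 0) l i hi
  unfold vertexBlock
  rw [show 2 + 2 * i = 2 * i + 1 + 1 by omega,
    show 2 * i + 1 + 1 + 1 = (2 * i + 1) + 1 + 1 by omega]
  simpa only [List.getElem?_cons_succ] using h

/-- The words of the `k`-th block of a concatenation of blocks. -/
theorem getElem?_flatMap {α : Type*} (f : α → List ℕ) (l : List α) (k : ℕ) (hk : k < l.length)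
    (i : ℕ) (hi : i < (f l[k]).length) :
    (l.flatMap f)[((l.take k).flatMap f).length + i]? = (f l[k])[i]? := by
  have hl : l.flatMap f = (l.take k).flatMap f ++ (l.drop k).flatMap f := by
    rw [← List.flatMap_append, List.take_append_drop]
  rw [hl, List.getElem?_append_right (by omega), Nat.add_sub_cancel_left,
    List.drop_eq_getElem_cons hk, List.flatMap_cons, List.getElem?_append_left hi]

/-- A word that encodes an instance, decoded. -/
theorem IsEncoding.exists_layout (h : P.IsMasterListInstance A B S) {w : List ℕ}
    (hw : IsEncoding P A B S w) :
    Nonempty (Layout P A S (fun x => w.getD x 0) w.length) ∧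
      (∃ bl, Mach.IsBlockInput w bl) ∧ (∀ x ∈ w, x ≤ n + w.length) ∧
      w.length ≤ 8 * P.edges.ncard + 2 := by
  classical
  obtain ⟨pl, as, bs, hpl, has, hasA, hbs, hbsB, rfl⟩ := hw
  have hdisj : ∀ v, v ∈ A → v ∉ B := fun v hv =>
    Set.disjoint_left.mp h.bipartite.disjoint hv
  have hcov : ∀ v, v ∈ A ∨ v ∈ B := fun v => by
    have : v ∈ A ∪ B := by rw [h.cover]; trivial
    exact this
  set vs := as ++ bs with hvs
  set f : Fin n → List ℕ := fun v => vertexBlock S v (pl v) with hf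
  set w := as.length :: bs.length :: vs.flatMap f with hw
  have hlen : w.length = 2 + (vs.flatMap f).length := by rw [hw]; simp; omega
  have hflen : ∀ v, (f v).length = 2 + 2 * (pl v).length := fun v => length_vertexBlock v _
  have hnodup : vs.Nodup := by
    refine List.nodup_append.mpr ⟨has, hbs, fun a ha b hb => ?_⟩
    rintro rfl
    exact hdisj a ((hasA a).mp ha).1 ((hbsB a).mp hb).1
  have hmem : ∀ v, v ∈ vs ↔ pl v ≠ [] := by
    intro v
    rw [hvs, List.mem_append, hasA, hbsB]
    rcases hcov v with hv | hv <;> tauto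
  have hget : ∀ k (hk : k < vs.length) i, i < 2 + 2 * (pl vs[k]).length →
      w[2 + ((vs.take k).flatMap f).length + i]? = (f vs[k])[i]? := by
    intro k hk i hi
    rw [← getElem?_flatMap f vs k hk i (by rw [hflen]; exact hi), hw,
      show 2 + ((vs.take k).flatMap f).length + i = ((vs.take k).flatMap f).length + i + 1 + 1 by
        omega]
    rw [List.getElem?_cons_succ, List.getElem?_cons_succ]
  refine ⟨⟨⟨vs, pl, fun k => 2 + ((vs.take k).flatMap f).length, hpl, hnodup, hmem, ?_, ?_, ?_,
    ?_, ?_, ?_, ?_, ?_⟩⟩, ⟨vs.map f, ⟨_, _, hw, ?_⟩, ?_⟩, ?_, ?_⟩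
  · intro k hk
    show _ ↔ k < as.length
    by_cases hka : k < as.length
    · have : vs[k] = as[k] := List.getElem_append_left hka
      rw [this]
      exact ⟨fun _ => hka, fun _ => ((hasA _).mp (List.getElem_mem hka)).1⟩
    · have hkb : k - as.length < bs.length := by
        rw [hvs, List.length_append] at hk; omega
      have : vs[k] = bs[k - as.length] := List.getElem_append_right (not_lt.mp hka)
      rw [this]
      exact ⟨fun hA => absurd ((hbsB _).mp (List.getElem_mem hkb)).1 (hdisj _ hA),
        fun hc => absurd hc hka⟩
  · simp
  · intro k hk
    rw [← List.take_concat_get' vs k hk, List.flatMap_append, List.length_append]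
    simp only [List.flatMap_cons, List.flatMap_nil, List.append_nil, hflen]
    omega
  · rw [List.take_length, hlen]
  · intro k hk
    have h1 := hget k hk 0 (by omega)
    rw [(getElem?_vertexBlock _ _).1] at h1
    rw [List.getD_eq_getElem?_getD, show 2 + ((vs.take k).flatMap f).length =
      2 + ((vs.take k).flatMap f).length + 0 from rfl, h1]
    rfl
  · intro k hk
    rw [List.getD_eq_getElem?_getD, hget k hk 1 (by omega), (getElem?_vertexBlock _ _).2.1]
    rfl
  · intro k hk i hi
    rw [List.getD_eq_getElem?_getD, add_assoc, hget k hk _ (by omega),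
      ((getElem?_vertexBlock _ _).2.2 i hi).1]
    rfl
  · intro k hk i hi
    rw [List.getD_eq_getElem?_getD, add_assoc, add_assoc, hget k hk _ (by omega), ← add_assoc,
      ((getElem?_vertexBlock _ _).2.2 i hi).2]
    simp
  · simp [hvs]
  · intro l hl
    obtain ⟨v, -, rfl⟩ := List.mem_map.mp hl
    refine ⟨v, (pl v).length, _, rfl, ?_⟩
    have := hflen v
    rw [hf] at this
    simp only [vertexBlock, List.length_cons] at this
    omega
  · intro x hx
    have hvl : vs.length ≤ n := by simpa using hnodup.length_le_card
    have hvl' : as.length + bs.length = vs.length := by rw [hvs, List.length_append]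
    rcases List.mem_cons.mp hx with rfl | hx
    · omega
    rcases List.mem_cons.mp hx with rfl | hx
    · omega
    obtain ⟨v, hv, hxv⟩ := List.mem_flatMap.mp hx
    have hpln : (pl v).length ≤ n := by
      have : (pl v).Nodup := (hpl v).2.imp fun h => by rintro rfl; exact P.irrefl _ _ h
      simpa using this.length_le_card
    rcases List.mem_cons.mp hxv with rfl | hxv
    · have := v.isLt; omega
    rcases List.mem_cons.mp hxv with rfl | hxv
    · omega
    obtain ⟨u, hu, hxu⟩ := List.mem_flatMap.mp hxv
    have := u.isLt
    rcases List.mem_cons.mp hxu with rfl | hxu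
    · omega
    · rw [List.mem_singleton] at hxu
      split_ifs at hxu <;> omega
  · have hdeg : ∀ v, (pl v).length = P.graph.degree v := by
      intro v
      have hnd : (pl v).Nodup := (hpl v).2.imp fun h => by rintro rfl; exact P.irrefl _ _ h
      rw [← List.toFinset_card_of_nodup hnd, ← SimpleGraph.card_neighborFinset_eq_degree]
      congr 1
      ext u
      simp [(hpl v).1 u]
    have hsum : (vs.flatMap f).length ≤ ∑ v, 4 * P.graph.degree v := by
      have h1 : (vs.flatMap f).length = ∑ v ∈ vs.toFinset, (2 + 2 * (pl v).length) := by
        rw [List.length_flatMap, List.sum_toFinset _ hnodup]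
        simp only [hflen]
      rw [h1]
      calc _ ≤ ∑ v ∈ vs.toFinset, 4 * P.graph.degree v := by
            refine Finset.sum_le_sum fun v hv => ?_
            have := List.length_pos_iff.mpr ((hmem v).mp (List.mem_toFinset.mp hv))
            rw [← hdeg]
            omega
        _ ≤ _ := Finset.sum_le_sum_of_subset (Finset.subset_univ _)
    rw [← Finset.mul_sum, SimpleGraph.sum_degrees_eq_twice_card_edges] at hsum
    have hE : P.edges.ncard = P.graph.edgeFinset.card := by
      rw [PrefSystem.edges, Set.ncard_eq_toFinset_card']
      rfl
    omega

end Encoding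

/-! ### Rules for the array machine -/

namespace Mach

theorem Store.reg_setReg (s : Store) (r x r' : ℕ) :
    (s.setReg r x).reg r' = if r' = r then x else s.reg r' := by
  simp [Store.setReg, Function.update_apply]

theorem Store.arr_setReg (s : Store) (r x : ℕ) : (s.setReg r x).arr = s.arr := rfl

theorem Store.out_setReg (s : Store) (r x : ℕ) : (s.setReg r x).out = s.out := rfl

theorem Store.reg_setArr (s : Store) (j : Fin 16) (a x : ℕ) : (s.setArr j a x).reg = s.reg := rfl

theorem Store.out_setArr (s : Store) (j : Fin 16) (a x : ℕ) : (s.setArr j a x).out = s.out := rfl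

theorem Store.arr_setArr_self (s : Store) (j : Fin 16) (a x : ℕ) :
    (s.setArr j a x).arr j = Function.update (s.arr j) a x := by
  simp [Store.setArr]

theorem Store.arr_setArr_of_ne (s : Store) {j j' : Fin 16} (h : j' ≠ j) (a x : ℕ) :
    (s.setArr j a x).arr j' = s.arr j' := by
  simp [Store.setArr, h]

theorem Store.reg_setOut (s : Store) (a x : ℕ) : (s.setOut a x).reg = s.reg := rfl

theorem Store.arr_setOut (s : Store) (a x : ℕ) : (s.setOut a x).arr = s.arr := rfl

theorem Store.out_setOut (s : Store) (a x : ℕ) :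
    (s.setOut a x).out = Function.update s.out a x := rfl

attribute [simp] Store.reg_setReg Store.arr_setReg Store.out_setReg Store.reg_setArr
  Store.out_setArr Store.arr_setArr_self Store.arr_setArr_of_ne Store.reg_setOut Store.arr_setOut
  Store.out_setOut

/-- The command assigns to array `j`. -/
def Cmd.WritesArr (j : Fin 16) : Cmd → Bool
  | .store j' _ _ => j' == j
  | .seq c c' => c.WritesArr j || c'.WritesArr j
  | .ite _ _ c c' => c.WritesArr j || c'.WritesArr j
  | _ => false

/-- The command assigns to register `r`. -/
def Cmd.WritesReg (r : ℕ) : Cmd → Bool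
  | .set r' _ => r' == r
  | .seq c c' => c.WritesReg r || c'.WritesReg r
  | .ite _ _ c c' => c.WritesReg r || c'.WritesReg r
  | _ => false

theorem Cmd.eval_arr {I : ℕ → ℕ} {j : Fin 16} (c : Cmd) (h : c.WritesArr j = false) (s : Store) :
    (c.eval I s).arr j = s.arr j := by
  induction c generalizing s with
  | skip => rfl
  | set r e => rfl
  | store j' e e' =>
    simp only [Cmd.WritesArr, beq_eq_false_iff_ne, ne_eq] at h
    exact Store.arr_setArr_of_ne _ (fun hj => h hj.symm) _ _
  | out e e' => rfl
  | seq c c' ih ih' =>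
    simp only [Cmd.WritesArr, Bool.or_eq_false_iff] at h
    simp only [Cmd.eval, ih' h.2, ih h.1]
  | ite e e' c c' ih ih' =>
    simp only [Cmd.WritesArr, Bool.or_eq_false_iff] at h
    simp only [Cmd.eval]
    split_ifs
    · exact ih h.1 s
    · exact ih' h.2 s

theorem Cmd.eval_reg {I : ℕ → ℕ} {r : ℕ} (c : Cmd) (h : c.WritesReg r = false) (s : Store) :
    (c.eval I s).reg r = s.reg r := by
  induction c generalizing s with
  | skip => rfl
  | set r' e =>
    simp only [Cmd.WritesReg, beq_eq_false_iff_ne, ne_eq] at h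
    simp only [Cmd.eval, Store.reg_setReg, if_neg (fun hj => h (Eq.symm hj))]
  | store j' e e' => rfl
  | out e e' => rfl
  | seq c c' ih ih' =>
    simp only [Cmd.WritesReg, Bool.or_eq_false_iff] at h
    simp only [Cmd.eval, ih' h.2, ih h.1]
  | ite e e' c c' ih ih' =>
    simp only [Cmd.WritesReg, Bool.or_eq_false_iff] at h
    simp only [Cmd.eval]
    split_ifs
    · exact ih h.1 s
    · exact ih' h.2 s

theorem Phase.eval_arr {I : ℕ → ℕ} {L : ℕ} {j : Fin 16} (p : Phase)
    (h : p.init.WritesArr j = false) (h' : p.body.WritesArr j = false) (s : Store) :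
    (p.eval I L s).arr j = s.arr j := by
  unfold Phase.eval
  induction 4 * L with
  | zero => exact p.init.eval_arr h s
  | succ k ih => rw [Function.iterate_succ_apply', p.body.eval_arr h', ih]

theorem Phase.eval_reg {I : ℕ → ℕ} {L r : ℕ} (p : Phase)
    (h : p.init.WritesReg r = false) (h' : p.body.WritesReg r = false) (s : Store) :
    (p.eval I L s).reg r = s.reg r := by
  unfold Phase.eval
  induction 4 * L with
  | zero => exact p.init.eval_reg h s
  | succ k ih => rw [Function.iterate_succ_apply', p.body.eval_reg h', ih]

/-- An invariant with a bound `m` for the number of steps left. -/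
theorem Phase.eval_inv {I : ℕ → ℕ} {L m : ℕ} (p : Phase) (Inv : Store → ℕ → Prop) {s : Store}
    (hstep : ∀ s m, Inv s m → Inv (p.body.eval I s) (m - 1))
    (h0 : Inv (p.init.eval I s) m) (hm : m ≤ 4 * L) : Inv (p.eval I L s) 0 := by
  have h : ∀ k, Inv ((p.body.eval I)^[k] (p.init.eval I s)) (m - k) := by
    intro k
    induction k with
    | zero => exact h0
    | succ k ih =>
      rw [Function.iterate_succ_apply', ← Nat.sub_sub]
      exact hstep _ _ ih
  have := h (4 * L)
  rwa [Nat.sub_eq_zero_of_le hm] at this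

end Mach

/-! ### Reading the input

The arrays used by the algorithm, where a vertex `v` is represented by the number `v + 1`:
`0` owner of an entry (and `0` at all other addresses); `1` first entry of a vertex; `2` marks for
the addresses of blocks; `3` the same for the blocks of vertices of `A`; `4` the last entry of a
given neighbour that has been read; `5` the entry of the same neighbour before a given entry;
`6` scratch; `7` for the entry of `u` in the list of `v`, the entry of `v` in the list of `u`;
`8` for a matched vertex, the entry of its partner in its list; `9` marks for forced vertices;
`10` the queue of forced vertices. -/

open Mach

/-- Walk through the blocks: register `1` is the current address, register `2` the number of entries
that remain in the current block, register `3` its vertex, and register `4` the number of blocks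
of `A` to come. -/
def readPhase : Phase where
  init := .seq (.set 1 (.lit 2)) (.set 4 (.inp (.lit 0)))
  body := .ite (.reg 1) (.reg 0)
    (.ite (.lit 0) (.reg 2)
      (.seq (.store 0 (.reg 1) (.reg 3)) <|
        .seq (.store 5 (.reg 1) (.arr 4 (.succ (.inp (.reg 1))))) <|
        .seq (.store 4 (.succ (.inp (.reg 1))) (.reg 1)) <|
        .seq (.set 2 (.pred (.reg 2))) (.set 1 (.succ (.succ (.reg 1)))))
      (.seq (.set 3 (.succ (.inp (.reg 1)))) <|
        .seq (.set 2 (.inp (.succ (.reg 1)))) <|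
        .seq (.store 2 (.reg 1) (.lit 1)) <|
        .seq (.store 3 (.reg 1) (.reg 4)) <|
        .seq (.set 4 (.pred (.reg 4))) <|
        .seq (.set 1 (.succ (.succ (.reg 1)))) (.store 1 (.reg 3) (.reg 1))))
    .skip

namespace Layout

variable {n : ℕ} {P : PrefSystem (Fin n)} {A : Set (Fin n)} {S : Set (Sym2 (Fin n))} {I : ℕ → ℕ}
  {L : ℕ} (D : Layout P A S I L)

open Classical in
/-- The last entry of `u` in some preference list before the address `p`, or `0`. -/
noncomputable def prev (u : Fin n) : ℕ → ℕ
  | 0 => 0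
  | p + 1 => if ∃ v, P.graph.Adj v u ∧ D.adr v u = p then p else prev u p

theorem prev_succ_of_adr {v u : Fin n} (h : P.graph.Adj v u) :
    D.prev u (D.adr v u + 1) = D.adr v u := by
  rw [prev, if_pos ⟨v, h, rfl⟩]

theorem prev_succ_of_not {u : Fin n} {p : ℕ} (h : ∀ v, P.graph.Adj v u → D.adr v u ≠ p) :
    D.prev u (p + 1) = D.prev u p := by
  rw [prev, if_neg]
  rintro ⟨v, h1, h2⟩
  exact h v h1 h2

theorem prev_add_two_of_not {u : Fin n} {p : ℕ} (hp : p % 2 = 0)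
    (h : ∀ v, P.graph.Adj v u → D.adr v u ≠ p) : D.prev u (p + 2) = D.prev u p := by
  rw [show p + 2 = p + 1 + 1 from rfl, D.prev_succ_of_not, D.prev_succ_of_not h]
  intro v hv he
  have := D.even_adr hv
  omega

theorem prev_add_two_of_adr {v u : Fin n} (h : P.graph.Adj v u) :
    D.prev u (D.adr v u + 2) = D.adr v u := by
  rw [show D.adr v u + 2 = D.adr v u + 1 + 1 from rfl, D.prev_succ_of_not, D.prev_succ_of_adr h]
  intro w hw he
  have := D.even_adr hw
  have := D.even_adr h
  omega

theorem prev_spec (u : Fin n) (p : ℕ) :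
    D.prev u p = 0 ∨ ∃ v, P.graph.Adj v u ∧ D.prev u p = D.adr v u ∧ D.adr v u < p := by
  induction p with
  | zero => exact Or.inl rfl
  | succ p ih =>
    rw [prev]
    split_ifs with h
    · obtain ⟨v, hv, he⟩ := h
      exact Or.inr ⟨v, hv, he.symm, by omega⟩
    · exact ih.imp_right fun ⟨v, hv, he, hl⟩ => ⟨v, hv, he, by omega⟩

theorem le_prev {v u : Fin n} (h : P.graph.Adj v u) {p : ℕ} (hp : D.adr v u < p) :
    D.adr v u ≤ D.prev u p := by
  induction p with
  | zero => omega
  | succ p ih =>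
    rw [prev]
    split_ifs with hc
    · omega
    · refine ih ?_
      have : D.adr v u ≠ p := fun he => hc ⟨v, h, he⟩
      omega

/-- The part of the input before the address `p` has been read into the arrays. -/
structure Read (s : Store) (p : ℕ) : Prop where
  own : ∀ v u, P.graph.Adj v u → D.adr v u < p → s.arr 0 (D.adr v u) = v + 1
  own_zero : ∀ x, (¬ D.IsEntry x ∨ p ≤ x) → s.arr 0 x = 0
  start : ∀ v ∈ D.vs, D.hdr v < p → s.arr 1 (v + 1) = D.hdr v + 2
  mark : ∀ v ∈ D.vs, D.hdr v < p → s.arr 2 (D.hdr v) ≠ 0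
  of_mark : ∀ x, s.arr 2 x ≠ 0 → ∃ v ∈ D.vs, x = D.hdr v
  markA : ∀ v ∈ D.vs, v ∈ A → D.hdr v < p → s.arr 3 (D.hdr v) ≠ 0
  of_markA : ∀ x, s.arr 3 x ≠ 0 → ∃ v ∈ D.vs, v ∈ A ∧ x = D.hdr v
  last : ∀ u : Fin n, s.arr 4 (u + 1) = D.prev u p
  before : ∀ v u, P.graph.Adj v u → D.adr v u < p → s.arr 5 (D.adr v u) = D.prev u (D.adr v u)

/-- The invariant of `readPhase`. -/
structure ReadInv (s : Store) (m : ℕ) : Prop where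
  reg0 : s.reg 0 = L
  bound : L ≤ s.reg 1 + m
  read : D.Read s (s.reg 1)
  pos : (∃ k ≤ D.vs.length, s.reg 1 = D.off k ∧ s.reg 2 = 0 ∧ s.reg 4 = I 0 - k) ∨
    ∃ v ∈ D.vs, ∃ i < (D.pl v).length, s.reg 1 = D.hdr v + 2 + 2 * i ∧
      s.reg 2 = (D.pl v).length - i ∧ s.reg 3 = v + 1 ∧ s.reg 4 = I 0 - (D.vs.idxOf v + 1)

theorem readInv_step (s : Store) (m : ℕ) (h : D.ReadInv s m) :
    D.ReadInv (readPhase.body.eval I s) (m - 1) := by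
  obtain ⟨h0, hb, hr, hpos⟩ := h
  rcases hpos with ⟨k, hk, h1, h2, h4⟩ | ⟨v, hv, i, hi, h1, h2, h3, h4⟩
  · rcases hk.lt_or_eq with hk | rfl
    · -- at the address of a block
      have hle := D.block_le_length (List.getElem_mem hk)
      have hpl := D.pl_ne_nil (List.getElem_mem hk)
      rw [D.hdr_vs hk] at hle
      have hlt : D.off k < L := by omega
      set v := D.vs[k] with hvdef
      have hv : v ∈ D.vs := List.getElem_mem hk
      have hhdr : D.hdr v = D.off k := D.hdr_vs hk
      have hidx : D.vs.idxOf v = k := D.nodup.idxOf_getElem k hk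
      have hI : I (D.off k) = v := D.inp_off k hk
      have hI' : I (D.off k + 1) = (D.pl v).length := D.inp_deg k hk
      have heven := D.even_off hk.le
      have hnot : ∀ w u, P.graph.Adj w u → D.adr w u ≠ D.off k := by
        intro w u hwu he
        exact D.hdr_ne_adr hv hwu (by rw [hhdr, he])
      have hadr : ∀ w u, P.graph.Adj w u → D.adr w u < D.off k + 2 → D.adr w u < D.off k := by
        intro w u hwu hl
        have := hnot w u hwu
        have := D.even_adr hwu
        omega
      have hhd : ∀ w ∈ D.vs, w ≠ v → D.hdr w < D.off k + 2 → D.hdr w < D.off k := by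
        intro w hw hne hl
        have := D.even_hdr hw
        have : D.hdr w ≠ D.off k := fun he => hne (D.hdr_inj hw hv (by rw [he, hhdr]))
        omega
      have hA : v ∈ A ↔ 0 < I 0 - k := by
        rw [D.side' hv, hidx]
        omega
      have hcode : ∀ w : Fin n, (w : ℕ) = v ↔ w = v := fun w => Fin.val_inj
      have hev : readPhase.body.eval I s =
          ((((((s.setReg 3 (v + 1)).setReg 2 (D.pl v).length).setArr 2 (D.off k) 1).setArr 3
            (D.off k) (I 0 - k)).setReg 4 (I 0 - k - 1)).setReg 1 (D.off k + 1 + 1)).setArr 1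
            (v + 1) (D.off k + 1 + 1) := by
        have c1 : D.off k < s.reg 0 := by omega
        simp [readPhase, Cmd.eval, Exp.eval, c1, h2, h1, h4, hI, hI']
      rw [hev]
      refine ⟨?_, ?_, ⟨?_, ?_, ?_, ?_, ?_, ?_, ?_, ?_, ?_⟩, ?_⟩
      · simp [h0]
      · simp; omega
      · intro w u hwu hl
        simp only [Store.reg_setArr, Store.reg_setReg, if_true] at hl
        have := hr.own w u hwu (by rw [h1]; exact hadr w u hwu hl)
        simpa using this
      · intro x hx
        have := hr.own_zero x (hx.imp_right fun h => by simp at h; omega)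
        simpa using this
      · intro w hw hl
        simp only [Store.reg_setArr, Store.reg_setReg, if_true] at hl
        by_cases hwv : w = v
        · subst hwv; simp [hhdr]
        · have := hr.start w hw (by rw [h1]; exact hhd w hw hwv hl)
          simp [hcode, hwv, this]
      · intro w hw hl
        simp only [Store.reg_setArr, Store.reg_setReg, if_true] at hl
        by_cases hwv : w = v
        · subst hwv; simp [hhdr]
        · have := hr.mark w hw (by rw [h1]; exact hhd w hw hwv hl)
          have hne : D.hdr w ≠ D.off k := fun he => hwv (D.hdr_inj hw hv (by rw [he, hhdr]))
          simp [this, hne]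
      · intro x hx
        by_cases hxk : x = D.off k
        · exact ⟨v, hv, by rw [hxk, hhdr]⟩
        · exact hr.of_mark x (by simpa [Function.update_apply, hxk] using hx)
      · intro w hw hwA hl
        simp only [Store.reg_setArr, Store.reg_setReg, if_true] at hl
        by_cases hwv : w = v
        · subst hwv
          have := hA.mp hwA
          simp [hhdr]
          omega
        · have := hr.markA w hw hwA (by rw [h1]; exact hhd w hw hwv hl)
          have hne : D.hdr w ≠ D.off k := fun he => hwv (D.hdr_inj hw hv (by rw [he, hhdr]))
          simp [this, hne]
      · intro x hx
        by_cases hxk : x = D.off k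
        · refine ⟨v, hv, hA.mpr ?_, by rw [hxk, hhdr]⟩
          simp [hxk] at hx
          omega
        · exact hr.of_markA x (by simpa [Function.update_apply, hxk] using hx)
      · intro u
        have := hr.last u
        rw [h1] at this
        simp only [Store.reg_setArr, Store.reg_setReg, if_true]
        rw [D.prev_add_two_of_not heven fun w hw => hnot w u hw]
        simpa using this
      · intro w u hwu hl
        simp only [Store.reg_setArr, Store.reg_setReg, if_true] at hl
        have := hr.before w u hwu (by rw [h1]; exact hadr w u hwu hl)
        simpa using this
      · right
        refine ⟨v, hv, 0, hpl, ?_, ?_, ?_, ?_⟩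
        · simp [hhdr]
        · simp
        · simp
        · simp [hidx]; omega
    · have hL := D.off_length
      have hev : readPhase.body.eval I s = s := by
        have c1 : ¬ s.reg 1 < s.reg 0 := by omega
        simp [readPhase, Cmd.eval, Exp.eval, c1]
      rw [hev]
      exact ⟨h0, by omega, hr, Or.inl ⟨_, le_rfl, h1, h2, h4⟩⟩
  · -- at an entry
    have hle := D.block_le_length hv
    set u := (D.pl v)[i] with hu
    have hvu : P.graph.Adj v u := D.mem_pl.mp (List.getElem_mem hi)
    have hp : D.adr v u = s.reg 1 := by rw [adr, (D.nodup_pl v).idxOf_getElem, h1]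
    have hI : I (s.reg 1) = u := by rw [← hp, D.inp_adr hvu]
    have hev : readPhase.body.eval I s =
        ((((s.setArr 0 (s.reg 1) (v + 1)).setArr 5 (s.reg 1) (s.arr 4 (u + 1))).setArr 4
          (u + 1) (s.reg 1)).setReg 2 (s.reg 2 - 1)).setReg 1 (s.reg 1 + 1 + 1) := by
      have c1 : s.reg 1 < s.reg 0 := by omega
      have c2 : 0 < s.reg 2 := by omega
      simp [readPhase, Cmd.eval, Exp.eval, c1, c2, h3, hI]
    have heven := D.even_adr hvu
    have hadr : ∀ w x, P.graph.Adj w x → D.adr w x < s.reg 1 + 1 + 1 → (w = v ∧ x = u) ∨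
        (D.adr w x ≠ s.reg 1 ∧ D.adr w x < s.reg 1) := by
      intro w x hwx hl
      by_cases he : D.adr w x = D.adr v u
      · exact Or.inl (D.adr_inj hwx hvu he)
      · have := D.even_adr hwx
        right; omega
    have hhd : ∀ w ∈ D.vs, D.hdr w < s.reg 1 + 1 + 1 → D.hdr w < s.reg 1 := by
      intro w hw hl
      have := D.hdr_ne_adr hw hvu
      have := D.even_hdr hw
      omega
    have hcode : ∀ x : Fin n, (x : ℕ) = u ↔ x = u := fun x => Fin.val_inj
    rw [hev]
    refine ⟨?_, ?_, ⟨?_, ?_, ?_, ?_, ?_, ?_, ?_, ?_, ?_⟩, ?_⟩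
    · simpa using h0
    · simp; omega
    · intro w x hwx hl
      rcases hadr w x hwx hl with ⟨rfl, rfl⟩ | ⟨h5, h6⟩
      · simp [hp]
      · simp [h5, hr.own w x hwx h6]
    · intro x hx
      have hxp : x ≠ s.reg 1 := by
        rintro rfl
        rcases hx with hx | hx
        · exact hx ⟨v, u, hvu, hp⟩
        · simp at hx
      have := hr.own_zero x (hx.imp_right fun h => by simp at h; omega)
      simp [hxp, this]
    · intro w hw hl
      simpa using hr.start w hw (hhd w hw hl)
    · intro w hw hl
      simpa using hr.mark w hw (hhd w hw hl)
    · intro x hx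
      exact hr.of_mark x (by simpa using hx)
    · intro w hw hwA hl
      simpa using hr.markA w hw hwA (hhd w hw hl)
    · intro x hx
      exact hr.of_markA x (by simpa using hx)
    · intro x
      by_cases hxu : x = u
      · subst hxu
        have := D.prev_add_two_of_adr hvu
        rw [hp] at this
        simp [this]
      · have hne : ∀ w, P.graph.Adj w x → D.adr w x ≠ s.reg 1 := by
          intro w hw he
          exact hxu (D.adr_inj hw hvu (by rw [he, hp])).2
        have := D.prev_add_two_of_not (by rw [← hp]; exact heven) hne
        simp [hcode, hxu, hr.last x, this]
    · intro w x hwx hl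
      rcases hadr w x hwx hl with ⟨rfl, rfl⟩ | ⟨h5, h6⟩
      · simp [hp, hr.last]
      · simp [h5, hr.before w x hwx h6]
    · by_cases hi' : i + 1 < (D.pl v).length
      · right
        refine ⟨v, hv, i + 1, hi', ?_, ?_, ?_, ?_⟩
        · simp [h1]; omega
        · simp [h2]; omega
        · simp [h3]
        · simp [h4]
      · left
        refine ⟨D.vs.idxOf v + 1, D.idx_lt hv, ?_, ?_, ?_⟩
        · rw [D.off_succ' hv]; simp [h1]; omega
        · simp [h2]; omega
        · simp [h4]

/-- After `readPhase` the whole input has been read into the arrays. -/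
theorem read_readPhase : D.Read (readPhase.eval I L (Store.start L)) L := by
  have h := readPhase.eval_inv (I := I) (L := L) (s := Store.start L) D.ReadInv D.readInv_step
    (m := L) ?_ (by omega)
  · have hle := h.bound
    refine ⟨fun v u hvu _ => h.read.own v u hvu ?_, fun x hx => h.read.own_zero x ?_,
      fun v hv _ => h.read.start v hv ?_, fun v hv _ => h.read.mark v hv ?_, h.read.of_mark,
      fun v hv hA _ => h.read.markA v hv hA ?_, h.read.of_markA, fun u => ?_,
      fun v u hvu _ => h.read.before v u hvu ?_⟩
    · have := D.adr_lt_length hvu; omega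
    · refine hx.imp_right fun hx => ?_
      rcases h.pos with ⟨k, hk, h1, -⟩ | ⟨v, hv, i, hi, h1, -⟩
      · have := D.off_mono hk le_rfl
        have := D.off_length
        omega
      · have := D.block_le_length hv
        omega
    · have := D.block_le_length hv; omega
    · have := D.block_le_length hv; omega
    · have := D.block_le_length hv; omega
    · have heq : (readPhase.eval I L (Store.start L)).reg 1 = L := by
        rcases h.pos with ⟨k, hk, h1, -⟩ | ⟨v, hv, i, hi, h1, -⟩
        · have := D.off_mono hk le_rfl
          have := D.off_length
          omega
        · have := D.block_le_length hv
          omega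
      rw [h.read.last, heq]
    · have := D.adr_lt_length hvu; omega
  · have hprev : ∀ u, D.prev u 2 = 0 := by
      intro u
      rcases D.prev_spec u 2 with h | ⟨v, hv, -, hl⟩
      · exact h
      · have := D.two_le_hdr (D.mem_vs_of_adj hv)
        have := D.hdr_add_two_le (v := v) (u := u)
        omega
    have hadr : ∀ v u, P.graph.Adj v u → ¬ D.adr v u < 2 := by
      intro v u hv
      have := D.two_le_hdr (D.mem_vs_of_adj hv)
      have := D.hdr_add_two_le (v := v) (u := u)
      omega
    have hhdr : ∀ v ∈ D.vs, ¬ D.hdr v < 2 := fun v hv => not_lt.mpr (D.two_le_hdr hv)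
    refine ⟨?_, ?_, ⟨?_, ?_, ?_, ?_, ?_, ?_, ?_, ?_, ?_⟩, ?_⟩
    all_goals simp only [readPhase, Cmd.eval, Exp.eval, Store.start, Store.reg_setReg,
      Store.arr_setReg]
    · simp
    · simp
    · intro v u hv hl; exact absurd hl (hadr v u hv)
    · simp
    · intro v hv hl; exact absurd hl (hhdr v hv)
    · intro v hv hl; exact absurd hl (hhdr v hv)
    · simp
    · intro v hv _ hl; exact absurd hl (hhdr v hv)
    · simp
    · intro u; exact (hprev u).symm
    · intro v u hv hl; exact absurd hl (hadr v u hv)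
    · left
      exact ⟨0, Nat.zero_le _, by simp [D.off_zero], by simp, by simp⟩

end Layout

/-! ### Linking the two entries of an edge -/

/-- Scan the input with register `1`.  At the address of the block of `v`, start to run with
register `2` through the entries `q` of `v` in the lists of other vertices, noting `q` in the
scratch array under the owner of `q`; at an entry of the list of `v`, look up the note of the
neighbour. -/
def linkPhase : Phase where
  init := .seq (.set 1 (.lit 0)) (.set 2 (.lit 0))
  body := .ite (.lit 0) (.reg 2)
    (.seq (.store 6 (.arr 0 (.reg 2)) (.reg 2)) (.set 2 (.arr 5 (.reg 2))))
    (.ite (.reg 1) (.reg 0)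
      (.seq (.ite (.lit 0) (.arr 2 (.reg 1)) (.set 2 (.arr 4 (.succ (.inp (.reg 1)))))
        (.ite (.lit 0) (.arr 0 (.reg 1))
          (.store 7 (.reg 1) (.arr 6 (.succ (.inp (.reg 1))))) .skip))
        (.set 1 (.succ (.reg 1))))
      .skip)

namespace Layout

variable {n : ℕ} {P : PrefSystem (Fin n)} {A : Set (Fin n)} {S : Set (Sym2 (Fin n))} {I : ℕ → ℕ}
  {L : ℕ} {D : Layout P A S I L}

theorem Read.congr {s s' : Store} {p : ℕ} (h : D.Read s p) (h0 : s'.arr 0 = s.arr 0)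
    (h1 : s'.arr 1 = s.arr 1) (h2 : s'.arr 2 = s.arr 2) (h3 : s'.arr 3 = s.arr 3)
    (h4 : s'.arr 4 = s.arr 4) (h5 : s'.arr 5 = s.arr 5) : D.Read s' p := by
  obtain ⟨a1, a2, a3, a4, a5, a6, a7, a8, a9⟩ := h
  constructor <;> simp only [h0, h1, h2, h3, h4, h5] <;> assumption

theorem Read.own' {s : Store} (h : D.Read s L) {v u : Fin n} (hvu : P.graph.Adj v u) :
    s.arr 0 (D.adr v u) = v + 1 :=
  h.own v u hvu (by have := D.adr_lt_length hvu; omega)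

theorem Read.own_pos_iff {s : Store} (h : D.Read s L) {x : ℕ} : 0 < s.arr 0 x ↔ D.IsEntry x := by
  constructor
  · intro hx
    by_contra hc
    rw [h.own_zero x (Or.inl hc)] at hx
    exact lt_irrefl _ hx
  · rintro ⟨v, u, hvu, rfl⟩
    rw [h.own' hvu]
    omega

theorem Read.mark_pos_iff {s : Store} (h : D.Read s L) {x : ℕ} :
    0 < s.arr 2 x ↔ ∃ v ∈ D.vs, x = D.hdr v := by
  constructor
  · exact fun hx => h.of_mark x hx.ne'
  · rintro ⟨v, hv, rfl⟩
    exact Nat.pos_of_ne_zero (h.mark v hv (by have := D.block_le_length hv; omega))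

theorem Read.markA_pos_iff {s : Store} (h : D.Read s L) {x : ℕ} :
    0 < s.arr 3 x ↔ ∃ v ∈ D.vs, v ∈ A ∧ x = D.hdr v := by
  constructor
  · exact fun hx => h.of_markA x hx.ne'
  · rintro ⟨v, hv, hA, rfl⟩
    exact Nat.pos_of_ne_zero (h.markA v hv hA (by have := D.block_le_length hv; omega))

variable (D)

/-- The array `7` links the two entries of each edge. -/
def Linked (s : Store) : Prop := ∀ v u, P.graph.Adj v u → s.arr 7 (D.adr v u) = D.adr u v

/-- The invariant of `linkPhase`; `T` is the set of the entries that register `2` has visited. -/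
structure LinkInv (s : Store) (m : ℕ) : Prop where
  reg0 : s.reg 0 = L
  read : D.Read s L
  state : (∀ v u, P.graph.Adj v u → D.adr v u < s.reg 1 → s.arr 7 (D.adr v u) = D.adr u v) ∧
    ∃ T ⊆ Finset.range L, (L ≤ s.reg 1 ∧ s.reg 2 = 0 ∨ L - s.reg 1 + (L - T.card) ≤ m) ∧
    (∀ e ∈ T, ∃ w v, P.graph.Adj w v ∧ e = D.adr w v ∧ D.hdr v < s.reg 1) ∧
    ((s.reg 2 = 0 ∧ ∀ v ∈ D.vs, s.reg 1 ≤ D.hdr v) ∨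
      ∃ v ∈ D.vs, D.hdr v < s.reg 1 ∧ (∀ w ∈ D.vs, D.hdr w < s.reg 1 → D.hdr w ≤ D.hdr v) ∧
        ∃ x, s.reg 2 = D.prev v x ∧ ∀ w, P.graph.Adj w v →
          (x ≤ D.adr w v → s.arr 6 (w + 1) = D.adr w v) ∧ (D.adr w v ∈ T → x ≤ D.adr w v))

theorem linkInv_step (s : Store) (m : ℕ) (h : D.LinkInv s m) :
    D.LinkInv (linkPhase.body.eval I s) (m - 1) := by
  have hread : D.Read (linkPhase.body.eval I s) L :=
    h.read.congr (Cmd.eval_arr _ rfl s) (Cmd.eval_arr _ rfl s) (Cmd.eval_arr _ rfl s)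
      (Cmd.eval_arr _ rfl s) (Cmd.eval_arr _ rfl s) (Cmd.eval_arr _ rfl s)
  have hreg0 : (linkPhase.body.eval I s).reg 0 = L := by
    rw [Cmd.eval_reg _ rfl s, h.reg0]
  obtain ⟨h0, hr, hlink, T, hT, hm, hTe, hch⟩ := h
  refine ⟨hreg0, hread, ?_⟩
  by_cases hq : 0 < s.reg 2
  · -- one step along the chain of entries of the current vertex
    obtain ⟨h2, -⟩ | ⟨v, hv, hvp, hlast, x, h2, hx⟩ := hch
    · omega
    obtain h2' | ⟨w, hwv, hw, hwx⟩ := D.prev_spec v x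
    · omega
    rw [hw] at h2
    have hev : linkPhase.body.eval I s =
        (s.setArr 6 (w + 1) (D.adr w v)).setReg 2 (D.prev v (D.adr w v)) := by
      have hL := D.adr_lt_length hwv
      simp [linkPhase, Cmd.eval, Exp.eval, h2, D.adr_pos, hr.own' hwv,
        hr.before w v hwv (by omega)]
    rw [hev]
    have hnotT : D.adr w v ∉ T := fun hc => by have := (hx w hwv).2 hc; omega
    have hlt := D.adr_lt_length hwv
    refine ⟨by simpa using hlink, insert (D.adr w v) T, ?_, Or.inr ?_, ?_, Or.inr ⟨v, hv, ?_, ?_,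
      D.adr w v, ?_, ?_⟩⟩
    · exact Finset.insert_subset (Finset.mem_range.mpr (by omega)) hT
    · rw [Finset.card_insert_of_notMem hnotT]
      have : T.card < L := by
        have hsub : insert (D.adr w v) T ⊆ Finset.range L :=
          Finset.insert_subset (Finset.mem_range.mpr (by omega)) hT
        have := Finset.card_le_card hsub
        rw [Finset.card_insert_of_notMem hnotT, Finset.card_range] at this
        omega
      simp
      omega
    · intro e he
      rcases Finset.mem_insert.mp he with rfl | he
      · exact ⟨w, v, hwv, rfl, by simpa using hvp⟩
      · simpa using hTe e he
    · simpa using hvp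
    · simpa using hlast
    · simp
    · intro w' hw'
      have hle : x ≤ D.adr w' v ∨ D.adr w' v ≤ D.adr w v := by
        by_contra hc
        push Not at hc
        have := D.le_prev hw' hc.1
        omega
      constructor
      · intro hge
        by_cases hww : w' = w
        · subst hww; simp
        · have hne : (w' : ℕ) ≠ w := fun hc => hww (Fin.ext hc)
          have hne' : D.adr w' v ≠ D.adr w v := fun hc => hww (D.adr_inj hw' hwv hc).1
          have := (hx w' hw').1 (by omega)
          simp [hne, this]
      · intro hmem
        rcases Finset.mem_insert.mp hmem with he | he
        · exact he.ge
        · have := (hx w' hw').2 he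
          omega
  · have hq0 : s.reg 2 = 0 := by omega
    by_cases hp : s.reg 1 < s.reg 0
    · by_cases hmark : 0 < s.arr 2 (s.reg 1)
      · -- the block of a vertex begins
        obtain ⟨v, hv, hpv⟩ := hr.mark_pos_iff.mp hmark
        have hev : linkPhase.body.eval I s =
            (s.setReg 2 (D.prev v L)).setReg 1 (s.reg 1 + 1) := by
          have hlst := hr.last v
          rw [hpv] at hmark hp
          simp [linkPhase, Cmd.eval, Exp.eval, hq0, hpv, hp, hmark, D.inp_hdr hv, hlst]
        rw [hev]
        refine ⟨?_, T, hT, Or.inr ?_, ?_, Or.inr ⟨v, hv, ?_, ?_, L, ?_, ?_⟩⟩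
        · intro w u hwu hl
          refine hlink w u hwu ?_
          have := D.hdr_ne_adr hv hwu
          simp at hl
          omega
        · clear hch; simp; omega
        · intro e he
          obtain ⟨w, v', h1, h2, h3⟩ := hTe e he
          exact ⟨w, v', h1, h2, by simp; omega⟩
        · simp [hpv]
        · intro w _ hw
          simp at hw
          omega
        · simp
        · intro w hwv
          refine ⟨fun hge => ?_, fun hmem => ?_⟩
          · have := D.adr_lt_length hwv
            omega
          · obtain ⟨w', v', h1, h2, h3⟩ := hTe _ hmem
            obtain ⟨-, rfl⟩ := D.adr_inj hwv h1 h2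
            omega
      · have hnomark : ∀ w ∈ D.vs, D.hdr w ≠ s.reg 1 :=
          fun w hw he => hmark (hr.mark_pos_iff.mpr ⟨w, hw, he.symm⟩)
        by_cases hown : 0 < s.arr 0 (s.reg 1)
        · -- an entry of the list of the current vertex
          obtain ⟨v, u, hvu, hpa⟩ := hr.own_pos_iff.mp hown
          have hvvs := D.mem_vs_of_adj hvu
          have htmp : s.arr 6 (u + 1) = D.adr u v := by
            obtain ⟨-, h2⟩ | ⟨v', hv', hvp, hlast, x, h2, hx⟩ := hch
            · have := h2 v hvvs
              have := D.hdr_add_two_le (v := v) (u := u)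
              omega
            · have hvv : v' = v := by
                by_contra hne
                have h3 := D.hdr_add_two_le (v := v) (u := u)
                have h4 := hlast v hvvs (by omega)
                have h5 := D.idxOf_lt hvu
                have h6 : D.adr v u = D.hdr v + 2 + 2 * (D.pl v).idxOf u := rfl
                rcases D.block_le hv' hvvs hne with hb | hb <;> omega
              subst hvv
              refine (hx u hvu.symm).1 ?_
              by_contra hc
              have := D.le_prev hvu.symm (not_le.mp hc)
              have := D.adr_pos (v := u) (u := v')
              omega
          have hev : linkPhase.body.eval I s =
              (s.setArr 7 (s.reg 1) (D.adr u v)).setReg 1 (s.reg 1 + 1) := by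
            rw [← hpa] at hmark hp hown
            simp [linkPhase, Cmd.eval, Exp.eval, hq0, ← hpa, hp, hmark, hown, D.inp_adr hvu, htmp]
          rw [hev]
          refine ⟨?_, T, hT, Or.inr ?_, ?_, ?_⟩
          · intro w x hwx hl
            by_cases he : D.adr w x = D.adr v u
            · obtain ⟨rfl, rfl⟩ := D.adr_inj hwx hvu he
              simp [hpa]
            · simp at hl
              have := hlink w x hwx (by omega)
              simp [← hpa, he, this]
          · clear hch; simp; omega
          · intro e he
            obtain ⟨w, v', h1, h2, h3⟩ := hTe e he
            exact ⟨w, v', h1, h2, by simp; omega⟩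
          · refine hch.imp ?_ ?_
            · rintro ⟨h1, h2⟩
              refine ⟨by simpa using h1, fun w hw => ?_⟩
              have := h2 w hw
              have := hnomark w hw
              simp
              omega
            · rintro ⟨w, hw, h1, h2, x, h3, h4⟩
              refine ⟨w, hw, by simp; omega, fun w' hw' hl => h2 w' hw' ?_, x, by simpa using h3,
                by simpa using h4⟩
              have := hnomark w' hw'
              simp at hl
              omega
        · have hev : linkPhase.body.eval I s = s.setReg 1 (s.reg 1 + 1) := by
            simp [linkPhase, Cmd.eval, Exp.eval, hq0, hp, hmark, hown]
          rw [hev]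
          refine ⟨?_, T, hT, Or.inr ?_, ?_, ?_⟩
          · intro w x hwx hl
            have hne : D.adr w x ≠ s.reg 1 := fun he => hown (hr.own_pos_iff.mpr ⟨w, x, hwx, he⟩)
            simp at hl
            exact hlink w x hwx (by omega)
          · clear hch; simp; omega
          · intro e he
            obtain ⟨w, v', h1, h2, h3⟩ := hTe e he
            exact ⟨w, v', h1, h2, by simp; omega⟩
          · refine hch.imp ?_ ?_
            · rintro ⟨h1, h2⟩
              refine ⟨by simpa using h1, fun w hw => ?_⟩
              have := h2 w hw
              have := hnomark w hw
              simp
              omega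
            · rintro ⟨w, hw, h1, h2, x, h3, h4⟩
              refine ⟨w, hw, by simp; omega, fun w' hw' hl => h2 w' hw' ?_, x, by simpa using h3,
                by simpa using h4⟩
              have := hnomark w' hw'
              simp at hl
              omega
    · have hev : linkPhase.body.eval I s = s := by
        simp [linkPhase, Cmd.eval, Exp.eval, hq0, hp]
      rw [hev]
      exact ⟨hlink, T, hT, Or.inl ⟨by omega, hq0⟩, hTe, hch⟩

/-- After `linkPhase` the two entries of each edge are linked. -/
theorem linked_linkPhase {s : Store} (h : D.Read s L) (h0 : s.reg 0 = L) :
    D.Linked (linkPhase.eval I L s) := by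
  have hinv := linkPhase.eval_inv (I := I) (L := L) (s := s) D.LinkInv D.linkInv_step
    (m := 2 * L) ?_ (by omega)
  · obtain ⟨-, -, hlink, T, hT, hm, -⟩ := hinv
    intro v u hvu
    refine hlink v u hvu ?_
    have := D.adr_lt_length hvu
    omega
  · refine ⟨?_, h.congr rfl rfl rfl rfl rfl rfl, ?_⟩
    · simp [linkPhase, Cmd.eval, h0]
    · simp only [linkPhase, Cmd.eval, Exp.eval, Store.reg_setReg, Store.arr_setReg]
      refine ⟨fun v u hvu hl => ?_, ∅, by simp, Or.inr (by simp; omega), by simp,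
        Or.inl ⟨by simp, by simp⟩⟩
      simp at hl

end Layout

/-! ### The stable matching without the edges of `S` -/

/-- Deferred acceptance.  Register `1` scans the input for blocks of vertices of `A`; register `2`
is the entry of the list of the vertex of `A` that is about to propose, unless it is not an entry.
For such a proposal, register `3` is the entry of the proposer in the other list, and register `4`
that of the present partner, or `0`. -/
def proposePhase : Phase where
  init := .seq (.set 1 (.lit 0)) (.set 2 (.lit 0))
  body := .ite (.lit 0) (.arr 0 (.reg 2))
    (.ite (.lit 0) (.inp (.succ (.reg 2))) (.set 2 (.succ (.succ (.reg 2))))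
      (.seq (.set 3 (.arr 7 (.reg 2))) <|
        .seq (.set 4 (.arr 8 (.succ (.inp (.reg 2))))) <|
        .ite (.lit 0) (.reg 4)
          (.ite (.reg 3) (.reg 4)
            (.seq (.store 8 (.succ (.inp (.reg 4))) (.lit 0)) <|
              .seq (.store 8 (.succ (.inp (.reg 2))) (.reg 3)) <|
              .seq (.store 8 (.arr 0 (.reg 2)) (.reg 2)) <|
              .set 2 (.succ (.succ (.arr 7 (.reg 4)))))
            (.set 2 (.succ (.succ (.reg 2)))))
          (.seq (.store 8 (.succ (.inp (.reg 2))) (.reg 3)) <|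
            .seq (.store 8 (.arr 0 (.reg 2)) (.reg 2)) (.set 2 (.lit 0)))))
    (.ite (.reg 1) (.reg 0)
      (.seq (.ite (.lit 0) (.arr 3 (.reg 1)) (.set 2 (.succ (.succ (.reg 1)))) .skip)
        (.set 1 (.succ (.reg 1))))
      .skip)

namespace Layout

variable {n : ℕ} {P : PrefSystem (Fin n)} {A B : Set (Fin n)} {S : Set (Sym2 (Fin n))} {I : ℕ → ℕ}
  {L : ℕ} (D : Layout P A S I L)

/-- The vertex `a` of `A` has been rejected by `b`: when register `1` has the value `i`, register
`2` has the value `y`, and `c` gives the entry of the partner of each matched vertex, this means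
that `b` comes before the partner of `a`, and before `y` if `a` is about to propose. -/
structure Passed (c : Fin n → ℕ) (i y : ℕ) (a b : Fin n) : Prop where
  mem : a ∈ A
  hdr_lt : D.hdr a < i
  before_cur : c a ≠ 0 → D.adr a b < c a
  before_pos : ∀ x, P.graph.Adj a x → y = D.adr a x → D.adr a b < y

open Classical in
/-- The set of the entries of the vertices that have rejected the owner of the entry. -/
noncomputable def passedSet (c : Fin n → ℕ) (i y : ℕ) : Finset ℕ :=
  (Finset.range L).filter fun p => ∃ a b, P.graph.Adj a b ∧ D.Passed c i y a b ∧ D.adr a b = p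

theorem adr_mem_passedSet {c : Fin n → ℕ} {i y : ℕ} {a b : Fin n} (hab : P.graph.Adj a b) :
    D.adr a b ∈ D.passedSet c i y ↔ D.Passed c i y a b := by
  classical
  unfold passedSet
  rw [Finset.mem_filter, Finset.mem_range]
  constructor
  · rintro ⟨-, a', b', h, hp, he⟩
    obtain ⟨rfl, rfl⟩ := D.adr_inj h hab he
    exact hp
  · intro h
    have := D.adr_lt_length hab
    exact ⟨by omega, a, b, hab, h, rfl⟩

theorem passedSet_subset {c c' : Fin n → ℕ} {i y i' y' : ℕ}
    (h : ∀ a b, P.graph.Adj a b → D.Passed c i y a b → D.Passed c' i' y' a b) :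
    D.passedSet c i y ⊆ D.passedSet c' i' y' := by
  intro p hp
  obtain ⟨-, a, b, hab, hpass, rfl⟩ := by
    classical
    simpa only [passedSet, Finset.mem_filter] using hp
  exact (D.adr_mem_passedSet hab).mpr (h a b hab hpass)

theorem card_passedSet_le (c : Fin n → ℕ) (i y : ℕ) : (D.passedSet c i y).card ≤ L := by
  classical
  unfold passedSet
  exact (Finset.card_filter_le _ _).trans (Finset.card_range L).le

/-- The invariant of deferred acceptance. -/
structure Proposing (c : Fin n → ℕ) (i y : ℕ) : Prop where
  symm : ∀ v, c v = 0 ∨ ∃ u, P.graph.Adj v u ∧ c v = D.adr v u ∧ c u = D.adr u v ∧ s(v, u) ∉ S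
  pos : ∀ a x, P.graph.Adj a x → y = D.adr a x → a ∈ A ∧ D.hdr a < i ∧ c a = 0
  fresh : ∀ a ∈ A, i ≤ D.hdr a → c a = 0
  rejected : ∀ a b, P.graph.Adj a b → D.Passed c i y a b →
    s(a, b) ∈ S ∨ c b ≠ 0 ∧ c b < D.adr b a

variable {D}

theorem owner_eq {a b a' x : Fin n} (hab : P.graph.Adj a b) (hax : P.graph.Adj a' x)
    (h : D.adr a b + 2 = D.adr a' x) : a' = a := by
  rcases D.next hab with ⟨u', hu', he⟩ | ⟨hne, -⟩
  · exact (D.adr_inj hax hu' (by omega)).1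
  · exact absurd ⟨a', x, hax, h.symm⟩ hne

/-- A vertex of `A` has been rejected and turns to the next entry of its list. -/
theorem Proposing.advance {c : Fin n → ℕ} {i : ℕ} {a b : Fin n} (hab : P.graph.Adj a b)
    (h : D.Proposing c i (D.adr a b)) (hrej : s(a, b) ∈ S ∨ c b ≠ 0 ∧ c b < D.adr b a) :
    D.Proposing c i (D.adr a b + 2) ∧
      (D.passedSet c i (D.adr a b)).card < (D.passedSet c i (D.adr a b + 2)).card := by
  obtain ⟨hA, hlt, hc⟩ := h.pos a b hab rfl
  have hpass : ∀ a' b', P.graph.Adj a' b' → D.Passed c i (D.adr a b) a' b' →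
      D.Passed c i (D.adr a b + 2) a' b' := by
    intro a' b' hab' hp
    refine ⟨hp.mem, hp.hdr_lt, hp.before_cur, fun x hx he => ?_⟩
    obtain rfl := owner_eq hab hx he
    have := hp.before_pos b hab rfl
    omega
  refine ⟨⟨h.symm, fun a' x hx he => ?_, h.fresh, fun a' b' hab' hp => ?_⟩,
    Finset.card_lt_card ((Finset.ssubset_iff_of_subset (D.passedSet_subset hpass)).mpr
      ⟨D.adr a b, ?_, ?_⟩)⟩
  · obtain rfl := owner_eq hab hx he
    exact ⟨hA, hlt, hc⟩
  · by_cases ha : a' = a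
    · subst ha
      by_cases hle : D.adr a' b' < D.adr a' b
      · exact h.rejected a' b' hab' ⟨hp.mem, hp.hdr_lt, hp.before_cur, fun x _ _ => hle⟩
      · have heq : D.adr a' b' = D.adr a' b := by
          rcases D.next hab with ⟨u', hu', he⟩ | ⟨-, hlast⟩
          · have := hp.before_pos u' hu' he.symm
            have := D.even_adr hab
            have := D.even_adr hab'
            omega
          · have := hlast b' hab'
            omega
        obtain ⟨-, rfl⟩ := D.adr_inj hab' hab heq
        exact hrej
    · exact h.rejected a' b' hab' ⟨hp.mem, hp.hdr_lt, hp.before_cur, fun x hx he =>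
        absurd (D.adr_inj hab hx he).1.symm ha⟩
  · refine (D.adr_mem_passedSet hab).mpr ⟨hA, hlt, fun h0 => absurd hc h0, fun _ _ _ => by omega⟩
  · intro hmem
    exact lt_irrefl _ (((D.adr_mem_passedSet hab).mp hmem).before_pos b hab rfl)

/-- A proposal to an unmatched vertex is accepted. -/
theorem Proposing.accept {c : Fin n → ℕ} {i : ℕ} {a b : Fin n}
    (hbip : P.graph.IsBipartiteWith A B) (hab : P.graph.Adj a b)
    (h : D.Proposing c i (D.adr a b)) (hS : s(a, b) ∉ S) (hb : c b = 0) :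
    let c' := Function.update (Function.update c b (D.adr b a)) a (D.adr a b)
    D.Proposing c' i 0 ∧ (D.passedSet c i (D.adr a b)).card ≤ (D.passedSet c' i 0).card := by
  intro c'
  obtain ⟨hA, hlt, hc⟩ := h.pos a b hab rfl
  have hbA : b ∉ A := Set.disjoint_right.mp hbip.disjoint (hbip.mem_of_mem_adj hA hab)
  have hne : b ≠ a := hab.ne'
  have hca : c' a = D.adr a b := by simp [c']
  have hcb : c' b = D.adr b a := by simp [c', hne]
  have hcv : ∀ v, v ≠ a → v ≠ b → c' v = c v := fun v h1 h2 => by simp [c', h1, h2]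
  have hzero : ∀ a' x, P.graph.Adj a' x → (0 : ℕ) ≠ D.adr a' x := fun a' x hx =>
    (D.adr_pos (v := a') (u := x)).ne
  have hpass : ∀ a' b', D.Passed c i (D.adr a b) a' b' ↔ D.Passed c' i 0 a' b' := by
    intro a' b'
    have hA' : a' ∈ A → a' ≠ b := by rintro hx rfl; exact hbA hx
    constructor
    · intro hp
      refine ⟨hp.mem, hp.hdr_lt, fun h0 => ?_, fun x hx he => absurd he (hzero a' x hx)⟩
      by_cases ha : a' = a
      · subst ha
        rw [hca]
        exact hp.before_pos b hab rfl
      · rw [hcv a' ha (hA' hp.mem)] at h0 ⊢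
        exact hp.before_cur h0
    · intro hp
      refine ⟨hp.mem, hp.hdr_lt, fun h0 => ?_, fun x hx he => ?_⟩
      · by_cases ha : a' = a
        · subst ha
          exact absurd hc h0
        · rw [← hcv a' ha (hA' hp.mem)] at h0 ⊢
          exact hp.before_cur h0
      · obtain ⟨rfl, rfl⟩ := D.adr_inj hab hx he
        rw [← hca]
        exact hp.before_cur (by rw [hca]; exact D.adr_pos.ne')
  refine ⟨⟨fun v => ?_, fun a' x hx he => absurd he (hzero a' x hx), fun a' ha' hi => ?_,
    fun a' b' hab' hp => ?_⟩, Finset.card_le_card (D.passedSet_subset fun a' b' _ =>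
      (hpass a' b').mp)⟩
  · by_cases hva : v = a
    · subst hva
      exact Or.inr ⟨b, hab, hca, hcb, hS⟩
    by_cases hvb : v = b
    · subst hvb
      exact Or.inr ⟨a, hab.symm, hcb, hca, by rwa [Sym2.eq_swap]⟩
    rw [hcv v hva hvb]
    refine (h.symm v).imp_right ?_
    rintro ⟨u, h1, h2, h3, h4⟩
    refine ⟨u, h1, h2, ?_, h4⟩
    have hp := D.adr_pos (v := u) (u := v)
    rw [hcv u (by rintro rfl; omega) (by rintro rfl; omega), h3]
  · have h1 : a' ≠ a := by rintro rfl; omega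
    have h2 : a' ≠ b := by rintro rfl; exact hbA ha'
    rw [hcv a' h1 h2]
    exact h.fresh a' ha' hi
  · refine (h.rejected a' b' hab' ((hpass a' b').mpr hp)).imp_right ?_
    rintro ⟨h1, h2⟩
    have hbA' : b' ≠ a := by
      rintro rfl
      exact h1 hc
    rw [hcv b' hbA' (by rintro rfl; exact h1 hb)]
    exact ⟨h1, h2⟩

/-- A proposal to a vertex `b` that prefers the proposer `a` to its partner `a'` is accepted, and
`a'` is about to be rejected. -/
theorem Proposing.exchange {c : Fin n → ℕ} {i : ℕ} {a b a' : Fin n}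
    (hbip : P.graph.IsBipartiteWith A B) (hab : P.graph.Adj a b) (hba' : P.graph.Adj b a')
    (h : D.Proposing c i (D.adr a b)) (hS : s(a, b) ∉ S) (hb : c b = D.adr b a')
    (hlt' : D.adr b a < D.adr b a') :
    let c' := Function.update (Function.update (Function.update c a' 0) b (D.adr b a)) a (D.adr a b)
    D.Proposing c' i (D.adr a' b) ∧ c' b = D.adr b a ∧
      (D.passedSet c i (D.adr a b)).card ≤ (D.passedSet c' i (D.adr a' b)).card := by
  intro c'
  obtain ⟨hA, hlt, hc⟩ := h.pos a b hab rfl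
  have hbB : b ∈ B := hbip.mem_of_mem_adj hA hab
  have hbA : b ∉ A := Set.disjoint_right.mp hbip.disjoint hbB
  have haA' : a' ∈ A := hbip.symm.mem_of_mem_adj hbB hba'
  have hne : b ≠ a := hab.ne'
  have hne' : a' ≠ a := by rintro rfl; omega
  have hne2 : a' ≠ b := hba'.ne'
  have hca' : c a' = D.adr a' b := by
    obtain h0 | ⟨u, h1, h2, h3, h4⟩ := h.symm b
    · have := D.adr_pos (v := b) (u := a')
      omega
    · obtain ⟨-, rfl⟩ := D.adr_inj h1 hba' (by omega)
      exact h3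
  have hi' : D.hdr a' < i := by
    by_contra hi
    have := h.fresh a' haA' (not_lt.mp hi)
    have := D.adr_pos (v := a') (u := b)
    omega
  have hca : c' a = D.adr a b := by simp [c']
  have hcb : c' b = D.adr b a := by simp [c', hne]
  have hca2 : c' a' = 0 := by simp [c', hne', hne2]
  have hcv : ∀ v, v ≠ a → v ≠ b → v ≠ a' → c' v = c v := fun v h1 h2 h3 => by simp [c', h1, h2, h3]
  have hpass : ∀ x y, P.graph.Adj x y →
      (D.Passed c i (D.adr a b) x y ↔ D.Passed c' i (D.adr a' b) x y) := by
    intro x y hxy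
    have hA' : x ∈ A → x ≠ b := by rintro hx rfl; exact hbA hx
    constructor
    · intro hp
      refine ⟨hp.mem, hp.hdr_lt, fun h0 => ?_, fun z hz he => ?_⟩
      · by_cases hxa : x = a
        · subst hxa
          rw [hca]
          exact hp.before_pos b hab rfl
        · have hxa' : x ≠ a' := by rintro rfl; exact h0 hca2
          rw [hcv x hxa (hA' hp.mem) hxa'] at h0 ⊢
          exact hp.before_cur h0
      · obtain ⟨rfl, rfl⟩ := D.adr_inj hba'.symm hz he
        rw [← hca']
        exact hp.before_cur (by rw [hca']; exact D.adr_pos.ne')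
    · intro hp
      refine ⟨hp.mem, hp.hdr_lt, fun h0 => ?_, fun z hz he => ?_⟩
      · have hxa : x ≠ a := by rintro rfl; exact h0 hc
        by_cases hxa' : x = a'
        · subst hxa'
          rw [hca']
          exact hp.before_pos b hba'.symm rfl
        · rw [← hcv x hxa (hA' hp.mem) hxa'] at h0 ⊢
          exact hp.before_cur h0
      · obtain ⟨rfl, rfl⟩ := D.adr_inj hab hz he
        rw [← hca]
        exact hp.before_cur (by rw [hca]; exact D.adr_pos.ne')
  refine ⟨⟨fun v => ?_, fun x y hxy he => ?_, fun x hx hi => ?_, fun x y hxy hp => ?_⟩, hcb,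
    Finset.card_le_card (D.passedSet_subset fun x y hxy => (hpass x y hxy).mp)⟩
  · by_cases hva : v = a
    · subst hva
      exact Or.inr ⟨b, hab, hca, hcb, hS⟩
    by_cases hvb : v = b
    · subst hvb
      exact Or.inr ⟨a, hab.symm, hcb, hca, by rwa [Sym2.eq_swap]⟩
    by_cases hva' : v = a'
    · subst hva'
      exact Or.inl hca2
    rw [hcv v hva hvb hva']
    refine (h.symm v).imp_right ?_
    rintro ⟨u, h1, h2, h3, h4⟩
    refine ⟨u, h1, h2, ?_, h4⟩
    have hp := D.adr_pos (v := u) (u := v)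
    rw [hcv u (by rintro rfl; omega) ?_ ?_, h3]
    · rintro rfl
      exact hva' (D.adr_inj hba' h1.symm (by omega)).2.symm
    · rintro rfl
      exact hvb (D.adr_inj hba'.symm h1.symm (by omega)).2.symm
  · obtain ⟨rfl, rfl⟩ := D.adr_inj hba'.symm hxy he
    exact ⟨haA', hi', hca2⟩
  · have h1 : x ≠ a := by rintro rfl; omega
    have h2 : x ≠ b := by rintro rfl; exact hbA hx
    have h3 : x ≠ a' := by rintro rfl; omega
    rw [hcv x h1 h2 h3]
    exact h.fresh x hx hi
  · refine (h.rejected x y hxy ((hpass x y hxy).mpr hp)).imp_right ?_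
    rintro ⟨h1, h2⟩
    have hyA : y ∉ A := Set.disjoint_right.mp hbip.disjoint (hbip.mem_of_mem_adj hp.mem hxy)
    by_cases hyb : y = b
    · subst hyb
      exact ⟨by rw [hcb]; exact D.adr_pos.ne', by rw [hcb]; omega⟩
    · rw [hcv y (by rintro rfl; exact hyA hA) hyb (by rintro rfl; exact hyA haA')]
      exact ⟨h1, h2⟩

/-- The scan passes an address at which no block of a vertex of `A` begins. -/
theorem Proposing.skip {c : Fin n → ℕ} {i y : ℕ} (h : D.Proposing c i y) (hy : ¬ D.IsEntry y)
    (hi : ∀ a ∈ D.vs, a ∈ A → D.hdr a ≠ i) :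
    D.Proposing c (i + 1) y ∧ (D.passedSet c i y).card ≤ (D.passedSet c (i + 1) y).card := by
  refine ⟨⟨h.symm, fun a x hx he => absurd ⟨a, x, hx, he.symm⟩ hy, fun a ha hle =>
    h.fresh a ha (by omega), fun a b hab hp => h.rejected a b hab ⟨hp.mem, ?_, hp.before_cur,
      hp.before_pos⟩⟩, Finset.card_le_card (D.passedSet_subset fun a b _ hp => ⟨hp.mem, ?_,
        hp.before_cur, hp.before_pos⟩)⟩
  · have := hi a (D.mem_vs_of_adj hab) hp.mem
    have := hp.hdr_lt
    omega
  · have := hp.hdr_lt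
    omega

/-- The scan reaches the block of a vertex of `A`, which starts proposing. -/
theorem Proposing.begin {c : Fin n → ℕ} {y : ℕ} {a : Fin n} (ha : a ∈ D.vs) (haA : a ∈ A)
    (h : D.Proposing c (D.hdr a) y) (hy : ¬ D.IsEntry y) :
    D.Proposing c (D.hdr a + 1) (D.hdr a + 2) ∧
      (D.passedSet c (D.hdr a) y).card ≤ (D.passedSet c (D.hdr a + 1) (D.hdr a + 2)).card := by
  obtain ⟨u, hau, hu⟩ := D.first ha
  rw [← hu]
  have hown : ∀ x z, P.graph.Adj x z → D.adr a u = D.adr x z → x = a := fun x z hxz he =>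
    (D.adr_inj hau hxz he).1.symm
  refine ⟨⟨h.symm, fun x z hxz he => ?_, fun x hx hle => h.fresh x hx (by omega),
    fun x z hxz hp => ?_⟩, Finset.card_le_card (D.passedSet_subset fun x z hxz hp => ⟨hp.mem, ?_,
      hp.before_cur, fun w hw he => ?_⟩)⟩
  · obtain rfl := hown x z hxz he
    exact ⟨haA, by omega, h.fresh x haA le_rfl⟩
  · by_cases hxa : x = a
    · subst hxa
      have := hp.before_pos u hau rfl
      have := D.hdr_add_two_le (v := x) (u := z)
      omega
    · refine h.rejected x z hxz ⟨hp.mem, ?_, hp.before_cur, fun w hw he =>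
        absurd ⟨x, w, hw, he.symm⟩ hy⟩
      have : D.hdr x ≠ D.hdr a := fun he => hxa (D.hdr_inj (D.mem_vs_of_adj hxz) ha he)
      have := hp.hdr_lt
      omega
  · have := hp.hdr_lt
    omega
  · obtain rfl := hown x w hw he
    exact absurd hp.hdr_lt (lt_irrefl _)

/-- The function `c` gives, for each vertex matched in `M`, the entry of its partner, and `0` for
the other vertices. -/
structure Holds (D : Layout P A S I L) (c : Fin n → ℕ) (M : Set (Sym2 (Fin n))) : Prop where
  mem_iff : ∀ v u, s(v, u) ∈ M ↔ P.graph.Adj v u ∧ c v = D.adr v u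
  eq_zero_or : ∀ v, c v = 0 ∨ ∃ u, P.graph.Adj v u ∧ c v = D.adr v u

theorem Holds.wants_iff {c : Fin n → ℕ} {M : Set (Sym2 (Fin n))} (h : D.Holds c M) {v u : Fin n}
    (hvu : P.graph.Adj v u) : P.Wants M v u ↔ c v = 0 ∨ D.adr v u < c v := by
  constructor
  · intro hw
    refine (h.eq_zero_or v).imp_right ?_
    rintro ⟨x, hx, hcx⟩
    rw [hcx, D.adr_lt_iff hvu hx]
    exact hw x ((h.mem_iff v x).mpr ⟨hx, hcx⟩)
  · intro hw x hx
    obtain ⟨hx, hcx⟩ := (h.mem_iff v x).mp hx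
    rw [← D.adr_lt_iff hvu hx]
    have := D.adr_pos (v := v) (u := x)
    omega

theorem Holds.isMatching {c : Fin n → ℕ} {M : Set (Sym2 (Fin n))} (h : D.Holds c M) :
    P.IsMatching M := by
  refine PrefSystem.isMatching_of_partner_unique (fun a b hab => ((h.mem_iff a b).mp hab).1)
    fun v a b ha hb => ?_
  obtain ⟨h1, h2⟩ := (h.mem_iff v a).mp ha
  obtain ⟨h3, h4⟩ := (h.mem_iff v b).mp hb
  exact (D.adr_inj h1 h3 (by omega)).2

/-- When deferred acceptance ends, the result is a stable matching. -/
theorem Proposing.exists_holds {c : Fin n → ℕ} {i y : ℕ} (hbip : P.graph.IsBipartiteWith A B)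
    (h : D.Proposing c i y) (hi : L ≤ i) (hy : ¬ D.IsEntry y) :
    ∃ M, (P.deleteEdges S).IsStable M ∧ D.Holds c M := by
  have hmem : ∀ v u, s(v, u) ∈ {e | ∃ v u, P.graph.Adj v u ∧ c v = D.adr v u ∧ e = s(v, u)} ↔
      P.graph.Adj v u ∧ c v = D.adr v u := by
    intro v u
    constructor
    · rintro ⟨x, z, hxz, hc, he⟩
      rcases Sym2.eq_iff.mp he with ⟨rfl, rfl⟩ | ⟨rfl, rfl⟩
      · exact ⟨hxz, hc⟩
      · refine ⟨hxz.symm, ?_⟩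
        obtain h0 | ⟨w, h1, h2, h3, -⟩ := h.symm u
        · have := D.adr_pos (v := u) (u := v)
          omega
        · obtain ⟨-, rfl⟩ := D.adr_inj hxz h1 (by omega)
          exact h3
    · rintro ⟨h1, h2⟩
      exact ⟨v, u, h1, h2, rfl⟩
  have hholds : D.Holds c {e | ∃ v u, P.graph.Adj v u ∧ c v = D.adr v u ∧ e = s(v, u)} :=
    ⟨hmem, fun v => (h.symm v).imp_right fun ⟨u, h1, h2, _⟩ => ⟨u, h1, h2⟩⟩
  refine ⟨_, ⟨?_, ?_⟩, hholds⟩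
  · refine PrefSystem.isMatching_of_partner_unique (fun a b hab => ?_)
      fun v a b => hholds.isMatching.partner_unique
    obtain ⟨h1, h2⟩ := (hmem a b).mp hab
    refine PrefSystem.deleteEdges_adj.mpr ⟨h1, ?_⟩
    obtain h0 | ⟨w, h3, h4, -, h5⟩ := h.symm a
    · have := D.adr_pos (v := a) (u := b)
      omega
    · obtain ⟨-, rfl⟩ := D.adr_inj h1 h3 (by omega)
      exact h5
  · -- an edge `ab` that does not lie in `S`, with `a ∈ A`, does not block
    have key : ∀ a b, a ∈ A → P.graph.Adj a b → s(a, b) ∉ S →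
        (c a = 0 ∨ D.adr a b < c a) → ¬ (c b = 0 ∨ D.adr b a < c b) := by
      intro a b ha hab hS hw hw'
      have hlen := D.block_le_length (D.mem_vs_of_adj hab)
      rcases h.rejected a b hab ⟨ha, by omega, by omega, fun x hx he =>
        absurd ⟨a, x, hx, he.symm⟩ hy⟩ with h1 | h1
      · exact hS h1
      · omega
    have hwants : ∀ v u, (P.deleteEdges S).graph.Adj v u → (P.deleteEdges S).Wants
        {e | ∃ v u, P.graph.Adj v u ∧ c v = D.adr v u ∧ e = s(v, u)} v u →
          c v = 0 ∨ D.adr v u < c v := by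
      intro v u hvu hw
      exact (hholds.wants_iff (PrefSystem.deleteEdges_adj.mp hvu).1).mp fun w hwM => (hw w hwM).1
    refine PrefSystem.bp_eq_empty_iff.mpr fun a b hab h1 h2 => ?_
    have h1 := hwants a b hab h1
    have h2 := hwants b a hab.symm h2
    obtain ⟨hab, hS⟩ := PrefSystem.deleteEdges_adj.mp hab
    rcases hbip.mem_of_adj hab with ⟨ha, -⟩ | ⟨-, hb⟩
    · exact key a b ha hab hS h1 h2
    · exact key b a hb hab.symm (by rwa [Sym2.eq_swap]) h2 h1

end Layout

/-! ### Correctness of the phase for deferred acceptance -/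

namespace Layout

variable {n : ℕ} {P : PrefSystem (Fin n)} {A B : Set (Fin n)} {S : Set (Sym2 (Fin n))} {I : ℕ → ℕ}
  {L : ℕ} {D : Layout P A S I L}

/-- The array `8`, as a function on vertices. -/
def cur (s : Store) (v : Fin n) : ℕ := s.arr 8 (v + 1)

theorem cur_setReg (s : Store) (r x : ℕ) : (cur (s.setReg r x) : Fin n → ℕ) = cur s := rfl

theorem cur_setArr (s : Store) (v : Fin n) (x : ℕ) :
    (cur (s.setArr 8 (v + 1) x) : Fin n → ℕ) = Function.update (cur s) v x := by
  funext u
  simp [cur, Function.update_apply, Fin.val_inj]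

theorem cur_congr {s s' : Store} (h : s'.arr 8 = s.arr 8) : (cur s' : Fin n → ℕ) = cur s := by
  funext v
  rw [cur, cur, h]

variable (D)

/-- The invariant of `proposePhase`. -/
structure ProposeInv (s : Store) (m : ℕ) : Prop where
  reg0 : s.reg 0 = L
  read : D.Read s L
  linked : D.Linked s
  proposing : D.Proposing (cur s) (s.reg 1) (s.reg 2)
  bound : (L ≤ s.reg 1 ∧ ¬ D.IsEntry (s.reg 2)) ∨ ∃ k ≤ 1, (D.IsEntry (s.reg 2) → k = 1) ∧
    2 * (L - s.reg 1) + (L - (D.passedSet (cur s) (s.reg 1) (s.reg 2)).card) + k ≤ m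

theorem proposeInv_step (hbip : P.graph.IsBipartiteWith A B) (s : Store) (m : ℕ)
    (h : D.ProposeInv s m) : D.ProposeInv (proposePhase.body.eval I s) (m - 1) := by
  have hread : D.Read (proposePhase.body.eval I s) L :=
    h.read.congr (Cmd.eval_arr _ rfl s) (Cmd.eval_arr _ rfl s) (Cmd.eval_arr _ rfl s)
      (Cmd.eval_arr _ rfl s) (Cmd.eval_arr _ rfl s) (Cmd.eval_arr _ rfl s)
  have hreg0 : (proposePhase.body.eval I s).reg 0 = L := by
    rw [Cmd.eval_reg _ rfl s, h.reg0]
  have hlinked : D.Linked (proposePhase.body.eval I s) := by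
    intro v u hvu
    rw [Cmd.eval_arr _ rfl s, h.linked v u hvu]
  obtain ⟨h0, hr, hl, hp, hb⟩ := h
  refine (fun h : D.Proposing _ _ _ ∧ _ => ⟨hreg0, hread, hlinked, h.1, h.2⟩) ?_
  by_cases hown : 0 < s.arr 0 (s.reg 2)
  · obtain ⟨a, b, hab, hy⟩ := hr.own_pos_iff.mp hown
    have hown' := hr.own' hab
    have hlink := hl a b hab
    have hI := D.inp_adr hab
    have hcur : cur s b = s.arr 8 (b + 1) := rfl
    have hne : (a : ℕ) ≠ b := fun he => hab.ne (Fin.ext he)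
    obtain ⟨h1, h2⟩ | ⟨k, hk, hk', hbd⟩ := hb
    · exact absurd ⟨a, b, hab, hy⟩ h2
    rw [hk' ⟨a, b, hab, hy⟩] at hbd
    rw [← hy] at hown hp hbd
    -- the result of an advance to the next entry
    have hadv : ∀ (s' : Store) (a' b' : Fin n), P.graph.Adj a' b' → s'.reg 1 = s.reg 1 →
        s'.reg 2 = D.adr a' b' + 2 → D.Proposing (cur s') (s.reg 1) (D.adr a' b') →
        (s(a', b') ∈ S ∨ cur s' b' ≠ 0 ∧ cur s' b' < D.adr b' a') →
        (D.passedSet (cur s) (s.reg 1) (D.adr a b)).card ≤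
          (D.passedSet (cur s') (s.reg 1) (D.adr a' b')).card →
        D.Proposing (cur s') (s'.reg 1) (s'.reg 2) ∧
          ((L ≤ s'.reg 1 ∧ ¬ D.IsEntry (s'.reg 2)) ∨ ∃ k ≤ 1, (D.IsEntry (s'.reg 2) → k = 1) ∧
            2 * (L - s'.reg 1) + (L - (D.passedSet (cur s') (s'.reg 1) (s'.reg 2)).card) + k
              ≤ m - 1) := by
      intro s' a' b' hab' e1 e2 hp' hrej hcard
      obtain ⟨h3, h4⟩ := hp'.advance hab' hrej
      rw [e1, e2]
      refine ⟨h3, Or.inr ⟨1, le_rfl, fun _ => rfl, ?_⟩⟩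
      have := D.card_passedSet_le (cur s') (s.reg 1) (D.adr a' b' + 2)
      omega
    by_cases hS : s(a, b) ∈ S
    · have hflag : 0 < I (D.adr a b + 1) :=
        Nat.pos_of_ne_zero fun h => (D.inp_adr_succ hab).mp h hS
      have hev : proposePhase.body.eval I s = s.setReg 2 (D.adr a b + 2) := by
        simp [proposePhase, Cmd.eval, Exp.eval, ← hy, hown, hflag]
      rw [hev]
      exact hadv _ a b hab (by simp) (by simp) hp (Or.inl hS) le_rfl
    · have hflag := (D.inp_adr_succ hab).mpr hS
      obtain hb0 | ⟨a', hba', hb', hca', -⟩ := hp.symm b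
      · have hev : proposePhase.body.eval I s =
            (((((s.setReg 3 (D.adr b a)).setReg 4 0).setArr 8 (b + 1) (D.adr b a)).setArr 8
              (a + 1) (D.adr a b)).setReg 2 0) := by
          rw [hcur] at hb0
          simp [proposePhase, Cmd.eval, Exp.eval, ← hy, hown', hflag, hlink, hI, hb0]
        rw [hev]
        obtain ⟨h3, h4⟩ := hp.accept hbip hab hS hb0
        simp only [cur_setReg, cur_setArr, Store.reg_setReg, Store.reg_setArr]
        refine ⟨h3, Or.inr ⟨0, by omega, fun hc => absurd hc D.not_isEntry_zero, ?_⟩⟩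
        have := D.card_passedSet_le (Function.update (Function.update (cur s) b (D.adr b a)) a
          (D.adr a b)) (s.reg 1) 0
        simp
        omega
      · have hlink' := hl b a' hba'
        have hI' := D.inp_adr hba'
        have hpos := D.adr_pos (v := b) (u := a')
        have hcur' : s.arr 8 (b + 1) = D.adr b a' := hb'
        by_cases hlt : D.adr b a < D.adr b a'
        · have hev : proposePhase.body.eval I s =
              ((((((s.setReg 3 (D.adr b a)).setReg 4 (D.adr b a')).setArr 8 (a' + 1) 0).setArr 8
                (b + 1) (D.adr b a)).setArr 8 (a + 1) (D.adr a b)).setReg 2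
                (D.adr a' b + 2)) := by
            simp [proposePhase, Cmd.eval, Exp.eval, ← hy, hown', hflag, hlink, hI, hcur', hpos,
              hlt, hlink', hI']
          rw [hev]
          obtain ⟨h3, h4, h5⟩ := hp.exchange hbip hab hba' hS hb' hlt
          refine hadv _ a' b hba'.symm (by simp) (by simp) ?_ (Or.inr ?_) ?_
          · simpa only [cur_setReg, cur_setArr] using h3
          · simp only [cur_setReg, cur_setArr]
            rw [h4]
            exact ⟨D.adr_pos.ne', hlt⟩
          · simpa only [cur_setReg, cur_setArr] using h5
        · have hev : proposePhase.body.eval I s =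
              ((s.setReg 3 (D.adr b a)).setReg 4 (D.adr b a')).setReg 2 (D.adr a b + 2) := by
            simp [proposePhase, Cmd.eval, Exp.eval, ← hy, hown, hflag, hlink, hI, hcur', hpos,
              hlt]
          rw [hev]
          refine hadv _ a b hab (by simp) (by simp) hp (Or.inr ⟨?_, ?_⟩) le_rfl
          · show cur s b ≠ 0
            omega
          · show cur s b < _
            have hne' : D.adr b a ≠ D.adr b a' := by
              intro he
              obtain ⟨-, rfl⟩ := D.adr_inj hab.symm hba' he
              have := (hp.pos a b hab rfl).2.2
              have := D.adr_pos (v := a) (u := b)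
              omega
            omega
  · have hent : ¬ D.IsEntry (s.reg 2) := fun hc => hown (hr.own_pos_iff.mpr hc)
    by_cases hi : s.reg 1 < s.reg 0
    · obtain ⟨h1, -⟩ | ⟨k, hk, hk', hbd⟩ := hb
      · omega
      by_cases hmark : 0 < s.arr 3 (s.reg 1)
      · obtain ⟨a, ha, haA, hia⟩ := hr.markA_pos_iff.mp hmark
        have hev : proposePhase.body.eval I s =
            (s.setReg 2 (s.reg 1 + 2)).setReg 1 (s.reg 1 + 1) := by
          simp [proposePhase, Cmd.eval, Exp.eval, hown, hi, hmark]
        rw [hev]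
        rw [hia] at hp
        obtain ⟨h3, h4⟩ := hp.begin ha haA hent
        rw [← hia] at h3 h4
        refine ⟨h3, Or.inr ⟨1, le_rfl, fun _ => rfl, ?_⟩⟩
        simp only [cur_setReg, Store.reg_setReg]
        simp
        omega
      · have hev : proposePhase.body.eval I s = s.setReg 1 (s.reg 1 + 1) := by
          simp [proposePhase, Cmd.eval, Exp.eval, hown, hi, hmark]
        rw [hev]
        obtain ⟨h3, h4⟩ := hp.skip hent fun a ha haA he =>
          hmark (hr.markA_pos_iff.mpr ⟨a, ha, haA, he.symm⟩)
        refine ⟨h3, Or.inr ⟨0, by omega, fun hc => absurd hc hent, ?_⟩⟩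
        simp only [cur_setReg, Store.reg_setReg]
        simp
        omega
    · have hev : proposePhase.body.eval I s = s := by
        simp [proposePhase, Cmd.eval, Exp.eval, hown, hi]
      rw [hev]
      exact ⟨hp, Or.inl ⟨by omega, hent⟩⟩

/-- The array `8` holds a stable matching of the system without the edges of `S` after
`proposePhase`. -/
theorem holds_proposePhase (hbip : P.graph.IsBipartiteWith A B) {s : Store} (h : D.Read s L)
    (hl : D.Linked s) (h0 : s.reg 0 = L) (h8 : ∀ x, s.arr 8 x = 0) :
    ∃ M, (P.deleteEdges S).IsStable M ∧ D.Holds (cur (proposePhase.eval I L s)) M := by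
  have hinv := proposePhase.eval_inv (I := I) (L := L) (s := s) D.ProposeInv
    (D.proposeInv_step hbip) (m := 3 * L) ?_ (by omega)
  · obtain ⟨-, -, -, hp, h1 | ⟨k, -, hk, hb⟩⟩ := hinv
    · exact hp.exists_holds hbip h1.1 h1.2
    · exact hp.exists_holds hbip (by omega) fun hc => by have := hk hc; omega
  · have hcur : ∀ v : Fin n, cur (proposePhase.init.eval I s) v = 0 := fun v => h8 _
    have hr2 : (proposePhase.init.eval I s).reg 2 = 0 := by simp [proposePhase, Cmd.eval, Exp.eval]
    have hr1 : (proposePhase.init.eval I s).reg 1 = 0 := by simp [proposePhase, Cmd.eval, Exp.eval]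
    refine ⟨?_, h.congr rfl rfl rfl rfl rfl rfl, hl, ⟨fun v => Or.inl (hcur v),
      fun a x hax he => ?_, fun a _ _ => hcur a, fun a b hab hp => ?_⟩,
      Or.inr ⟨0, by omega, ?_, ?_⟩⟩
    · simp [proposePhase, Cmd.eval, h0]
    · have := D.adr_pos (v := a) (u := x)
      omega
    · have := hp.hdr_lt
      omega
    · rw [hr2]
      exact fun hc => absurd hc D.not_isEntry_zero
    · rw [hr1]
      omega

end Layout

/-! ### The blocking edges -/

namespace Mach

/-- Run through the addresses of the input with register `1` and execute `c` at each entry. -/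
def Phase.scan (c : Cmd) : Phase where
  init := .set 1 (.lit 0)
  body := .ite (.reg 1) (.reg 0)
    (.seq (.ite (.lit 0) (.arr 0 (.reg 1)) c .skip) (.set 1 (.succ (.reg 1)))) .skip

/-- The command `c` leaves the registers `0` and `1` and the arrays `0`, …, `8` unchanged. -/
def Cmd.Keeps (c : Cmd) : Prop :=
  c.WritesReg 0 = false ∧ c.WritesReg 1 = false ∧ ∀ j : Fin 16, j ≤ 8 → c.WritesArr j = false

/-- Mark the vertex in register `3` and append it to the queue, whose length is in register `9`,
unless it is marked. -/
def enqueueCmd : Cmd :=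
  .ite (.lit 0) (.arr 9 (.reg 3)) .skip
    (.seq (.store 9 (.reg 3) (.lit 1)) <|
      .seq (.store 10 (.reg 9) (.reg 3)) (.set 9 (.succ (.reg 9))))

end Mach

/-- Enqueue the owner of the entry in register `1`, if it is an entry of an edge of `S`.  If the
owner does not prefer that neighbour to its partner, then put `1` into register `10`. -/
def seedCmd : Cmd :=
  .ite (.lit 0) (.inp (.succ (.reg 1)))
    (.seq (.ite (.lit 0) (.arr 8 (.arr 0 (.reg 1)))
        (.ite (.reg 1) (.arr 8 (.arr 0 (.reg 1))) .skip (.set 10 (.lit 1))) .skip)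
      (.seq (.set 3 (.arr 0 (.reg 1))) enqueueCmd))
    .skip

namespace Layout

variable {n : ℕ} {P : PrefSystem (Fin n)} {A B : Set (Fin n)} {S : Set (Sym2 (Fin n))} {I : ℕ → ℕ}
  {L : ℕ} (D : Layout P A S I L) {M : Set (Sym2 (Fin n))}

/-- The arrays `0`, …, `8` are filled, and the array `8` holds the matching `M`. -/
structure Ready (s : Store) (M : Set (Sym2 (Fin n))) : Prop where
  reg0 : s.reg 0 = L
  read : D.Read s L
  linked : D.Linked s
  holds : D.Holds (cur s) M

/-- The queue holds the vertices in the list `l`, and these are the marked vertices. -/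
structure Queued (s : Store) (l : List (Fin n)) : Prop where
  nodup : l.Nodup
  length : s.reg 9 = l.length
  arr_queue : ∀ k (h : k < l.length), s.arr 10 k = l[k] + 1
  arr_mark : ∀ v : Fin n, s.arr 9 (v + 1) ≠ 0 ↔ v ∈ l

variable {D}

theorem Ready.congr {s s' : Store} (h : D.Ready s M) (h0 : s'.reg 0 = s.reg 0)
    (hj : ∀ j : Fin 16, j ≤ 8 → s'.arr j = s.arr j) : D.Ready s' M := by
  refine ⟨h0.trans h.reg0, h.read.congr (hj 0 (by decide)) (hj 1 (by decide)) (hj 2 (by decide))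
    (hj 3 (by decide)) (hj 4 (by decide)) (hj 5 (by decide)), fun v u hvu => ?_, ?_⟩
  · rw [hj 7 (by decide), h.linked v u hvu]
  · rw [cur_congr (hj 8 (by decide))]
    exact h.holds

theorem Ready.eval {s : Store} (h : D.Ready s M) (c : Cmd) (h0 : c.WritesReg 0 = false)
    (hj : ∀ j : Fin 16, j ≤ 8 → c.WritesArr j = false) : D.Ready (c.eval I s) M :=
  h.congr (Cmd.eval_reg c h0 s) fun j hj' => Cmd.eval_arr c (hj j hj') s

theorem Ready.evalPhase {s : Store} (h : D.Ready s M) (p : Phase)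
    (h0 : p.init.WritesReg 0 = false ∧ p.body.WritesReg 0 = false)
    (hj : ∀ j : Fin 16, j ≤ 8 → p.init.WritesArr j = false ∧ p.body.WritesArr j = false) :
    D.Ready (p.eval I L s) M :=
  h.congr (Phase.eval_reg p h0.1 h0.2 s) fun j hj' => Phase.eval_arr p (hj j hj').1 (hj j hj').2 s

/-- Induction along a scan: `Inv s E` is meant to hold when the entries in `E` have been visited. -/
theorem Ready.scan_induction {s : Store} (h : D.Ready s M) {c : Cmd} (hc : c.Keeps)
    (Inv : Store → Set (Fin n × Fin n) → Prop) (hinit : Inv s ∅)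
    (hreg : ∀ s x E, Inv s E → Inv (s.setReg 1 x) E)
    (hstep : ∀ s E v u, D.Ready s M → s.reg 1 = D.adr v u → P.graph.Adj v u → (v, u) ∉ E →
      Inv s E → Inv (c.eval I s) (insert (v, u) E)) :
    Inv ((Phase.scan c).eval I L s) {q | P.graph.Adj q.1 q.2} := by
  have hfin := (Phase.scan c).eval_inv (I := I) (L := L) (s := s)
    (fun s m => D.Ready s M ∧ L ≤ s.reg 1 + m ∧
      Inv s {q | P.graph.Adj q.1 q.2 ∧ D.adr q.1 q.2 < s.reg 1}) ?_ (m := L) ?_ (by omega)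
  · obtain ⟨-, hL, hinv⟩ := hfin
    convert hinv using 1
    ext ⟨v, u⟩
    refine ⟨fun hvu => ⟨hvu, ?_⟩, fun hvu => hvu.1⟩
    have := D.adr_lt_length (v := v) (u := u) hvu
    have hlt : D.adr v u < ((Phase.scan c).eval I L s).reg 1 := by omega
    exact hlt
  · rintro s m ⟨hr, hm, hinv⟩
    by_cases hlt : s.reg 1 < s.reg 0
    · have hltL := hr.reg0 ▸ hlt
      by_cases hown : 0 < s.arr 0 (s.reg 1)
      · obtain ⟨v, u, hvu, he⟩ := hr.read.own_pos_iff.mp hown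
        have hev : (Phase.scan c).body.eval I s = (c.eval I s).setReg 1 (s.reg 1 + 1) := by
          have h1 := Cmd.eval_reg (I := I) c hc.2.1 s
          simp [Phase.scan, Cmd.eval, Exp.eval, hlt, hown, h1]
        rw [hev]
        refine ⟨(hr.eval c hc.1 hc.2.2).congr (by simp) fun _ _ => rfl, by simp; omega,
          hreg _ _ _ ?_⟩
        convert hstep s _ v u hr he.symm hvu ?_ hinv using 1
        · ext ⟨x, z⟩
          simp only [Store.reg_setReg, if_true, Set.mem_ofPred_eq, Set.mem_insert_iff,
            Prod.mk.injEq]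
          constructor
          · rintro ⟨hxz, hl⟩
            by_cases hxe : D.adr x z = D.adr v u
            · exact Or.inl (D.adr_inj hxz hvu hxe)
            · exact Or.inr ⟨hxz, by omega⟩
          · rintro (⟨rfl, rfl⟩ | ⟨hxz, hl⟩)
            · exact ⟨hvu, by omega⟩
            · exact ⟨hxz, by omega⟩
        · rintro ⟨-, hl⟩
          simp only at hl
          omega
      · have hev : (Phase.scan c).body.eval I s = s.setReg 1 (s.reg 1 + 1) := by
          simp [Phase.scan, Cmd.eval, Exp.eval, hlt, hown]
        rw [hev]
        refine ⟨hr.congr (by simp) fun _ _ => rfl, by simp; omega, hreg _ _ _ ?_⟩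
        convert hinv using 1
        ext ⟨x, z⟩
        simp only [Store.reg_setReg, if_true, Set.mem_ofPred_eq]
        refine and_congr_right fun hxz => ?_
        have : D.adr x z ≠ s.reg 1 := fun he => hown (hr.read.own_pos_iff.mpr ⟨x, z, hxz, he⟩)
        omega
    · have hev : (Phase.scan c).body.eval I s = s := by
        simp [Phase.scan, Cmd.eval, Exp.eval, hlt]
      have := hr.reg0
      rw [hev]
      exact ⟨hr, by omega, hinv⟩
  · refine ⟨h.congr (by simp [Phase.scan, Cmd.eval]) fun _ _ => rfl,
      by simp [Phase.scan, Cmd.eval, Exp.eval], ?_⟩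
    have hE : {q : Fin n × Fin n | P.graph.Adj q.1 q.2 ∧
        D.adr q.1 q.2 < ((Phase.scan c).init.eval I s).reg 1} = ∅ := by
      ext q
      simp [Phase.scan, Cmd.eval, Exp.eval]
    rw [hE]
    exact hreg s 0 _ hinit

theorem Queued.congr {s s' : Store} {l : List (Fin n)} (h : Queued s l)
    (h9 : s'.reg 9 = s.reg 9) (ha : s'.arr 9 = s.arr 9) (hb : s'.arr 10 = s.arr 10) :
    Queued s' l := by
  obtain ⟨h1, h2, h3, h4⟩ := h
  exact ⟨h1, h9.trans h2, by rwa [hb], by rwa [ha]⟩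

theorem Queued.enqueue {s : Store} {l : List (Fin n)} (h : Queued s l) {v : Fin n}
    (hv : s.reg 3 = v + 1) :
    ∃ l', Queued (enqueueCmd.eval I s) (l ++ l') ∧ ∀ u, u ∈ l ++ l' ↔ u ∈ l ∨ u = v := by
  by_cases hmem : v ∈ l
  · have hpos := Nat.pos_of_ne_zero ((h.arr_mark v).mpr hmem)
    refine ⟨[], ?_, fun u => ?_⟩
    · rw [List.append_nil]
      simpa [enqueueCmd, Cmd.eval, Exp.eval, hv, hpos] using h
    · rw [List.append_nil]
      exact ⟨Or.inl, fun hu => hu.elim id fun hu => hu ▸ hmem⟩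
  · have hzero : s.arr 9 (v + 1) = 0 := by
      by_contra hc
      exact hmem ((h.arr_mark v).mp hc)
    have hev : enqueueCmd.eval I s =
        ((s.setArr 9 (v + 1) 1).setArr 10 l.length (v + 1)).setReg 9 (l.length + 1) := by
      simp [enqueueCmd, Cmd.eval, Exp.eval, hv, hzero, h.length]
    refine ⟨[v], ?_, fun u => by simp⟩
    rw [hev]
    refine ⟨?_, by simp, fun k hk => ?_, fun u => ?_⟩
    · exact List.nodup_append.mpr ⟨h.nodup, by simp, fun a ha b hb hab => by
        rw [List.mem_singleton.mp hb] at hab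
        exact hmem (hab ▸ ha)⟩
    · rcases lt_or_ge k l.length with hkl | hkl
      · have := h.arr_queue k hkl
        simp [hkl.ne, List.getElem_append_left hkl, this]
      · have hk' : k = l.length := by simp at hk; omega
        subst hk'
        simp
    · have := h.arr_mark u
      by_cases huv : u = v
      · subst huv
        simp
      · have hne : (u : ℕ) ≠ v := fun he => huv (Fin.ext he)
        simp [huv, hne, ← this]

theorem isStable_deleteEdges_iff_bp (hS : S ⊆ P.edges) (hM : (P.deleteEdges S).IsStable M) :
    P.bp M = S ↔ ∀ v u, P.graph.Adj v u → s(v, u) ∈ S → P.Wants M v u := by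
  constructor
  · intro h v u _ hvu
    rw [← h] at hvu
    exact (PrefSystem.mk_mem_bp.mp hvu).2.1
  · intro h
    ext e
    induction e using Sym2.ind with
    | _ a b =>
      rw [PrefSystem.mk_mem_bp]
      constructor
      · rintro ⟨hab, h1, h2⟩
        by_contra hnS
        have hab' := PrefSystem.deleteEdges_adj.mpr ⟨hab, hnS⟩
        exact PrefSystem.bp_eq_empty_iff.mp hM.2 a b hab'
          (fun w hw => ⟨h1 w hw, hM.1.adj hw, hab'⟩)
          (fun w hw => ⟨h2 w hw, hM.1.adj hw, hab'.symm⟩)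
      · intro hab
        have hadj : P.graph.Adj a b := hS hab
        exact ⟨hadj, h a b hadj hab, h b a hadj.symm (by rwa [Sym2.eq_swap])⟩

/-- After the scan with `seedCmd` the endpoints of the edges of `S` are in the queue, and register
`10` tells whether all edges of `S` block `M`. -/
theorem Ready.scan_seedCmd {s : Store} (h : D.Ready s M) (h9 : s.reg 9 = 0) (h10 : s.reg 10 = 0)
    (ha : ∀ x, s.arr 9 x = 0) :
    let s' := (Phase.scan seedCmd).eval I L s
    D.Ready s' M ∧
      (s'.reg 10 = 0 ↔ ∀ v u, P.graph.Adj v u → s(v, u) ∈ S → P.Wants M v u) ∧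
      ∃ l, Queued s' l ∧ ∀ v, v ∈ l ↔ ∃ u, P.graph.Adj v u ∧ s(v, u) ∈ S := by
  intro s'
  refine ⟨h.evalPhase _ ⟨rfl, rfl⟩ (by decide), ?_⟩
  have := h.scan_induction (c := seedCmd) ⟨rfl, rfl, by decide⟩ (fun s E =>
    (s.reg 10 = 0 ↔ ∀ v u, (v, u) ∈ E → s(v, u) ∈ S → P.Wants M v u) ∧
      ∃ l, Queued s l ∧ ∀ v, v ∈ l ↔ ∃ u, (v, u) ∈ E ∧ s(v, u) ∈ S) ?_ ?_ ?_
  · simpa using this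
  · exact ⟨by simp [h10], [], ⟨by simp, h9, by simp, by simp [ha]⟩, by simp⟩
  · rintro s x E ⟨h1, l, h2, h3⟩
    exact ⟨by simpa using h1, l, h2.congr (by simp) rfl rfl, h3⟩
  · rintro s E v u hr h1 hvu hE ⟨h2, l, hl, hlE⟩
    have hown := hr.read.own' hvu
    by_cases hS : s(v, u) ∈ S
    · have hflag : 0 < I (D.adr v u + 1) :=
        Nat.pos_of_ne_zero fun h => (D.inp_adr_succ hvu).mp h hS
      have hw := hr.holds.wants_iff hvu
      rw [show cur s v = s.arr 8 (v + 1) from rfl] at hw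
      -- the state in which `v` is enqueued
      obtain ⟨s₁, hev, h10, h3, hl₁⟩ : ∃ s₁ : Store, seedCmd.eval I s = enqueueCmd.eval I s₁ ∧
          (s₁.reg 10 = 0 ↔ s.reg 10 = 0 ∧ P.Wants M v u) ∧ s₁.reg 3 = v + 1 ∧ Queued s₁ l := by
        by_cases hwant : P.Wants M v u
        · refine ⟨s.setReg 3 (v + 1), ?_, by simp [hwant], by simp, hl.congr (by simp) rfl rfl⟩
          rcases hw.mp hwant with h0 | h0
          · simp [seedCmd, Cmd.eval, Exp.eval, h1, hflag, hown, h0]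
          · by_cases hz : 0 < s.arr 8 (v + 1)
            · simp [seedCmd, Cmd.eval, Exp.eval, h1, hflag, hown, h0, hz]
            · simp [seedCmd, Cmd.eval, Exp.eval, h1, hflag, hown, hz]
        · refine ⟨(s.setReg 10 1).setReg 3 (v + 1), ?_, by simp [hwant], by simp,
            hl.congr (by simp) rfl rfl⟩
          rw [hw, not_or] at hwant
          have hz : 0 < s.arr 8 (v + 1) := by omega
          simp [seedCmd, Cmd.eval, Exp.eval, h1, hflag, hown, hz, hwant.2]
      rw [hev]
      obtain ⟨l', hl', hmem⟩ := hl₁.enqueue (I := I) h3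
      rw [Cmd.eval_reg (r := 10) enqueueCmd rfl, h10, h2]
      refine ⟨⟨?_, ?_⟩, l ++ l', hl', fun x => ?_⟩
      · rintro ⟨h4, h5⟩ x z hxz hxS
        rcases hxz with he | hxz
        · obtain ⟨rfl, rfl⟩ := Prod.mk.inj he
          exact h5
        · exact h4 x z hxz hxS
      · exact fun h4 => ⟨fun x z hxz => h4 x z (Or.inr hxz), h4 v u (Or.inl rfl) hS⟩
      · rw [hmem, hlE]
        constructor
        · rintro (⟨z, hz, hzS⟩ | rfl)
          · exact ⟨z, Or.inr hz, hzS⟩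
          · exact ⟨u, Or.inl rfl, hS⟩
        · rintro ⟨z, he | hz, hzS⟩
          · exact Or.inr (Prod.mk.inj he).1
          · exact Or.inl ⟨z, hz, hzS⟩
    · have hflag := (D.inp_adr_succ hvu).mpr hS
      have hev : seedCmd.eval I s = s := by
        simp [seedCmd, Cmd.eval, Exp.eval, h1, hflag]
      have hiff : ∀ x z, s(x, z) ∈ S → ((x, z) ∈ insert (v, u) E ↔ (x, z) ∈ E) := by
        refine fun x z hxz => ⟨?_, Or.inr⟩
        rintro (he | hxz')
        · obtain ⟨rfl, rfl⟩ := Prod.mk.inj he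
          exact absurd hxz hS
        · exact hxz'
      rw [hev]
      refine ⟨h2.trans ⟨fun h4 x z hxz hxS => h4 x z ((hiff x z hxS).mp hxz) hxS,
        fun h4 x z hxz hxS => h4 x z ((hiff x z hxS).mpr hxz) hxS⟩, l, hl, fun x =>
        (hlE x).trans ⟨fun ⟨z, hz, hzS⟩ => ⟨z, (hiff x z hzS).mpr hz, hzS⟩,
          fun ⟨z, hz, hzS⟩ => ⟨z, (hiff x z hzS).mp hz, hzS⟩⟩⟩

end Layout

/-! ### The forced vertices -/

/-- Register `2` is an entry of a vertex `m` that is the partner of a forced vertex.  Enqueue the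
neighbour `x` in this entry, if `m` or `x` prefers the other to its partner. -/
def examineCmd : Cmd :=
  .seq (.set 3 (.succ (.inp (.reg 2)))) <|
    .ite (.reg 2) (.arr 8 (.arr 0 (.reg 2))) enqueueCmd <|
      .ite (.lit 0) (.arr 8 (.reg 3))
        (.ite (.arr 7 (.reg 2)) (.arr 8 (.reg 3)) enqueueCmd .skip) enqueueCmd

/-- Find the forced vertices by breadth-first search.  Register `1` is the position in the queue,
and register `2` runs through the list of the partner of the vertex dequeued last. -/
def forcePhase : Phase where
  init := .seq (.set 1 (.lit 0)) (.set 2 (.lit 0))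
  body := .ite (.lit 0) (.arr 0 (.reg 2))
    (.seq examineCmd (.set 2 (.succ (.succ (.reg 2)))))
    (.ite (.reg 1) (.reg 9)
      (.seq (.set 4 (.arr 8 (.arr 10 (.reg 1)))) <|
        .seq (.set 1 (.succ (.reg 1))) <|
        .ite (.lit 0) (.reg 4) (.set 2 (.arr 1 (.succ (.inp (.reg 4))))) .skip)
      .skip)

namespace Layout

variable {n : ℕ} {P : PrefSystem (Fin n)} {A B : Set (Fin n)} {S : Set (Sym2 (Fin n))} {I : ℕ → ℕ}
  {L : ℕ} {D : Layout P A S I L} {M : Set (Sym2 (Fin n))}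

theorem Holds.symm {c : Fin n → ℕ} (h : D.Holds c M) {v u : Fin n} (hvu : P.graph.Adj v u)
    (hc : c v = D.adr v u) : c u = D.adr u v := by
  have hm := (h.mem_iff v u).mpr ⟨hvu, hc⟩
  rw [Sym2.eq_swap] at hm
  exact ((h.mem_iff u v).mp hm).2

theorem Ready.examineCmd {s : Store} (h : D.Ready s M) {l : List (Fin n)} (hl : Queued s l)
    {v m x : Fin n} (hvm : s(v, m) ∈ M) (hmx : P.graph.Adj m x) (h2 : s.reg 2 = D.adr m x) :
    ∃ l', Queued (examineCmd.eval I s) (l ++ l') ∧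
      ∀ u, u ∈ l ++ l' ↔ u ∈ l ∨ u = x ∧ (P.Wants M m x ∨ P.Wants M x m) := by
  obtain ⟨hadj, hcv⟩ := (h.holds.mem_iff v m).mp hvm
  have hcm := h.holds.symm hadj hcv
  have hpos := D.adr_pos (v := m) (u := v)
  have h1 := h.holds.wants_iff hmx
  have h3 := h.holds.wants_iff hmx.symm
  have hown := h.read.own' hmx
  have hlink := h.linked m x hmx
  have hI := D.inp_adr hmx
  rw [show cur s m = s.arr 8 (m + 1) from rfl] at h1 hcm
  rw [show cur s x = s.arr 8 (x + 1) from rfl] at h3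
  have hl₁ : Queued (s.setReg 3 (x + 1)) l := hl.congr (by simp) rfl rfl
  by_cases hw : P.Wants M m x ∨ P.Wants M x m
  · have hev : _root_.examineCmd.eval I s = enqueueCmd.eval I (s.setReg 3 (x + 1)) := by
      by_cases hlt : D.adr m x < s.arr 8 (m + 1)
      · simp [_root_.examineCmd, Cmd.eval, Exp.eval, h2, hown, hI, hlt]
      · have hw' : P.Wants M x m := by
          refine hw.resolve_left fun hc => ?_
          have := h1.mp hc
          omega
        by_cases hz : 0 < s.arr 8 (x + 1)
        · have hlt' : D.adr x m < s.arr 8 (x + 1) := by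
            have := h3.mp hw'
            omega
          simp [_root_.examineCmd, Cmd.eval, Exp.eval, h2, hown, hI, hlt, hz, hlink, hlt']
        · simp [_root_.examineCmd, Cmd.eval, Exp.eval, h2, hown, hI, hlt, hz]
    rw [hev]
    obtain ⟨l', hl', hmem⟩ := hl₁.enqueue (I := I) (v := x) (by simp)
    exact ⟨l', hl', fun u => by rw [hmem]; simp [hw]⟩
  · refine ⟨[], ?_, fun u => by simp [hw]⟩
    rw [h1, h3, not_or] at hw
    have hlt : ¬ D.adr m x < s.arr 8 (m + 1) := by omega
    have hz : 0 < s.arr 8 (x + 1) := by omega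
    have hlt' : ¬ D.adr x m < s.arr 8 (x + 1) := by omega
    have hev : _root_.examineCmd.eval I s = s.setReg 3 (x + 1) := by
      simp [_root_.examineCmd, Cmd.eval, Exp.eval, h2, hown, hI, hlt, hz, hlink, hlt']
    rw [hev, List.append_nil]
    exact hl₁

variable (D)

/-- The invariant of `forcePhase`; `T` consists of the addresses of the dequeued vertices and of the
entries that have been examined. -/
structure ForceInv (M : Set (Sym2 (Fin n))) (s : Store) (m : ℕ) : Prop where
  ready : D.Ready s M
  state : ∃ l, Queued s l ∧ (∀ v u, P.graph.Adj v u → s(v, u) ∈ S → v ∈ l) ∧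
    (∀ v ∈ l, P.Forced M v) ∧ s.reg 1 ≤ l.length ∧
    (∀ m x, P.graph.Adj m x → s.reg 2 = D.adr m x → ∃ v ∈ l.take (s.reg 1), s(v, m) ∈ M) ∧
    (∀ v ∈ l.take (s.reg 1), ∀ m x, s(v, m) ∈ M → P.graph.Adj m x →
      (P.Wants M m x ∨ P.Wants M x m) →
        x ∈ l ∨ ∃ z, P.graph.Adj m z ∧ s.reg 2 = D.adr m z ∧ s.reg 2 ≤ D.adr m x) ∧
    ∃ T ⊆ Finset.range L, (¬ D.IsEntry (s.reg 2) ∧ l.length ≤ s.reg 1 ∨ L - T.card ≤ m) ∧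
      ∀ e ∈ T, ∃ v ∈ l.take (s.reg 1), e = D.hdr v ∨ ∃ m z, s(v, m) ∈ M ∧ P.graph.Adj m z ∧
        e = D.adr m z ∧ ∀ z', P.graph.Adj m z' → s.reg 2 = D.adr m z' → e < s.reg 2

variable {D}

theorem mem_vs_of_forced {v : Fin n} (h : P.Forced M v) : v ∈ D.vs := by
  cases h with
  | seed h => exact D.mem_vs_of_adj (PrefSystem.mk_mem_bp.mp h).1
  | step _ _ hx => exact D.mem_vs_of_adj hx.symm

theorem card_insert_bound {T : Finset ℕ} {e : ℕ} (hT : T ⊆ Finset.range L) (he : e < L)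
    (hne : e ∉ T) : insert e T ⊆ Finset.range L ∧ L - (insert e T).card < L - T.card := by
  have hsub : insert e T ⊆ Finset.range L :=
    Finset.insert_subset (Finset.mem_range.mpr he) hT
  have := Finset.card_le_card hsub
  rw [Finset.card_insert_of_notMem hne, Finset.card_range] at this
  rw [Finset.card_insert_of_notMem hne]
  exact ⟨hsub, by omega⟩

theorem forceInv_step (s : Store) (m : ℕ) (h : D.ForceInv M s m) :
    D.ForceInv M (forcePhase.body.eval I s) (m - 1) := by
  obtain ⟨hr, l, hl, hS, hF, hle, hpos, hcl, T, hT, hb, hTe⟩ := h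
  refine ⟨hr.eval _ rfl (by decide), ?_⟩
  have huniq := hr.holds.isMatching
  by_cases hown : 0 < s.arr 0 (s.reg 2)
  · obtain ⟨w, z, hwz, he⟩ := hr.read.own_pos_iff.mp hown
    obtain ⟨v, hv, hvw⟩ := hpos w z hwz he.symm
    obtain ⟨l', hl', hmem⟩ := hr.examineCmd hl hvw hwz he.symm
    have h1 := Cmd.eval_reg (I := I) (r := 1) examineCmd rfl s
    have h2 := Cmd.eval_reg (I := I) (r := 2) examineCmd rfl s
    have hev : forcePhase.body.eval I s = (examineCmd.eval I s).setReg 2 (D.adr w z + 2) := by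
      simp [forcePhase, Cmd.eval, Exp.eval, hr.read.own' hwz, h2, ← he]
    have htake : (l ++ l').take (s.reg 1) = l.take (s.reg 1) := List.take_append_of_le_length hle
    have hnotT : D.adr w z ∉ T := by
      intro hc
      obtain ⟨v', hv', h3 | ⟨w', z', -, h4, h5, h6⟩⟩ := hTe _ hc
      · exact D.hdr_ne_adr (mem_vs_of_forced (hF v' (List.mem_of_mem_take hv'))) hwz h3.symm
      · obtain ⟨rfl, rfl⟩ := D.adr_inj hwz h4 h5
        have := h6 z hwz he.symm
        omega
    obtain ⟨hT', hcard⟩ := card_insert_bound hT (by have := D.adr_lt_length hwz; omega) hnotT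
    rw [hev]
    refine ⟨l ++ l', hl'.congr (by simp) rfl rfl, fun a u hau haS =>
      List.mem_append_left _ (hS a u hau haS), fun u hu => ?_, ?_, ?_, ?_, insert (D.adr w z) T,
      hT', Or.inr ?_, ?_⟩
    · rcases (hmem u).mp hu with hu | ⟨rfl, hw⟩
      · exact hF u hu
      · exact .step (hF v (List.mem_of_mem_take hv)) hvw hwz hw
    · simp [h1]
      omega
    · intro a x hax hc
      obtain rfl := owner_eq hwz hax (by simpa using hc)
      refine ⟨v, ?_, hvw⟩
      simpa [h1, htake] using hv
    · intro a ha b x hab hbx hw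
      simp only [Store.reg_setReg, h1, htake, if_true, if_neg (show (1 : ℕ) ≠ 2 by decide)] at ha ⊢
      rw [hmem]
      rcases hcl a ha b x hab hbx hw with hx | ⟨y, hby, h3, h4⟩
      · exact Or.inl (Or.inl hx)
      · obtain ⟨rfl, rfl⟩ := D.adr_inj hwz hby (by omega)
        by_cases hxz : D.adr w x = D.adr w z
        · obtain ⟨-, rfl⟩ := D.adr_inj hbx hwz hxz
          exact Or.inl (Or.inr ⟨rfl, hw⟩)
        · right
          rcases D.next hwz with ⟨u', hu', h5⟩ | ⟨-, hlast⟩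
          · have := D.adr_add_two_le hwz hbx (by omega)
            exact ⟨u', hu', h5.symm, by omega⟩
          · have := hlast x hbx
            omega
    · rcases hb with ⟨h3, -⟩ | hb
      · exact absurd ⟨w, z, hwz, he⟩ h3
      · omega
    · intro e he'
      simp only [Store.reg_setReg, h1, htake, if_true, if_neg (show (1 : ℕ) ≠ 2 by decide)]
      rcases Finset.mem_insert.mp he' with rfl | he'
      · exact ⟨v, hv, Or.inr ⟨w, z, hvw, hwz, rfl, fun _ _ _ => by omega⟩⟩
      · obtain ⟨v', hv', h3⟩ := hTe e he'
        refine ⟨v', hv', h3.imp_right ?_⟩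
        rintro ⟨w', z', h4, h5, h6, h7⟩
        refine ⟨w', z', h4, h5, h6, fun y hy hc => ?_⟩
        obtain rfl := owner_eq hwz hy hc
        have := h7 z hwz he.symm
        omega
  · have hent : ¬ D.IsEntry (s.reg 2) := fun hc => hown (hr.read.own_pos_iff.mpr hc)
    have hcl' : ∀ v ∈ l.take (s.reg 1), ∀ m x, s(v, m) ∈ M → P.graph.Adj m x →
        (P.Wants M m x ∨ P.Wants M x m) → x ∈ l := by
      intro a ha b x hab hbx hw
      refine (hcl a ha b x hab hbx hw).resolve_right ?_
      rintro ⟨z, hz, h3, -⟩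
      exact hent ⟨b, z, hz, h3.symm⟩
    by_cases hlt : s.reg 1 < s.reg 9
    · have hlt' : s.reg 1 < l.length := by rw [← hl.length]; exact hlt
      obtain ⟨v, hv⟩ : ∃ v, v = l[s.reg 1] := ⟨_, rfl⟩
      have hvl : v ∈ l := hv ▸ List.getElem_mem hlt'
      have hq : s.arr 10 (s.reg 1) = v + 1 := by rw [hl.arr_queue _ hlt', hv]
      have htake : l.take (s.reg 1 + 1) = l.take (s.reg 1) ++ [v] := by
        rw [hv, List.take_concat_get']
      have hvnot : v ∉ l.take (s.reg 1) := by
        have := hl.nodup.sublist (List.take_sublist (s.reg 1 + 1) l)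
        rw [htake, List.nodup_append] at this
        exact fun hc => this.2.2 v hc v (List.mem_singleton_self v) rfl
      have hvvs : v ∈ D.vs := mem_vs_of_forced (hF v hvl)
      have hnotT : D.hdr v ∉ T := by
        intro hc
        obtain ⟨v', hv', h3 | ⟨w', z', -, h4, h5, -⟩⟩ := hTe _ hc
        · have := D.hdr_inj hvvs (mem_vs_of_forced (hF v' (List.mem_of_mem_take hv'))) h3
          exact hvnot (this ▸ hv')
        · exact D.hdr_ne_adr hvvs h4 h5
      obtain ⟨hT', hcard⟩ := card_insert_bound hT
        (by have := D.block_le_length hvvs; omega) hnotT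
      have hm : L - T.card ≤ m := hb.resolve_left fun hc => by omega
      obtain h0 | ⟨w, hvw, hcw⟩ := hr.holds.eq_zero_or v
      · -- the dequeued vertex is unmatched
        have hnoM : ∀ u, s(v, u) ∉ M := by
          intro u hu
          have := ((hr.holds.mem_iff v u).mp hu).2
          have := D.adr_pos (v := v) (u := u)
          omega
        have hev : forcePhase.body.eval I s = (s.setReg 4 0).setReg 1 (s.reg 1 + 1) := by
          rw [show cur s v = s.arr 8 (v + 1) from rfl] at h0
          simp [forcePhase, Cmd.eval, Exp.eval, hown, hlt, hq, h0]
        have e1 : (forcePhase.body.eval I s).reg 1 = s.reg 1 + 1 := by simp [hev]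
        have e2 : (forcePhase.body.eval I s).reg 2 = s.reg 2 := by simp [hev]
        rw [e1, e2]
        refine ⟨l, ?_⟩
        rw [htake]
        refine ⟨hl.congr (by simp [hev]) (by simp [hev]) (by simp [hev]), hS, hF, hlt',
          fun b x hbx hc => absurd ⟨b, x, hbx, hc.symm⟩ hent, ?_, insert (D.hdr v) T, hT',
          Or.inr (by omega), ?_⟩
        · intro a ha b x hab hbx hw
          rcases List.mem_append.mp ha with ha | ha
          · exact Or.inl (hcl' a ha b x hab hbx hw)
          · rw [List.mem_singleton.mp ha] at hab
            exact absurd hab (hnoM b)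
        · intro e he
          rcases Finset.mem_insert.mp he with rfl | he
          · exact ⟨v, by simp, Or.inl rfl⟩
          · obtain ⟨v', hv', h3⟩ := hTe e he
            exact ⟨v', List.mem_append_left _ hv', h3⟩
      · -- the list of the partner of the dequeued vertex is to be examined
        have hvwM := (hr.holds.mem_iff v w).mpr ⟨hvw, hcw⟩
        have hwvs := D.mem_vs_of_adj hvw.symm
        obtain ⟨u, hwu, hu⟩ := D.first hwvs
        have hstart := hr.read.start w hwvs (by have := D.block_le_length hwvs; omega)
        have hev : forcePhase.body.eval I s =
            ((s.setReg 4 (D.adr v w)).setReg 1 (s.reg 1 + 1)).setReg 2 (D.adr w u) := by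
          rw [show cur s v = s.arr 8 (v + 1) from rfl] at hcw
          have hp := D.adr_pos (v := v) (u := w)
          simp [forcePhase, Cmd.eval, Exp.eval, hown, hlt, hq, hcw, hp, D.inp_adr hvw, hstart, hu]
        have e1 : (forcePhase.body.eval I s).reg 1 = s.reg 1 + 1 := by simp [hev]
        have e2 : (forcePhase.body.eval I s).reg 2 = D.adr w u := by simp [hev]
        rw [e1, e2]
        refine ⟨l, ?_⟩
        rw [htake]
        refine ⟨hl.congr (by simp [hev]) (by simp [hev]) (by simp [hev]), hS, hF, hlt',
          ?_, ?_, insert (D.hdr v) T, hT', Or.inr (by omega), ?_⟩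
        · intro b x hbx hc
          obtain ⟨rfl, -⟩ := D.adr_inj hwu hbx hc
          exact ⟨v, by simp, hvwM⟩
        · intro a ha b x hab hbx hw
          rcases List.mem_append.mp ha with ha | ha
          · exact Or.inl (hcl' a ha b x hab hbx hw)
          · rw [List.mem_singleton.mp ha] at hab
            obtain rfl := huniq.partner_unique hab hvwM
            have := D.hdr_add_two_le (v := b) (u := x)
            exact Or.inr ⟨u, hwu, rfl, by omega⟩
        · intro e he
          rcases Finset.mem_insert.mp he with rfl | he
          · exact ⟨v, by simp, Or.inl rfl⟩
          · obtain ⟨v', hv', h3⟩ := hTe e he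
            refine ⟨v', List.mem_append_left _ hv', h3.imp_right ?_⟩
            rintro ⟨w', z', h4, h5, h6, -⟩
            refine ⟨w', z', h4, h5, h6, fun y hy hc => ?_⟩
            obtain ⟨rfl, -⟩ := D.adr_inj hwu hy hc
            rw [Sym2.eq_swap] at h4 hvwM
            obtain rfl := huniq.partner_unique h4 hvwM
            exact absurd hv' hvnot
    · have hev : forcePhase.body.eval I s = s := by
        simp [forcePhase, Cmd.eval, Exp.eval, hown, hlt]
      have := hl.length
      rw [hev]
      exact ⟨l, hl, hS, hF, hle, hpos, hcl, T, hT, Or.inl ⟨hent, by omega⟩, hTe⟩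

/-- If `S` is the set of blocking edges of `M` and the queue holds their endpoints, then after
`forcePhase` it holds the forced vertices. -/
theorem Ready.forcePhase {s : Store} (h : D.Ready s M) (hbp : P.bp M = S) {l : List (Fin n)}
    (hl : Queued s l) (hS : ∀ v, v ∈ l ↔ ∃ u, P.graph.Adj v u ∧ s(v, u) ∈ S) :
    ∃ l', Queued (forcePhase.eval I L s) l' ∧ ∀ v, v ∈ l' ↔ P.Forced M v := by
  have hfin := _root_.forcePhase.eval_inv (I := I) (L := L) (s := s) (D.ForceInv M) forceInv_step
    (m := L) ?_ (by omega)
  · obtain ⟨hr, l', hl', hS', hF, hle, hpos, hcl, T, hT, hb, hTe⟩ := hfin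
    refine ⟨l', hl', fun v => ⟨hF v, fun hv => ?_⟩⟩
    have hdone : ¬ D.IsEntry ((_root_.forcePhase.eval I L s).reg 2) ∧
        l'.length ≤ (_root_.forcePhase.eval I L s).reg 1 := by
      refine hb.elim id fun hb => ?_
      -- if the search were not finished, then `T` would not contain all numbers below `L`
      have hall : ∀ e < L, e ∈ T := by
        intro e he
        by_contra hc
        have := (card_insert_bound hT he hc).2
        omega
      refine ⟨?_, ?_⟩
      · rintro ⟨w, z, hwz, he⟩
        obtain ⟨v', hv', h3 | ⟨w', z', -, h4, h5, h6⟩⟩ :=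
          hTe _ (hall (D.adr w z) (by have := D.adr_lt_length hwz; omega))
        · exact D.hdr_ne_adr (mem_vs_of_forced (hF v' (List.mem_of_mem_take hv'))) hwz h3.symm
        · obtain ⟨rfl, rfl⟩ := D.adr_inj hwz h4 h5
          have := h6 z hwz he.symm
          omega
      · by_contra hlt
        rw [not_le] at hlt
        have hvvs := mem_vs_of_forced (D := D) (hF _ (List.getElem_mem hlt))
        have hlen := D.block_le_length hvvs
        obtain ⟨v', hv', h3 | ⟨w', z', -, h4, h5, -⟩⟩ := hTe _ (hall _
          (show D.hdr l'[(_root_.forcePhase.eval I L s).reg 1] < L by omega))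
        · have heq := D.hdr_inj hvvs (mem_vs_of_forced (hF v' (List.mem_of_mem_take hv'))) h3
          obtain ⟨i, hi, hi'⟩ := List.mem_take_iff_getElem.mp (heq ▸ hv')
          have := (hl'.nodup.getElem_inj_iff).mp hi'
          omega
        · exact D.hdr_ne_adr hvvs h4 h5
    rw [List.take_of_length_le hdone.2] at hcl
    induction hv with
    | seed hab =>
      exact hS' _ _ (PrefSystem.mk_mem_bp.mp hab).1 (hbp ▸ hab)
    | step _ hm hx hw ih =>
      refine (hcl _ ih _ _ hm hx hw).resolve_right ?_
      rintro ⟨z, hz, he, -⟩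
      exact hdone.1 ⟨_, z, hz, he.symm⟩
  · have e1 : (_root_.forcePhase.init.eval I s).reg 1 = 0 := by
      simp [_root_.forcePhase, Cmd.eval, Exp.eval]
    have e2 : (_root_.forcePhase.init.eval I s).reg 2 = 0 := by
      simp [_root_.forcePhase, Cmd.eval, Exp.eval]
    refine ⟨h.eval _ rfl (by decide), l, hl.congr (Cmd.eval_reg _ rfl s) rfl rfl,
      fun v u hvu hvS => (hS v).mpr ⟨u, hvu, hvS⟩, fun v hv => ?_, ?_, ?_, ?_, ∅, by simp,
      Or.inr (by simp), by simp⟩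
    · obtain ⟨u, -, hvu⟩ := (hS v).mp hv
      exact .seed (hbp.symm ▸ hvu)
    · omega
    · intro b x hbx hc
      exact absurd ⟨b, x, hbx, by rw [← hc, e2]⟩ D.not_isEntry_zero
    · simp [e1]

end Layout

/-! ### The answer -/

/-- Put `1` into register `10` if the owner of the entry in register `1` is forced and it is not
matched to a vertex that is not forced. -/
def checkCmd : Cmd :=
  .ite (.lit 0) (.arr 9 (.arr 0 (.reg 1)))
    (.seq (.set 3 (.arr 8 (.arr 0 (.reg 1)))) <|
      .ite (.lit 0) (.reg 3)
        (.ite (.lit 0) (.arr 9 (.succ (.inp (.reg 3)))) (.set 10 (.lit 1)) .skip)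
        (.set 10 (.lit 1)))
    .skip

/-- Write the edge of the entry in register `1` to the output if it is an edge of the matching and
this is the first of its two entries.  Register `11` is the number of the edges written, and
register `12` the next cell of the output. -/
def outputCmd : Cmd :=
  .seq (.set 3 (.arr 8 (.arr 0 (.reg 1)))) <|
    .ite (.reg 3) (.reg 1) .skip <|
      .ite (.reg 1) (.reg 3) .skip <|
        .ite (.reg 1) (.arr 7 (.reg 1))
          (.seq (.out (.reg 12) (.pred (.arr 0 (.reg 1)))) <|
            .seq (.out (.succ (.reg 12)) (.inp (.reg 1))) <|
            .seq (.set 12 (.succ (.succ (.reg 12)))) (.set 11 (.succ (.reg 11))))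
          .skip

/-- The algorithm for Popularity with Fixed Instability. -/
def solvePhases : List Phase :=
  [readPhase, linkPhase, proposePhase, .scan seedCmd, forcePhase, .scan checkCmd, .scan outputCmd]

namespace Layout

variable {n : ℕ} {P : PrefSystem (Fin n)} {A B : Set (Fin n)} {S : Set (Sym2 (Fin n))} {I : ℕ → ℕ}
  {L : ℕ} {D : Layout P A S I L} {M : Set (Sym2 (Fin n))}

/-- If an edge of `S` does not block `M`, then register `10` keeps the verdict. -/
theorem Ready.reg_ne_zero_scan_checkCmd {s : Store} (h : D.Ready s M) (h10 : s.reg 10 ≠ 0) :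
    ((Phase.scan checkCmd).eval I L s).reg 10 ≠ 0 := by
  refine h.scan_induction (c := checkCmd) ⟨rfl, rfl, by decide⟩ (fun s _ => s.reg 10 ≠ 0) h10
    (fun s x _ hs => by simpa using hs) fun s _ v u _ _ _ _ hs => ?_
  by_cases c₁ : 0 < s.arr 9 (s.arr 0 (s.reg 1)) <;>
    by_cases c₂ : 0 < s.arr 8 (s.arr 0 (s.reg 1)) <;>
    by_cases c₃ : 0 < s.arr 9 (I (s.arr 8 (s.arr 0 (s.reg 1))) + 1) <;>
    simp [checkCmd, Cmd.eval, Exp.eval, c₁, c₂, c₃, hs]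

/-- If the queue holds the forced vertices, then `checkCmd` tests the criterion for popularity. -/
theorem Ready.scan_checkCmd {s : Store} (h : D.Ready s M) {l : List (Fin n)} (hl : Queued s l)
    (h10 : s.reg 10 = 0) :
    ((Phase.scan checkCmd).eval I L s).reg 10 = 0 ↔
      ∀ v u, P.graph.Adj v u → v ∈ l → ∃ m, s(v, m) ∈ M ∧ m ∉ l := by
  have := h.scan_induction (c := checkCmd) ⟨rfl, rfl, by decide⟩ (fun s E => Queued s l ∧
    (s.reg 10 = 0 ↔ ∀ v u, (v, u) ∈ E → v ∈ l → ∃ m, s(v, m) ∈ M ∧ m ∉ l)) ?_ ?_ ?_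
  · exact this.2
  · exact ⟨hl, by simp [h10]⟩
  · rintro s x E ⟨h1, h2⟩
    exact ⟨h1.congr (by simp) rfl rfl, by simpa using h2⟩
  · rintro s E v u hr h1 hvu hE ⟨hl, h2⟩
    have hown := hr.read.own' hvu
    refine ⟨hl.congr (Cmd.eval_reg _ rfl s) (Cmd.eval_arr _ rfl s) (Cmd.eval_arr _ rfl s), ?_⟩
    have key : (checkCmd.eval I s).reg 10 = 0 ↔
        s.reg 10 = 0 ∧ (v ∈ l → ∃ m, s(v, m) ∈ M ∧ m ∉ l) := by
      have hmark := hl.arr_mark v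
      by_cases hv : v ∈ l
      · have hpos := Nat.pos_of_ne_zero (hmark.mpr hv)
        obtain h0 | ⟨m, hvm, hc⟩ := hr.holds.eq_zero_or v
        · have hno : ¬ ∃ m, s(v, m) ∈ M ∧ m ∉ l := by
            rintro ⟨m, hm, -⟩
            have := ((hr.holds.mem_iff v m).mp hm).2
            have := D.adr_pos (v := v) (u := m)
            omega
          rw [show cur s v = s.arr 8 (v + 1) from rfl] at h0
          simp [checkCmd, Cmd.eval, Exp.eval, h1, hown, hpos, h0, hv, hno]
        · have hM := (hr.holds.mem_iff v m).mpr ⟨hvm, hc⟩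
          have hiff : (∃ m, s(v, m) ∈ M ∧ m ∉ l) ↔ m ∉ l := by
            refine ⟨?_, fun hm => ⟨m, hM, hm⟩⟩
            rintro ⟨m', hm', hml⟩
            rwa [hr.holds.isMatching.partner_unique hM hm']
          have hmark' := hl.arr_mark m
          have hI := D.inp_adr hvm
          have hp := D.adr_pos (v := v) (u := m)
          rw [show cur s v = s.arr 8 (v + 1) from rfl] at hc
          rw [hiff]
          by_cases hml : m ∈ l
          · have hpos' := Nat.pos_of_ne_zero (hmark'.mpr hml)
            simp [checkCmd, Cmd.eval, Exp.eval, h1, hown, hpos, hc, hp, hI, hpos', hv, hml]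
          · have hz : s.arr 9 (m + 1) = 0 := by
              by_contra hne
              exact hml (hmark'.mp hne)
            simp [checkCmd, Cmd.eval, Exp.eval, h1, hown, hpos, hc, hp, hI, hz, hv, hml]
      · have hz : s.arr 9 (v + 1) = 0 := by
          by_contra hne
          exact hv (hmark.mp hne)
        simp [checkCmd, Cmd.eval, Exp.eval, h1, hown, hz, hv]
    rw [key, h2]
    constructor
    · rintro ⟨h3, h4⟩ x z hxz
      rcases hxz with he | hxz
      · obtain ⟨rfl, rfl⟩ := Prod.mk.inj he
        exact h4
      · exact h3 x z hxz
    · exact fun h3 => ⟨fun x z hxz => h3 x z (Or.inr hxz), h3 v u (Or.inl rfl)⟩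

/-- The output area of `s` lists the pairs in `ps`. -/
structure Listed (s : Store) (ps : List (Fin n × Fin n)) : Prop where
  length : s.reg 11 = ps.length
  pos : s.reg 12 = 2 * ps.length
  out : ∀ i (h : i < ps.length), s.out (2 * i) = ps[i].1 ∧ s.out (2 * i + 1) = ps[i].2

/-- Each edge of `M` is written once, at the first of its two entries. -/
theorem Ready.scan_outputCmd {s : Store} (h : D.Ready s M) (h11 : s.reg 11 = 0)
    (h12 : s.reg 12 = 0) :
    ∃ ps : List (Fin n × Fin n), Listed ((Phase.scan outputCmd).eval I L s) ps ∧
      ps.length ≤ L ∧ (ps.map fun q => s(q.1, q.2)).Nodup ∧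
      ∀ e, e ∈ M ↔ e ∈ ps.map fun q => s(q.1, q.2) := by
  have := h.scan_induction (c := outputCmd) ⟨rfl, rfl, by decide⟩ (fun s E =>
    ∃ ps : List (Fin n × Fin n), Listed s ps ∧ (ps.map fun q => s(q.1, q.2)).Nodup ∧
      ∀ v u, (v, u) ∈ ps ↔ (v, u) ∈ E ∧ s(v, u) ∈ M ∧ D.adr v u < D.adr u v) ?_ ?_ ?_
  · obtain ⟨ps, h1, h2, h3⟩ := this
    have hadj : ∀ v u, (v, u) ∈ ps → P.graph.Adj v u := fun v u hvu => ((h3 v u).mp hvu).1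
    refine ⟨ps, h1, ?_, h2, fun e => ?_⟩
    · have hnd : (ps.map fun q => D.adr q.1 q.2).Nodup := by
        refine List.Nodup.map_on ?_ (List.Nodup.of_map _ h2)
        rintro ⟨v, u⟩ hvu ⟨v', u'⟩ hvu' he
        obtain ⟨rfl, rfl⟩ := D.adr_inj (hadj _ _ hvu) (hadj _ _ hvu') he
        rfl
      have hsub : (ps.map fun q => D.adr q.1 q.2).toFinset ⊆ Finset.range L := by
        intro x hx
        obtain ⟨⟨v, u⟩, hvu, rfl⟩ := List.mem_map.mp (List.mem_toFinset.mp hx)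
        have := D.adr_lt_length (hadj _ _ hvu)
        exact Finset.mem_range.mpr (show D.adr v u < L by omega)
      have := Finset.card_le_card hsub
      rwa [List.toFinset_card_of_nodup hnd, List.length_map, Finset.card_range] at this
    · rw [List.mem_map]
      constructor
      · induction e using Sym2.ind with
        | _ v u =>
          intro hvu
          have hadj' := ((h.holds.mem_iff v u).mp hvu).1
          rcases lt_trichotomy (D.adr v u) (D.adr u v) with hlt | heq | hlt
          · exact ⟨(v, u), (h3 v u).mpr ⟨hadj', hvu, hlt⟩, rfl⟩
          · exact absurd (D.adr_inj hadj' hadj'.symm heq).1 hadj'.ne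
          · exact ⟨(u, v), (h3 u v).mpr ⟨hadj'.symm, by rwa [Sym2.eq_swap], hlt⟩, Sym2.eq_swap⟩
      · rintro ⟨⟨v, u⟩, hvu, rfl⟩
        exact ((h3 v u).mp hvu).2.1
  · exact ⟨[], ⟨h11, h12, by simp⟩, by simp, by simp⟩
  · rintro s x E ⟨ps, ⟨h1, h2, h3⟩, h4⟩
    exact ⟨ps, ⟨by simpa using h1, by simpa using h2, h3⟩, h4⟩
  · rintro s E v u hr h1 hvu hE ⟨ps, hps, hnd, hmem⟩
    have hown := hr.read.own' hvu
    have hlink := hr.linked v u hvu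
    have hM := hr.holds.mem_iff v u
    rw [show cur s v = s.arr 8 (v + 1) from rfl] at hM
    by_cases hout : s(v, u) ∈ M ∧ D.adr v u < D.adr u v
    · have hc := (hM.mp hout.1).2
      have hev : outputCmd.eval I s = ((((s.setReg 3 (D.adr v u)).setOut (2 * ps.length) v).setOut
          (2 * ps.length + 1) u).setReg 12 (2 * ps.length + 2)).setReg 11 (ps.length + 1) := by
        simp [outputCmd, Cmd.eval, Exp.eval, h1, hown, hc, hlink, hout.2, hps.pos, hps.length,
          D.inp_adr hvu]
      rw [hev]
      refine ⟨ps ++ [(v, u)], ⟨by simp, by simp; ring, fun i hi => ?_⟩, ?_, fun x z => ?_⟩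
      · rcases lt_or_ge i ps.length with hlt | hge
        · have := hps.out i hlt
          have h4 : 2 * i ≠ 2 * ps.length + 1 := by omega
          have h5 : 2 * i + 1 ≠ 2 * ps.length := by omega
          simp [List.getElem_append_left hlt, this, h4, h5, hlt.ne]
        · have hi' : i = ps.length := by simp at hi; omega
          subst hi'
          simp
      · rw [List.map_append, List.nodup_append]
        refine ⟨hnd, by simp, fun e he f hf hef => ?_⟩
        obtain ⟨⟨x, z⟩, hxz, rfl⟩ := List.mem_map.mp he
        obtain ⟨h4, h5, h6⟩ := (hmem x z).mp hxz
        simp only [List.map_cons, List.map_nil, List.mem_singleton] at hf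
        rcases Sym2.eq_iff.mp (hef.trans hf) with ⟨rfl, rfl⟩ | ⟨rfl, rfl⟩
        · exact hE h4
        · exact absurd hout.2 (not_lt.mpr h6.le)
      · rw [List.mem_append, hmem, List.mem_singleton, Set.mem_insert_iff]
        constructor
        · rintro (⟨h4, h5⟩ | h4)
          · exact ⟨Or.inr h4, h5⟩
          · obtain ⟨rfl, rfl⟩ := Prod.mk.inj h4
            exact ⟨Or.inl rfl, hout⟩
        · rintro ⟨h4 | h4, h5⟩
          · exact Or.inr h4
          · exact Or.inl ⟨h4, h5⟩
    · have hev : outputCmd.eval I s = s.setReg 3 (s.arr 8 (v + 1)) := by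
        by_cases hc : s.arr 8 (v + 1) = D.adr v u
        · have hlt : ¬ D.adr v u < D.adr u v := fun hlt => hout ⟨hM.mpr ⟨hvu, hc⟩, hlt⟩
          simp [outputCmd, Cmd.eval, Exp.eval, h1, hown, hc, hlink, hlt]
        · rcases Nat.lt_or_gt_of_ne hc with hlt | hlt
          · simp [outputCmd, Cmd.eval, Exp.eval, h1, hown, hlt]
          · simp [outputCmd, Cmd.eval, Exp.eval, h1, hown, hlt]
      rw [hev]
      refine ⟨ps, ⟨by simpa using hps.length, by simpa using hps.pos, hps.out⟩, hnd, fun x z => ?_⟩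
      rw [hmem, Set.mem_insert_iff]
      constructor
      · rintro ⟨h4, h5⟩
        exact ⟨Or.inr h4, h5⟩
      · rintro ⟨h4 | h4, h5⟩
        · obtain ⟨rfl, rfl⟩ := Prod.mk.inj h4
          exact absurd h5 hout
        · exact ⟨h4, h5⟩

/-- Register `10` holds `0` at the end if and only if there is a solution, and in this case the
output lists the edges of a solution. -/
theorem evalPhases_solvePhases (D : Layout P A S I L) (h : P.IsMasterListInstance A B S) :
    let s := evalPhases I L solvePhases (Store.start L)
    ((∃ M, P.IsSolution S M) → s.reg 10 = 0 ∧ ∃ M, P.IsSolution S M ∧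
      ∃ ps : List (Fin n × Fin n), Listed s ps ∧ ps.length ≤ L ∧
        (ps.map fun q => s(q.1, q.2)).Nodup ∧ ∀ e, e ∈ M ↔ e ∈ ps.map fun q => s(q.1, q.2)) ∧
    ((¬ ∃ M, P.IsSolution S M) → s.reg 10 ≠ 0) := by
  intro s
  set s₁ := readPhase.eval I L (Store.start L) with hs₁
  set s₂ := linkPhase.eval I L s₁ with hs₂
  set s₃ := proposePhase.eval I L s₂ with hs₃
  set s₄ := (Phase.scan seedCmd).eval I L s₃ with hs₄
  set s₅ := forcePhase.eval I L s₄ with hs₅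
  set s₆ := (Phase.scan checkCmd).eval I L s₅ with hs₆
  have hs : s = (Phase.scan outputCmd).eval I L s₆ := rfl
  have h1 := D.read_readPhase
  have hreg1 : ∀ r, readPhase.init.WritesReg r = false → readPhase.body.WritesReg r = false →
      s₁.reg r = (Store.start L).reg r := fun r h h' => Phase.eval_reg readPhase h h' _
  have h20 : s₁.reg 0 = L := hreg1 0 rfl rfl
  have h2 := D.linked_linkPhase h1 h20
  have h2r : D.Read s₂ L := h1.congr (Phase.eval_arr _ rfl rfl _) (Phase.eval_arr _ rfl rfl _)
    (Phase.eval_arr _ rfl rfl _) (Phase.eval_arr _ rfl rfl _) (Phase.eval_arr _ rfl rfl _)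
    (Phase.eval_arr _ rfl rfl _)
  have h30 : s₂.reg 0 = L := (Phase.eval_reg linkPhase rfl rfl s₁).trans h20
  have h38 : ∀ x, s₂.arr 8 x = 0 := fun x => by
    rw [hs₂, Phase.eval_arr linkPhase rfl rfl, hs₁, Phase.eval_arr readPhase rfl rfl]
    rfl
  obtain ⟨M, hM, hholds⟩ := D.holds_proposePhase h.bipartite h2r h2 h30 h38
  have hready₃ : D.Ready s₃ M := by
    refine ⟨(Phase.eval_reg proposePhase rfl rfl s₂).trans h30, h2r.congr
      (Phase.eval_arr _ rfl rfl _) (Phase.eval_arr _ rfl rfl _) (Phase.eval_arr _ rfl rfl _)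
      (Phase.eval_arr _ rfl rfl _) (Phase.eval_arr _ rfl rfl _) (Phase.eval_arr _ rfl rfl _),
      fun v u hvu => ?_, hholds⟩
    rw [hs₃, Phase.eval_arr proposePhase rfl rfl, h2 v u hvu]
  have hreg₃ : s₃.reg 9 = 0 ∧ s₃.reg 10 = 0 ∧ s₃.reg 11 = 0 ∧ s₃.reg 12 = 0 := by
    refine ⟨?_, ?_, ?_, ?_⟩ <;>
    · rw [hs₃, Phase.eval_reg proposePhase rfl rfl, hs₂, Phase.eval_reg linkPhase rfl rfl, hs₁,
        Phase.eval_reg readPhase rfl rfl]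
      rfl
  have harr₃ : ∀ x, s₃.arr 9 x = 0 := fun x => by
    rw [hs₃, Phase.eval_arr proposePhase rfl rfl, hs₂, Phase.eval_arr linkPhase rfl rfl, hs₁,
      Phase.eval_arr readPhase rfl rfl]
    rfl
  obtain ⟨hready₄, hbad₄, l, hl, hlmem⟩ := hready₃.scan_seedCmd hreg₃.1 hreg₃.2.1 harr₃
  have hready₅ : D.Ready s₅ M := hready₄.evalPhase forcePhase ⟨rfl, rfl⟩ (by decide)
  have hready₆ : D.Ready s₆ M := hready₅.evalPhase (.scan checkCmd) ⟨rfl, rfl⟩ (by decide)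
  have hreg₅ : s₅.reg 10 = s₄.reg 10 := Phase.eval_reg forcePhase rfl rfl s₄
  have hreg₆ : s.reg 10 = s₆.reg 10 := Phase.eval_reg (.scan outputCmd) rfl rfl s₆
  rw [← isStable_deleteEdges_iff_bp h.subset hM] at hbad₄
  -- the only candidate is the matching that deferred acceptance has found
  have hsol : (∃ M', P.IsSolution S M') → P.IsSolution S M := by
    rintro ⟨M', hM'⟩
    obtain ⟨M₀, -, huniq⟩ := h.existsUnique_isStable
    rwa [huniq M hM, ← huniq M' hM'.isStable_deleteEdges]
  have hbad : s.reg 10 = 0 ↔ P.IsSolution S M := by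
    rw [hreg₆]
    by_cases hbp : P.bp M = S
    · obtain ⟨l', hl', hmem'⟩ := hready₄.forcePhase hbp hl hlmem
      rw [hready₅.scan_checkCmd hl' (hreg₅.trans (hbad₄.mpr hbp)), PrefSystem.IsSolution,
        hholds.isMatching.isPopular_iff h.bipartite]
      constructor
      · intro hc
        refine ⟨fun v hv => ?_, hbp⟩
        obtain ⟨u, hvu, -⟩ := D.first (mem_vs_of_forced hv)
        obtain ⟨m, hm, hml⟩ := hc v u hvu ((hmem' v).mpr hv)
        exact ⟨m, hm, fun hf => hml ((hmem' m).mpr hf)⟩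
      · rintro ⟨hc, -⟩ v u - hv
        obtain ⟨m, hm, hmf⟩ := hc v ((hmem' v).mp hv)
        exact ⟨m, hm, fun hml => hmf ((hmem' m).mp hml)⟩
    · have hne : s₆.reg 10 ≠ 0 := hready₅.reg_ne_zero_scan_checkCmd (by
        rw [hreg₅]
        exact fun h0 => hbp (hbad₄.mp h0))
      exact ⟨fun h0 => absurd h0 hne, fun hs => absurd hs.2 hbp⟩
  refine ⟨fun hex => ⟨hbad.mpr (hsol hex), M, hsol hex, ?_⟩, fun hno h0 => hno ⟨M, hbad.mp h0⟩⟩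
  refine hready₆.scan_outputCmd ?_ ?_
  · rw [hs₆, Phase.eval_reg (.scan checkCmd) rfl rfl, hs₅, Phase.eval_reg forcePhase rfl rfl, hs₄,
      Phase.eval_reg (.scan seedCmd) rfl rfl, hreg₃.2.2.1]
  · rw [hs₆, Phase.eval_reg (.scan checkCmd) rfl rfl, hs₅, Phase.eval_reg forcePhase rfl rfl, hs₄,
      Phase.eval_reg (.scan seedCmd) rfl rfl, hreg₃.2.2.2]

end Layout

/-- The input has at most `8 * |E| + 2` words, and each of them is at most the number of vertices
plus the length of the input; this is where the constant comes from. -/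
theorem exists_solvesInLinearTime : ∃ p : RamProg, SolvesInLinearTime p := by
  obtain ⟨p, K, hp⟩ := exists_program solvePhases 10 11
  refine ⟨p, 20 * K, fun n P A B S h w hw => ?_⟩
  obtain ⟨⟨D⟩, ⟨bl, hbl⟩, hβ, hlen⟩ := hw.exists_layout h
  obtain ⟨t, m, hex, ht, h0, h1, h2, hout⟩ := hp w bl (n + w.length)
    (20 * K * (n + P.edges.ncard + 1)) hbl hβ (by
      rw [mul_comm 20 K, mul_assoc]
      exact Nat.mul_le_mul_left K (by omega))
  refine ⟨t, m, hex, ht.trans ?_, ?_⟩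
  · rw [mul_comm 20 K, mul_assoc]
    exact Nat.mul_le_mul_left K (by omega)
  · obtain ⟨hyes, hno⟩ := D.evalPhases_solvePhases h
    refine ⟨fun hs => ?_, fun hs => ?_⟩
    · obtain ⟨hr, M, hM, ps, hps, hL, hnd, hmem⟩ := hyes hs
      refine ⟨by rw [h0, hr], M, hM, ps, hnd, hmem, by rw [h2, hps.length], fun i hi => ?_⟩
      have := hps.out i hi
      rw [h1, add_assoc, hout _ (by omega), hout _ (by omega)]
      exact this
    · have := hno hs
      rw [h0]
      omega

theorem mainTheorem8 :
    (∃ p : RamProg, SolvesInLinearTime p) ∧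
    (∀ (V : Type*) [Finite V] (P : PrefSystem V) (A B : Set V) (S : Set (Sym2 V)),
      P.IsMasterListInstance A B S →
        ∃ M₀ : Set (Sym2 V),
          (P.deleteEdges S).IsStable M₀ ∧
          (∀ M, (P.deleteEdges S).IsStable M → M = M₀) ∧
          (∀ M, P.IsSolution S M → M = M₀)) := by
  refine ⟨exists_solvesInLinearTime, fun V _ P A B S h => ?_⟩
  obtain ⟨M₀, hM₀, huniq⟩ := h.existsUnique_isStable
  exact ⟨M₀, hM₀, huniq, fun M hM => huniq M hM.isStable_deleteEdges⟩
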